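/- Fix $n\ge 1$. A DNF formula $\varphi=T_1\vee\dots\vee T_k$ over $n$ Boolean variables is a disjunction of $k$ terms, a term being a conjunction of literals; $k$ is the size of $\varphi$, and the DNF set of $\varphi$ is the set $S_\varphi\subseteq\{0,1\}^n$ of its satisfying assignments. For a finite stream $\varphi_1,\dots,\varphi_M$ of DNF formulas over $n$ variables let $F_0=\bigl|\bigcup_{i}S_{\varphi_i}\bigr|$. A streaming algorithm is given $n$, rational numbers $\varepsilon>0$ and $\delta\in(0,1]$, and a number (computed by the algorithm) of independent fair random bits; it initialises its memory, a bit string, then processes the items of the stream one after the other, keeping nothing between two items except its memory (which includes the hash functions it has drawn and all parameters it still needs), and at the end computes from its memory an estimate $c\in\mathbb{Q}$. All phases are carried out by fixed multi-stack (multitape) Turing machines, the same for all $n,\varepsilon,\delta$. Space is the number of bits of the memory kept between items; the processing time of an item is the number of Turing machine steps from reading the memory and the item to having written the new memory. **Theorem.** There are a streaming algorithm and a constant $C$ such that for all $n\ge1$, all rational $\varepsilon>0$ and $\delta\in(0,1]$, the following holds. 1. For every stream of DNF formulas over $n$ variables (of any length, including the empty stream) the estimate $c$ satisfies $$\Pr\Bigl[\tfrac{F_0}{1+\varepsilon}\le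 c\le(1+\varepsilon)F_0\Bigr]\ge 1-\delta .$$ 2. For every choice of the random bits, the algorithm always halts, in initialisation, at each item and in reporting; its space is, at all times, at most $$C\cdot n\cdot\max\bigl(1,\tfrac1{\varepsilon^2}\bigr)\cdot\max\bigl(1,\log\tfrac1\delta\bigr);$$ and its processing time for an item with $k$ terms is at most $$C\cdot n^4\cdot\max(1,k)\cdot\max\bigl(1,\tfrac1{\varepsilon^2}\bigr)\cdot\max\bigl(1,\log\tfrac1\delta\bigr).$$ In particular, for $\varepsilon\le1$, $\delta\le\frac12$ and $k\ge1$ the space is $O\bigl(\frac n{\varepsilon^2}\log\frac1\delta\bigr)$ and the processing time per item is $O\bigl(n^4\cdot k\cdot\frac1{\varepsilon^2}\cdot\log\frac1\delta\bigr)$. -/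

import Mathlib

namespace DNFStream

/-! ### DNF formulas, DNF sets and `F₀` -/

/-- A literal over the variables `x₀, …, xₙ₋₁`: the pair `(i, b)` is `xᵢ` if `b = true` and `¬ xᵢ` if
`b = false`. -/
abbrev Literal (n : ℕ) := Fin n × Bool

/-- A term is a conjunction of literals, given by the set of its literals. It may contain a variable
together with its negation, and it may be empty. -/
abbrev Term (n : ℕ) := Finset (Literal n)

/-- A DNF formula over `n` variables is a disjunction of terms; its size is the number of terms,
i.e. the length of the list. -/
abbrev DNF (n : ℕ) := List (Term n)

/-- The assignment `x ∈ {0,1}ⁿ` satisfies the DNF formula `φ`. -/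
def Sat {n : ℕ} (φ : DNF n) (x : Fin n → Bool) : Prop :=
  ∃ T ∈ φ, ∀ l ∈ T, x l.1 = l.2

/-- The DNF set of `φ`: its satisfying assignments. -/
def dnfSet {n : ℕ} (φ : DNF n) : Set (Fin n → Bool) :=
  {x | Sat φ x}

/-- `F₀` of a stream of DNF sets: the number of elements of the union of the sets. -/
noncomputable def F0 {n : ℕ} (stream : List (DNF n)) : ℕ :=
  (⋃ φ ∈ stream, dnfSet φ).ncard

/-! ### Encodings -/

/-- A term over `n` variables is written as a marker followed by `2n` bits, which say for each
variable whether it occurs positively and whether it occurs negated. -/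
def encodeTerm {n : ℕ} (T : Term n) : List (Option Bool) :=
  none :: (List.finRange n).flatMap fun i =>
    [some (decide ((i, true) ∈ T)), some (decide ((i, false) ∈ T))]

/-- A DNF formula is written term by term. -/
def encodeDNF {n : ℕ} (φ : DNF n) : List (Option Bool) :=
  φ.flatMap encodeTerm

/-- The parameters `n`, `ε`, `δ`: the binary expansions of `n` and of the numerators and denominators
of `ε` and `δ`, each followed by a separator. -/
def encodeParams (n : ℕ) (ε δ : ℚ) : List (Option Bool) :=
  [n, ε.num.natAbs, ε.den, δ.num.natAbs, δ.den].flatMap fun a => a.bits.map some ++ [none]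

/-- The natural number with the given binary digits, least significant digit first; leading zeros
are allowed. -/
def ofBits (l : List Bool) : ℕ :=
  Nat.ofDigits 2 (l.map Bool.toNat)

/-! ### Streaming algorithms

The machine model is Mathlib's `Turing.FinTM2`: Turing machines with finitely many stacks (a work tape
is a pair of stacks), finitely many labels and finitely many internal states. Time is the number of
steps. -/

/-- A Turing machine with input alphabet `Γ₀` and output alphabet `Γ₁`. -/
abbrev Machine (Γ₀ Γ₁ : Type) := Turing.TM2ComputableAux Γ₀ Γ₁

/-- On input `x` the machine `M` halts after at most `t` steps with output `y`. -/
def Machine.OutputsWithin {Γ₀ Γ₁ : Type} (M : Machine Γ₀ Γ₁) (x : List Γ₀) (y : List Γ₁) (t : ℕ) :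
    Prop :=
  Nonempty (Turing.TM2OutputsInTime M.tm (x.map M.inputAlphabet.symm)
    (some (y.map M.outputAlphabet.symm)) t)

/-- On input `x` the machine `M` halts with output `y`. -/
def Machine.Outputs {Γ₀ Γ₁ : Type} (M : Machine Γ₀ Γ₁) (x : List Γ₀) (y : List Γ₁) : Prop :=
  ∃ t, M.OutputsWithin x y t

/-- A streaming algorithm for DNF sets. It consists of four Turing machines, the same ones for all
values of the parameters, and it draws all its random bits before it reads the stream. Between two
items of the stream all that it keeps is a bit string, its memory. -/
structure StreamingAlgorithm where
  /-- computes from the parameters how many random bits are drawn (in unary) -/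
  coins : Machine (Option Bool) Unit
  /-- computes from the parameters and the random bits the initial memory -/
  init : Machine (Option Bool) Bool
  /-- computes from the memory and the next item of the stream the new memory -/
  update : Machine (Bool ⊕ Option Bool) Bool
  /-- computes from the memory the estimate, a fraction in binary -/
  report : Machine Bool (Option Bool)

namespace StreamingAlgorithm

variable (A : StreamingAlgorithm)

/-- For the parameters `n`, `ε`, `δ` the algorithm draws exactly `R` random bits. -/
def Draws (n : ℕ) (ε δ : ℚ) (R : ℕ) : Prop :=
  A.coins.Outputs (encodeParams n ε δ) (List.replicate R ())

/-- With parameters `n`, `ε`, `δ` and random bits `r` the initial memory is `s`. -/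
def Starts (n : ℕ) (ε δ : ℚ) {R : ℕ} (r : Fin R → Bool) (s : List Bool) : Prop :=
  A.init.Outputs (encodeParams n ε δ ++ (List.ofFn r).map some) s

/-- With memory `s` the algorithm processes the item `φ` in at most `t` steps and its memory is then
`s'`. -/
def UpdatesWithin {n : ℕ} (s : List Bool) (φ : DNF n) (s' : List Bool) (t : ℕ) : Prop :=
  A.update.OutputsWithin (s.map Sum.inl ++ (encodeDNF φ).map Sum.inr) s' t

/-- With parameters `n`, `ε`, `δ` and random bits `r` the memory is `s` after the given stream. -/
inductive MemoryAfter {n : ℕ} (ε δ : ℚ) {R : ℕ} (r : Fin R → Bool) :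
    List (DNF n) → List Bool → Prop
  | start {s : List Bool} (h : A.Starts n ε δ r s) : MemoryAfter ε δ r [] s
  | item {stream : List (DNF n)} {s s' : List Bool} {φ : DNF n} {t : ℕ}
      (h : MemoryAfter ε δ r stream s) (hu : A.UpdatesWithin s φ s' t) :
      MemoryAfter ε δ r (stream ++ [φ]) s'

/-- With memory `s` the algorithm returns the estimate `c`. -/
def Reports (s : List Bool) (c : ℚ) : Prop :=
  ∃ a b : List Bool, A.report.Outputs s (a.map some ++ none :: b.map some) ∧
    c = (ofBits a : ℚ) / (ofBits b : ℚ)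

/-- With random bits `r` the algorithm, run on the given stream, returns an estimate that is within a
factor `1 + ε` of `F₀`. -/
def Succeeds {n : ℕ} (ε δ : ℚ) {R : ℕ} (r : Fin R → Bool) (stream : List (DNF n)) : Prop :=
  ∃ s c, A.MemoryAfter ε δ r stream s ∧ A.Reports s c ∧
    (F0 stream : ℚ) / (1 + ε) ≤ c ∧ c ≤ (1 + ε) * (F0 stream : ℚ)

end StreamingAlgorithm

/-- The probability of the event `E` for `R` independent fair random bits. -/
noncomputable def coinProb {R : ℕ} (E : (Fin R → Bool) → Prop) : ℝ :=
  ({r | E r} : Set (Fin R → Bool)).ncard / 2 ^ R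

end DNFStream

/-!
The algorithm keeps about `log (1 / δ)` independent rows and reports the median of their estimates.
A row holds random affine equations `e₁, …, eₙ` over `𝔽₂` in the `n` variables. The cell of level
`j` is the set of the assignments that satisfy `e₁, …, eⱼ`, and the row keeps a list, its bucket, of
all elements of the union of the DNF sets so far that lie in the cell of its level; the level is the
least one for which there are at most `K` such elements, with `K` of the order of `1 / ε²`
(`Row.Inv`). The estimate of the row is `2 ^ j` times the length of the bucket.

To process a term, the row deletes the points of the bucket that satisfy the term, and then has to
insert all assignments of the cell that satisfy it. These form an affine space, which is given by a
point and a basis of directions and from which elimination computes its intersection with the cell.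
While this intersection has too many points for the free places, which is decided from its dimension
alone, the level is raised: the next equation restricts both the bucket and the affine space. Then
the points of the space are listed (`climb_inv`, `rowStep_aux`). Since no point is inserted twice
and the contents of the bucket, up to their order, depend on the union of the DNF sets only,
duplicates in the stream do not matter.

Space is what dictates the choice of the equations. The coefficients of the `i`-th equation are a
window of length `n` in a sequence of `2n` random bits (a Toeplitz matrix), so that a row needs only
`3n` random bits, constant terms included. The cells are still pairwise independent
(`Seed.card_inCell`, `Seed.card_inCell₂`): if `z ≠ 0` is the difference of two points and `k` its
last nonzero coordinate, then the bit of the sequence that the `i`-th window pairs with the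
coordinate `k` is paired with a later coordinate, a zero of `z`, in all earlier windows; flipping it
hence changes the value of the `i`-th equation at `z` and none of the earlier ones. A further
equation, which has no solution, is added at the end; it makes sure that the level can always be
raised far enough.

By Chebyshev's inequality, a row is off by more than a relative error `ε / 2` with probability at
most `1 / 16` (`exists_bad_seeds`). The variances grow geometrically with the level, so that a union
bound over the levels that can occur costs only a constant factor. At least half of `t` independent
rows are bad with probability at most `2⁻ᵗ` (`card_half_bad`), and otherwise the median is good
(`median_mem`).

The Turing machines are obtained from a small language of structured programs on stacks, whose
semantics `Run` counts steps; `Run.steps` shows that the compiled program takes exactly these steps.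
A term costs a row `O (n³ / ε²)` steps (`rowTime_le`): elimination with up to `n + 1` equations on
at most `n + 1` vectors of length `n + 1`, and for each level one pass through the bucket and one
test for room. No time bound is needed for initialisation and report, for which `Does` only asserts
that the program halts. Counters are kept in unary, which is affordable as they are at most `K`
while an item is processed.
-/

namespace DNFStream

open Function

/-! ### A small structured language for stack machines -/

/-- The symbols that the work stacks hold. -/
inductive Sym
  /-- a bit of a vector -/
  | bit (b : Bool)
  /-- the leading coordinate of a vector -/
  | hd (h : Bool)
  /-- a pair of bits: a literal pair of a term, or a tape cell that carries a constant term -/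
  | con (a b : Bool)
  /-- a tape cell without a constant term -/
  | base (b : Bool)
  /-- the last tape cell, standing for the unsatisfiable equation -/
  | fls
  /-- a unary digit -/
  | mark
  /-- a separator -/
  | sep
deriving DecidableEq, Fintype

/-- The names of the work stacks. -/
inductive Reg
  | A | F | I | D | L | R | C | B | V | U | T | N | P | Q | X | Y | Z | W
deriving DecidableEq

instance : Fintype Reg :=
  ⟨{.A, .F, .I, .D, .L, .R, .C, .B, .V, .U, .T, .N, .P, .Q, .X, .Y, .Z, .W}, fun k => by
    cases k <;> decide⟩

/-- The contents of the work stacks, each with its top first. -/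
abbrev Store := Reg → List Sym

/-- Structured programs. `pop k f` pops `k` and goes on with `f o`, where `o` is the popped symbol
(`none` if `k` was empty). `each k c f` pops a symbol `s` from `k` and runs `f s`, again and again
as long as there is a top symbol of `k` and it satisfies `c`. -/
inductive Prog
  | skip
  | push (k : Reg) (s : Sym)
  | pop (k : Reg) (f : Option Sym → Prog)
  | seq (p q : Prog)
  | each (k : Reg) (c : Sym → Bool) (f : Sym → Prog)

infixr:60 " ;; " => Prog.seq


/-- `Run p S t S'`: started with the stacks `S`, the program `p` ends with the stacks `S'` after `t`
steps. -/
inductive Run : Prog → Store → ℕ → Store → Prop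
  | skip (S) : Run .skip S 0 S
  | push (k s S) : Run (.push k s) S 1 (update S k (s :: S k))
  | pop {k f S t S'} (h : Run (f (S k).head?) (update S k (S k).tail) t S') :
      Run (.pop k f) S (t + 1) S'
  | seq {p q S t S' t' S''} (h : Run p S t S') (h' : Run q S' t' S'') :
      Run (.seq p q) S (t + t') S''
  | finish {k c f S} (h : (S k).head?.any c = false) : Run (.each k c f) S 1 S
  | step {k c f S s l t S' t' S''} (hs : S k = s :: l) (hc : c s = true)
      (h : Run (f s) (update S k l) t S') (h' : Run (.each k c f) S' t' S'') :
      Run (.each k c f) S (t + t' + 1) S''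

/-! ### Compilation to Turing machines -/

/-- The control states of a compiled program. -/
def Lab : Prog → Type
  | .skip => Empty
  | .push _ _ => Unit
  | .pop _ f => Option (Σ o, Lab (f o))
  | .seq p q => Lab p ⊕ Lab q
  | .each _ _ f => Option (Σ s, Lab (f s))

noncomputable instance Lab.fintype : ∀ p, Fintype (Lab p)
  | .skip => inferInstanceAs (Fintype Empty)
  | .push _ _ => inferInstanceAs (Fintype Unit)
  | .pop _ f =>
    haveI := fun o => Lab.fintype (f o)
    inferInstanceAs (Fintype (Option (Σ o, Lab (f o))))
  | .seq p q =>
    haveI := Lab.fintype p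
    haveI := Lab.fintype q
    inferInstanceAs (Fintype (Lab p ⊕ Lab q))
  | .each _ _ f =>
    haveI := fun o => Lab.fintype (f o)
    inferInstanceAs (Fintype (Option (Σ s, Lab (f s))))

/-- The stacks of a compiled program: an input stack, an output stack and the work stacks. -/
inductive Stack
  | inp
  | out
  | reg (r : Reg)
deriving DecidableEq, Fintype

/-- The alphabets of the stacks of a compiled program. -/
def Stack.Alph (Γ₀ Γ₁ : Type) : Stack → Type
  | .inp => Γ₀
  | .out => Γ₁
  | .reg _ => Sym

/-- The statements of a compiled program; the internal state is the last symbol popped. -/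
abbrev Code (Γ₀ Γ₁ Λ : Type) := Turing.TM2.Stmt (Stack.Alph Γ₀ Γ₁) Λ (Option Sym)

section Compile

variable {Γ₀ Γ₁ Λ : Type}

/-- The control state in which the compiled program starts, if its control states are embedded in
`Λ` by `e` and it continues at `next`. -/
def Prog.entry : (p : Prog) → (Lab p → Λ) → Λ → Λ
  | .skip, _, next => next
  | .push _ _, e, _ => e ()
  | .pop _ _, e, _ => e none
  | .seq p q, e, next => p.entry (fun l => e (.inl l)) (q.entry (fun l => e (.inr l)) next)
  | .each _ _ _, e, _ => e none

/-- The statements of the compiled program. -/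
def Prog.code : (p : Prog) → (Lab p → Λ) → Λ → Lab p → Code Γ₀ Γ₁ Λ
  | .skip, _, _, l => l.elim
  | .push k s, _, next, _ => .push (.reg k) (fun _ => s) (.goto fun _ => next)
  | .pop k f, e, next, l =>
    match l with
    | none => .pop (.reg k) (fun _ o => o)
        (.goto fun o => (f o).entry (fun l => e (some ⟨o, l⟩)) next)
    | some ⟨o, l⟩ => (f o).code (fun l => e (some ⟨o, l⟩)) next l
  | .seq p q, e, next, l =>
    match l with
    | .inl l => p.code (fun l => e (.inl l)) (q.entry (fun l => e (.inr l)) next) l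
    | .inr l => q.code (fun l => e (.inr l)) next l
  | .each k c f, e, next, l =>
    match l with
    | none => .peek (.reg k) (fun _ o => o) (.branch (fun o => o.any c)
        (.pop (.reg k) (fun _ o => o) (.goto fun o =>
          match o with
          | some s => (f s).entry (fun l => e (some ⟨s, l⟩)) (e none)
          | none => next))
        (.goto fun _ => next))
    | some ⟨s, l⟩ => (f s).code (fun l => e (some ⟨s, l⟩)) (e none) l

/-- The contents of all stacks of a compiled program. -/
def contents (i : List Γ₀) (o : List Γ₁) (S : Store) : ∀ k, List (Stack.Alph Γ₀ Γ₁ k)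
  | .inp => i
  | .out => o
  | .reg r => S r

theorem update_contents_reg (i : List Γ₀) (o : List Γ₁) (S : Store) (r : Reg) (l : List Sym) :
    update (contents i o S) (.reg r) l = contents i o (update S r l) := by
  funext k
  rcases k with _ | _ | k
  · exact update_of_ne (by simp) _ _
  · exact update_of_ne (by simp) _ _
  · by_cases h : k = r
    · subst h
      exact (update_self _ _ _).trans (update_self (f := S) _ _).symm
    · exact (update_of_ne (by simpa using h) _ _).trans (update_of_ne h _ S).symm

theorem update_contents_inp (i i' : List Γ₀) (o : List Γ₁) (S : Store) :
    update (contents i o S) .inp i' = contents i' o S := by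
  funext k
  rcases k with _ | _ | k
  · exact update_self _ _ _
  · exact update_of_ne (by simp) _ _
  · exact update_of_ne (by simp) _ _

theorem update_contents_out (i : List Γ₀) (o o' : List Γ₁) (S : Store) :
    update (contents i o S) .out o' = contents i o' S := by
  funext k
  rcases k with _ | _ | k
  · exact update_of_ne (by simp) _ _
  · exact update_self _ _ _
  · exact update_of_ne (by simp) _ _

/-- `n` steps of the transition function `f` lead from `a` to `b`. -/
def Steps {α : Type*} (f : α → Option α) (n : ℕ) (a b : α) : Prop :=
  (flip bind f)^[n] (some a) = some b

theorem Steps.refl {α : Type*} (f : α → Option α) (a : α) : Steps f 0 a a := rfl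

theorem Steps.one {α : Type*} {f : α → Option α} {a b : α} (h : f a = some b) : Steps f 1 a b := h

theorem Steps.trans {α : Type*} {f : α → Option α} {n m : ℕ} {a b c : α} (h : Steps f n a b)
    (h' : Steps f m b c) : Steps f (n + m) a c := by
  unfold Steps at *
  rw [Nat.add_comm, iterate_add_apply, h, h']

/-- The entry of a loop looks at the top of the stack before it pops, so that a symbol that ends the
loop stays there. -/
theorem Prog.code_each {M : Λ → Code Γ₀ Γ₁ Λ} {k : Reg} {c : Sym → Bool} {f : Sym → Prog}
    {e : Lab (.each k c f) → Λ} {next : Λ} (hM : ∀ l, M (e l) = (Prog.each k c f).code e next l) :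
    M ((Prog.each k c f).entry e next) =
      .peek (.reg k) (fun _ o => o) (.branch (fun o => o.any c)
        (.pop (.reg k) (fun _ o => o) (.goto fun o =>
          match o with
          | some s => (f s).entry (fun l => e (some ⟨s, l⟩)) (e none)
          | none => next))
        (.goto fun _ => next)) :=
  hM none

/-- Compilation is correct: the compiled program takes exactly the steps that `Run` counts. -/
theorem Run.steps {p : Prog} {S : Store} {t : ℕ} {S' : Store} (h : Run p S t S')
    (M : Λ → Code Γ₀ Γ₁ Λ) (e : Lab p → Λ) (next : Λ) (hM : ∀ l, M (e l) = p.code e next l)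
    (i : List Γ₀) (o : List Γ₁) (v : Option Sym) :
    ∃ v', Steps (Turing.TM2.step M) t ⟨some (p.entry e next), v, contents i o S⟩
      ⟨some next, v', contents i o S'⟩ := by
  induction h generalizing next v with
  | skip S => exact ⟨v, Steps.refl _ _⟩
  | push k s S =>
    refine ⟨v, Steps.one ?_⟩
    have hm : M ((Prog.push k s).entry e next) =
      .push (.reg k) (fun _ => s) (.goto fun _ => next) := hM ()
    rw [Turing.TM2.step.eq_2, hm]
    exact congrArg (fun S' => some (Turing.TM2.Cfg.mk (some next) v S'))
      (update_contents_reg _ _ _ _ _)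
  | @pop k f S t S' h ih =>
    obtain ⟨v', h'⟩ := ih (fun l => e (some ⟨_, l⟩)) next (fun l => hM (some ⟨_, l⟩)) (S k).head?
    refine ⟨v', Nat.add_comm t 1 ▸ Steps.trans (Steps.one ?_) h'⟩
    have hm : M ((Prog.pop k f).entry e next) = .pop (.reg k) (fun _ o => o)
        (.goto fun o => (f o).entry (fun l => e (some ⟨o, l⟩)) next) := hM none
    rw [Turing.TM2.step.eq_2, hm, ← update_contents_reg]
    rfl
  | @seq p q S t S' t' S'' h h' ih ih' =>
    obtain ⟨v₁, h₁⟩ := ih (fun l => e (.inl l)) (q.entry (fun l => e (.inr l)) next)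
      (fun l => hM (.inl l)) v
    obtain ⟨v₂, h₂⟩ := ih' (fun l => e (.inr l)) next (fun l => hM (.inr l)) v₁
    exact ⟨v₂, h₁.trans h₂⟩
  | @finish k c f S h =>
    refine ⟨(S k).head?, Steps.one ?_⟩
    rw [Turing.TM2.step.eq_2, Prog.code_each hM]
    change some (cond ((S k).head?.any c) _ _) = _
    rw [h]
    rfl
  | @step k c f S s l t S' t' S'' hs hc h h' ih ih' =>
    obtain ⟨v₁, h₁⟩ := ih (fun l => e (some ⟨s, l⟩)) (e none) (fun l => hM (some ⟨s, l⟩)) (some s)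
    obtain ⟨v₂, h₂⟩ := ih' e next hM v₁
    refine ⟨v₂, ?_⟩
    rw [Nat.add_comm _ 1]
    refine Steps.trans (Steps.one ?_) (h₁.trans h₂)
    rw [Turing.TM2.step.eq_2, Prog.code_each hM]
    change some (cond ((S k).head?.any c) (Turing.TM2.stepAux (.pop _ _ _) _ _) _) = _
    rw [hs, List.head?_cons, Option.any_some, hc, cond_true, ← update_contents_reg]
    simp only [Turing.TM2.stepAux]
    have h2 : contents i o S (.reg k) = s :: l := hs
    rw [h2]
    rfl

end Compile

/-- The control states that a machine has besides those of its program: reading the input, writing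
the output, and writing the piece of output that belongs to one symbol. -/
inductive Ctl
  | read
  | write
  | emit (s : Sym)
deriving Fintype

/-- The statement that pushes the symbols of a list on the output stack. -/
def pushAll {Γ₀ Γ₁ Λ : Type} (next : Λ) : List Γ₁ → Code Γ₀ Γ₁ Λ
  | [] => .goto fun _ => next
  | a :: l => .push .out (fun _ => a) (pushAll next l)

/-- The statements of the machine `machine f g p`. -/
def machineCode {Γ₀ Γ₁ : Type} (f : Γ₀ → Sym) (g : Sym → List Γ₁) (p : Prog) :
    Ctl ⊕ Lab p → Code Γ₀ Γ₁ (Ctl ⊕ Lab p)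
  | .inl .read => .pop .inp (fun _ o => Option.map f o) (.branch Option.isSome
      (.push (.reg .A) (fun v => v.getD .sep) (.goto fun _ => .inl .read))
      (.goto fun _ => p.entry .inr (.inl .write)))
  | .inl .write => .pop (.reg .D) (fun _ o => o) (.branch Option.isSome
      (.goto fun v => .inl (.emit (v.getD .sep))) .halt)
  | .inl (.emit s) => pushAll (.inl .write) (g s).reverse
  | .inr l => p.code .inr (.inl .write) l

/-- The Turing machine that moves its input, translated by `f`, to the work stack `A` (so that the
end of the input is on top), runs `p`, and then moves the work stack `D` to the output, each symbol
being translated by `g`. -/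
noncomputable def machine {Γ₀ Γ₁ : Type} [Fintype Γ₀] (f : Γ₀ → Sym) (g : Sym → List Γ₁)
    (p : Prog) : Machine Γ₀ Γ₁ where
  tm :=
    { K := Stack
      k₀ := .inp
      k₁ := .out
      Γ := Stack.Alph Γ₀ Γ₁
      Λ := Ctl ⊕ Lab p
      main := .inl .read
      σ := Option Sym
      initialState := none
      Γk₀Fin := inferInstanceAs (Fintype Γ₀)
      m := machineCode f g p }
  inputAlphabet := Equiv.refl Γ₀
  outputAlphabet := Equiv.refl Γ₁

/-- All work stacks empty. -/
abbrev Store.nil : Store := fun _ => []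

section Machine

variable {Γ₀ Γ₁ : Type} (f : Γ₀ → Sym) (g : Sym → List Γ₁) (p : Prog)

theorem steps_read (x : List Γ₀) (l : List Sym) (v : Option Sym) :
    ∃ v', Steps (Turing.TM2.step (machineCode f g p)) (x.length + 1)
      ⟨some (.inl .read), v, contents x [] (update Store.nil .A l)⟩
      ⟨some (p.entry .inr (.inl .write)), v',
        contents [] [] (update Store.nil .A ((x.map f).reverse ++ l))⟩ := by
  induction x generalizing l v with
  | nil =>
    refine ⟨none, Steps.one ?_⟩
    simp only [Turing.TM2.step, machineCode, Turing.TM2.stepAux]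
    change some (cond (none : Option Sym).isSome _ _) = _
    simp only [Option.isSome_none, cond_false]
    congr 2
    exact update_contents_inp _ _ _ _
  | cons a x ih =>
    obtain ⟨v', h⟩ := ih (f a :: l) (some (f a))
    refine ⟨v', ?_⟩
    rw [List.length_cons, Nat.add_comm _ 1]
    refine Steps.trans (Steps.one ?_) (by simpa using h)
    simp only [Turing.TM2.step, machineCode, Turing.TM2.stepAux]
    change some (cond (some (f a)).isSome _ _) = _
    simp only [Option.isSome_some, cond_true]
    congr 2
    have e : update (contents (a :: x) ([] : List Γ₁) (update Store.nil .A l)) .inp x =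
      contents x [] (update Store.nil .A l) := update_contents_inp _ _ _ _
    refine (congrArg (fun c => update c (Stack.reg .A) (f a :: c (.reg .A))) e).trans ?_
    refine (update_contents_reg _ _ _ _ _).trans ?_
    congr 1
    simp [contents]

theorem stepAux_pushAll {Λ : Type} (next : Λ) (i : List Γ₀) (S : Store) (v : Option Sym)
    (w o : List Γ₁) :
    Turing.TM2.stepAux (pushAll next w) v (contents i o S) =
      ⟨some next, v, contents i (w.reverse ++ o) S⟩ := by
  induction w generalizing o with
  | nil => rfl
  | cons a w ih =>
    have e : update (contents i o S) .out (a :: o) = contents i (a :: o) S :=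
      update_contents_out _ _ _ _
    refine (congrArg (Turing.TM2.stepAux (pushAll next w) v) e).trans ?_
    rw [ih]
    simp

theorem steps_write (w : List Sym) (o : List Γ₁) (v : Option Sym) :
    Steps (Turing.TM2.step (machineCode f g p)) (2 * w.length + 1)
      ⟨some (.inl .write), v, contents [] o (update Store.nil .D w)⟩
      ⟨none, none, contents [] (w.reverse.flatMap g ++ o) Store.nil⟩ := by
  induction w generalizing o v with
  | nil =>
    refine Steps.one ?_
    simp only [Turing.TM2.step, machineCode, Turing.TM2.stepAux]
    change some (cond (none : Option Sym).isSome _ _) = _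
    simp only [Option.isSome_none, cond_false]
    congr 2
    refine (update_contents_reg _ _ _ _ _).trans ?_
    congr 1
    exact (update_idem _ _ _).trans (update_eq_self (Reg.D) Store.nil)
  | cons a w ih =>
    rw [List.length_cons, show 2 * (w.length + 1) + 1 = 1 + (1 + (2 * w.length + 1)) by ring]
    have h2 := ih (g a ++ o) (some a)
    rw [show w.reverse.flatMap g ++ (g a ++ o) = (a :: w).reverse.flatMap g ++ o by simp] at h2
    refine Steps.trans (b := ⟨some (.inl (.emit a)), some a,
      contents [] o (update Store.nil .D w)⟩) (Steps.one ?_) (Steps.trans (Steps.one ?_) h2)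
    · simp only [Turing.TM2.step, machineCode, Turing.TM2.stepAux]
      change some (cond (some a).isSome _ _) = _
      simp only [Option.isSome_some, cond_true]
      congr 2
      refine (update_contents_reg _ _ _ _ _).trans ?_
      congr 1
      exact update_idem _ _ _
    · simp only [Turing.TM2.step, machineCode]
      rw [stepAux_pushAll]
      simp

variable {f g p}

/-- A program that turns the input, stored on `A`, into the output, stored on `D`, gives a Turing
machine; apart from the run of the program, it takes one step for each input symbol and two for each
symbol on `D`. -/
theorem Run.outputsWithin [Fintype Γ₀] {x : List Γ₀} {t : ℕ} {w : List Sym}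
    (h : Run p (update Store.nil .A (x.map f).reverse) t (update Store.nil .D w)) :
    (machine f g p).OutputsWithin x (w.reverse.flatMap g) (x.length + t + 2 * w.length + 2) := by
  obtain ⟨v₁, h₁⟩ := steps_read f g p x [] none
  rw [List.append_nil] at h₁
  obtain ⟨v₂, h₂⟩ := h.steps (machineCode f g p) .inr (.inl .write) (fun _ => rfl) [] [] v₁
  have h₃ := (h₁.trans h₂).trans (steps_write f g p w [] v₂)
  refine ⟨⟨⟨x.length + 1 + t + (2 * w.length + 1), ?_⟩, ?_⟩⟩
  · have e₁ : Turing.initList (machine f g p).tm (x.map (machine f g p).inputAlphabet.symm) =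
        ⟨some (.inl .read), none, contents x [] (update Store.nil .A [])⟩ := by
      unfold Turing.initList
      congr 1
      funext k
      rcases k with _ | _ | k
      · exact List.map_id x
      · rfl
      · exact (congrFun (update_eq_self Reg.A Store.nil) k).symm
    have e₂ : Turing.haltList (machine f g p).tm
        ((w.reverse.flatMap g).map (machine f g p).outputAlphabet.symm) =
        ⟨none, none, contents [] (w.reverse.flatMap g ++ []) Store.nil⟩ := by
      unfold Turing.haltList
      congr 1
      funext k
      rcases k with _ | _ | k
      · rfl
      · exact (List.map_id _).trans (List.append_nil _).symm
      · rfl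
    rw [e₁, Option.map_some, e₂]
    exact h₃
  · change x.length + 1 + t + (2 * w.length + 1) ≤ _
    omega

end Machine

theorem Machine.OutputsWithin.mono {Γ₀ Γ₁ : Type} {M : Machine Γ₀ Γ₁} {x : List Γ₀} {y : List Γ₁}
    {t t' : ℕ} (h : M.OutputsWithin x y t) (ht : t ≤ t') : M.OutputsWithin x y t' := by
  obtain ⟨h⟩ := h
  exact ⟨⟨h.toEvalsTo, h.steps_le_m.trans ht⟩⟩

theorem steps_halted_unique {α : Type*} {f : α → Option α} {a b b' : α} {n n' : ℕ}
    (h : Steps f n a b) (h' : Steps f n' a b') (hb : f b = none) (hb' : f b' = none) : b = b' := by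
  wlog hn : n ≤ n' generalizing n n' b b'
  · exact (this h' h hb' hb (by omega)).symm
  obtain ⟨m, rfl⟩ := Nat.exists_eq_add_of_le hn
  unfold Steps at h h'
  rw [Nat.add_comm, iterate_add_apply, h] at h'
  rcases m with _ | m
  · simpa using h'
  · rw [iterate_succ_apply] at h'
    have : flip bind f (some b) = none := hb
    rw [this] at h'
    have hnone : ∀ k, (flip bind f)^[k] (none : Option α) = none := by
      intro k
      induction k with
      | zero => rfl
      | succ k ih => rw [iterate_succ_apply]; exact ih
    rw [hnone] at h'
    simp at h'

/-- The output of a Turing machine is determined by its input. -/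
theorem Machine.OutputsWithin.unique {Γ₀ Γ₁ : Type} {M : Machine Γ₀ Γ₁} {x : List Γ₀}
    {y y' : List Γ₁} {t t' : ℕ} (h : M.OutputsWithin x y t) (h' : M.OutputsWithin x y' t') :
    y = y' := by
  obtain ⟨h⟩ := h
  obtain ⟨h'⟩ := h'
  have e := steps_halted_unique (f := M.tm.step) h.evals_in_steps h'.evals_in_steps rfl rfl
  have e2 := congrFun (congrArg Turing.TM2.Cfg.stk e) M.tm.k₁
  simp only [Turing.haltList, dite_true] at e2
  exact List.map_injective_iff.2 M.outputAlphabet.symm.injective e2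

/-- `Runs p S S' t`: started with the stacks `S`, the program `p` ends with the stacks `S'` after at
most `t` steps. -/
def Runs (p : Prog) (S S' : Store) (t : ℕ) : Prop := ∃ t' ≤ t, Run p S t' S'

namespace Runs

variable {p q : Prog} {S S' S'' : Store} {t t' : ℕ} {k : Reg}

theorem of_eq (h : Runs p S S' t) (hS : S' = S'') (ht : t ≤ t') : Runs p S S'' t' := by
  obtain ⟨u, hu, h⟩ := h
  exact ⟨u, hu.trans ht, hS ▸ h⟩

theorem mono (h : Runs p S S' t) (ht : t ≤ t') : Runs p S S' t' := h.of_eq rfl ht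

theorem skip : Runs .skip S S 0 := ⟨0, le_rfl, .skip S⟩

theorem push (k : Reg) (s : Sym) (S : Store) : Runs (.push k s) S (update S k (s :: S k)) 1 :=
  ⟨1, le_rfl, .push k s S⟩

theorem pop_some {f : Option Sym → Prog} {s : Sym} {l : List Sym} (hk : S k = s :: l)
    (h : Runs (f (some s)) (update S k l) S' t) : Runs (.pop k f) S S' (t + 1) := by
  obtain ⟨u, hu, h⟩ := h
  refine ⟨u + 1, by omega, .pop ?_⟩
  rw [hk]
  exact h

theorem pop_none {f : Option Sym → Prog} (hk : S k = [])
    (h : Runs (f none) S S' t) : Runs (.pop k f) S S' (t + 1) := by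
  obtain ⟨u, hu, h⟩ := h
  refine ⟨u + 1, by omega, .pop ?_⟩
  rw [hk]
  have : update S k ([] : List Sym).tail = S := by
    rw [List.tail_nil, ← hk, update_eq_self]
  rw [this]
  exact h

theorem seq (h : Runs p S S' t) (h' : Runs q S' S'' t') : Runs (p ;; q) S S'' (t + t') := by
  obtain ⟨u, hu, h⟩ := h
  obtain ⟨u', hu', h'⟩ := h'
  exact ⟨u + u', by omega, .seq h h'⟩

theorem push_seq {s : Sym} (h : Runs q (update S k (s :: S k)) S' t) :
    Runs (.push k s ;; q) S S' (t + 1) := ((push k s S).seq h).mono (by omega)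

theorem each_stop {c : Sym → Bool} {f : Sym → Prog} (h : (S k).head?.any c = false) :
    Runs (.each k c f) S S 1 := ⟨1, le_rfl, .finish h⟩

theorem each_step {c : Sym → Bool} {f : Sym → Prog} {s : Sym} {l : List Sym} (hk : S k = s :: l)
    (hc : c s = true) (h : Runs (f s) (update S k l) S' t) (h' : Runs (.each k c f) S' S'' t') :
    Runs (.each k c f) S S'' (t + t' + 1) := by
  obtain ⟨u, hu, h⟩ := h
  obtain ⟨u', hu', h'⟩ := h'
  exact ⟨u + u' + 1, by omega, .step hk hc h h'⟩

end Runs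

/-- Moves the content of `x` to `y`, symbol by symbol. -/
def mv (x y : Reg) : Prog := .each x (fun _ => true) fun s => .push y s

theorem runs_mv (x y : Reg) (hxy : x ≠ y) (S : Store) :
    Runs (mv x y) S (update (update S x []) y ((S x).reverse ++ S y)) (2 * (S x).length + 1) := by
  generalize hl : S x = l
  induction l generalizing S with
  | nil =>
    refine (Runs.each_stop (by simp [hl])).of_eq ?_ (by simp)
    have : update S x [] = S := by rw [← hl, update_eq_self]
    simp [this]
  | cons s l ih =>
    refine (Runs.each_step hl rfl (Runs.push _ _ _) (ih _ ?_)).of_eq ?_ ?_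
    · simp [hxy]
    · funext k
      by_cases h1 : k = x <;> by_cases h2 : k = y <;> simp_all [update_apply]
    · simp; omega

/-- Moves the symbols of `x` up to the first one that does not satisfy `c` to `y`. -/
def mvWhile (c : Sym → Bool) (x y : Reg) : Prog := .each x c fun s => .push y s

theorem runs_mvWhile (c : Sym → Bool) (x y : Reg) (hxy : x ≠ y) (S : Store) (l r : List Sym)
    (hS : S x = l ++ r) (hl : ∀ s ∈ l, c s = true) (hr : r.head?.any c = false) :
    Runs (mvWhile c x y) S (update (update S x r) y (l.reverse ++ S y)) (2 * l.length + 1) := by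
  induction l generalizing S with
  | nil =>
    refine (Runs.each_stop (by rw [hS]; exact hr)).of_eq ?_ (by simp)
    rw [List.nil_append] at hS
    simp [← hS]
  | cons s l ih =>
    refine (Runs.each_step hS (hl s (by simp)) (Runs.push _ _ _) (ih _ ?_ ?_)).of_eq ?_ ?_
    · simp [hxy]
    · exact fun s hs => hl s (by simp [hs])
    · funext k
      by_cases h1 : k = x <;> by_cases h2 : k = y <;> simp_all [update_apply]
    · simp; omega

/-- Empties `x`. -/
def clear (x : Reg) : Prog := .each x (fun _ => true) fun _ => .skip

theorem runs_clear (x : Reg) (S : Store) :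
    Runs (clear x) S (update S x []) ((S x).length + 1) := by
  generalize hl : S x = l
  induction l generalizing S with
  | nil =>
    refine (Runs.each_stop (by simp [hl])).of_eq ?_ (by simp)
    simp [← hl]
  | cons s l ih =>
    refine (Runs.each_step hl rfl Runs.skip (ih _ ?_)).of_eq ?_ ?_
    · simp
    · simp
    · simp

/-- The bit that a symbol of a vector stands for. -/
def Sym.toBit : Sym → Bool
  | .bit b => b
  | .hd h => h
  | _ => false

/-- Runs through the stack `z` and, in parallel, through the vector on top of `src`, which is moved
to `Y` with `g` applied to each pair of symbols. Meanwhile a bit on `Q`, initially `false`, is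
updated by `f`. The stack `z` is restored. -/
def scan (z src : Reg) (f : Sym → Sym → Bool → Bool) (g : Sym → Sym → Sym) : Prog :=
  .push .Q (.bit false) ;;
  .each z (fun _ => true) (fun s => .push .X s ;; .pop src fun o =>
    .push .Y (g s (o.getD .sep)) ;;
    .pop .Q fun q => .push .Q (.bit (f s (o.getD .sep) (q.getD .sep).toBit))) ;;
  mv .X z

/-- The bit computed by `scan`. -/
def scanBit (f : Sym → Sym → Bool → Bool) : List Sym → List Sym → Bool → Bool
  | s :: zs, u :: us, q => scanBit f zs us (f s u q)
  | _, _, q => q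

theorem runs_scan_loop (z src : Reg) (f : Sym → Sym → Bool → Bool) (g : Sym → Sym → Sym)
    (h : [z, src, .X, .Y, .Q].Nodup) (zs us rest qs : List Sym) (q : Bool) (S : Store)
    (hz : S z = zs) (hsrc : S src = us ++ rest) (hl : zs.length = us.length)
    (hQ : S .Q = .bit q :: qs) :
    Runs (.each z (fun _ => true) (fun s => .push .X s ;; .pop src fun o =>
      .push .Y (g s (o.getD .sep)) ;;
      .pop .Q fun q => .push .Q (.bit (f s (o.getD .sep) (q.getD .sep).toBit)))) S
      (update (update (update (update (update S z []) src rest) .X (zs.reverse ++ S .X))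
        .Y ((List.zipWith g zs us).reverse ++ S .Y)) .Q (.bit (scanBit f zs us q) :: qs))
      (6 * zs.length + 1) := by
  simp only [List.nodup_cons, List.mem_cons, List.not_mem_nil, or_false, not_or] at h
  obtain ⟨⟨h1, h2, h3, h4⟩, ⟨h5, h6, h7⟩, -⟩ := h
  induction zs generalizing S us q with
  | nil =>
    obtain rfl : us = [] := by simpa using hl.symm
    refine (Runs.each_stop (by simp [hz])).of_eq ?_ (by simp)
    funext k
    simp only [update_apply]
    split_ifs <;> simp_all [scanBit]
  | cons s zs ih =>
    obtain ⟨u, us, rfl⟩ : ∃ u us', us = u :: us' := by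
      cases us with
      | nil => simp at hl
      | cons u us => exact ⟨u, us, rfl⟩
    refine (Runs.each_step (t := 5) hz rfl (Runs.push_seq (Runs.pop_some (s := u)
      (l := us ++ rest) ?_ (Runs.push_seq (Runs.pop_some (s := .bit q) (l := qs) ?_
      (Runs.push _ _ _))))) (ih us (f s u q) _ ?_ ?_ ?_ ?_)).of_eq ?_ ?_
    · simp [update_apply, hsrc, h5, Ne.symm h1]
    · simp [update_apply, hQ, Ne.symm h7, Ne.symm h4]
    · simp [update_apply, *]
    · simp [update_apply, *]
    · simpa using hl
    · simp [update_apply, Sym.toBit]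
    · funext k
      simp only [update_apply]
      split_ifs <;> simp_all [scanBit]
    · simp; omega

theorem runs_scan (z src : Reg) (f : Sym → Sym → Bool → Bool) (g : Sym → Sym → Sym)
    (h : [z, src, .X, .Y, .Q].Nodup) (zs us rest : List Sym) (S : Store)
    (hz : S z = zs) (hsrc : S src = us ++ rest) (hl : zs.length = us.length) (hX : S .X = []) :
    Runs (scan z src f g) S (update (update (update S src rest)
      .Y ((List.zipWith g zs us).reverse ++ S .Y)) .Q (.bit (scanBit f zs us false) :: S .Q))
      (8 * zs.length + 3) := by
  have h' := h
  simp only [List.nodup_cons, List.mem_cons, List.not_mem_nil, or_false, not_or] at h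
  obtain ⟨⟨h1, h2, h3, h4⟩, ⟨h5, h6, h7⟩, -⟩ := h
  refine (Runs.push_seq (Runs.seq (runs_scan_loop z src f g h' zs us rest (S .Q) false _
    ?_ ?_ hl ?_) (runs_mv _ _ (Ne.symm h2) _))).of_eq ?_ ?_
  · simp [*]
  · simp [*]
  · simp
  · funext k
    simp only [update_apply]
    split_ifs <;> simp_all
  · simp [hX]; omega

/-! ### Linear algebra over `𝔽₂` with lists of bits -/

/-- The sum of two vectors over `𝔽₂`. -/
def vx (u v : List Bool) : List Bool := List.zipWith xor u v

/-- The inner product of two vectors over `𝔽₂`. -/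
def ip (u v : List Bool) : Bool := (List.zipWith and u v).foldr xor false

theorem length_vx {u v : List Bool} {m : ℕ} (hu : u.length = m) (hv : v.length = m) :
    (vx u v).length = m := by simp [vx, hu, hv]

theorem vx_left_comm (u v w : List Bool) : vx u (vx v w) = vx v (vx u w) := by
  unfold vx
  induction u generalizing v w with
  | nil => simp
  | cons a u ih =>
    cases v with
    | nil => simp
    | cons b v =>
      cases w with
      | nil => simp
      | cons c w => simp [ih, Bool.xor_left_comm]

theorem vx_assoc (u v w : List Bool) : vx (vx u v) w = vx u (vx v w) := by
  unfold vx
  induction u generalizing v w with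
  | nil => simp
  | cons a u ih =>
    cases v with
    | nil => simp
    | cons b v =>
      cases w with
      | nil => simp
      | cons c w => simp [ih]

theorem vx_self_vx {u v : List Bool} (h : u.length = v.length) : vx u (vx u v) = v := by
  unfold vx
  induction u generalizing v with
  | nil => simpa using h.symm
  | cons a u ih =>
    cases v with
    | nil => simp at h
    | cons b v => simpa [← Bool.xor_assoc] using ih (by simpa using h)

theorem ip_vx (N : List Bool) {u v : List Bool} (h : u.length = v.length) :
    ip N (vx u v) = xor (ip N u) (ip N v) := by
  unfold vx ip
  induction N generalizing u v with
  | nil => simp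
  | cons a N ih =>
    cases u with
    | nil => obtain rfl : v = [] := by simpa using h.symm
             simp
    | cons b u =>
      cases v with
      | nil => simp at h
      | cons c v =>
        simp only [List.zipWith_cons_cons, List.foldr_cons, ih (by simpa using h : u.length =
          v.length)]
        generalize List.foldr xor false (List.zipWith and N u) = x
        generalize List.foldr xor false (List.zipWith and N v) = y
        clear h ih
        revert a b c x y
        decide

/-- The affine space `c + ⟨G⟩`, listed by subsets of `G`. -/
def sols : List (List Bool) → List Bool → List (List Bool)
  | [], c => [c]
  | g :: G, c => sols G (vx g c) ++ sols G c

/-- The affine space is built up by one doubling for each generator. -/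
def solsFrom : List (List Bool) → List (List Bool) → List (List Bool)
  | [], E => E
  | g :: G, E => solsFrom G (E.map (vx g) ++ E)

theorem solsFrom_perm (G E : List (List Bool)) : (solsFrom G E).Perm (E.flatMap (sols G)) := by
  induction G generalizing E with
  | nil => simp [solsFrom, sols]
  | cons g G ih =>
    refine (ih _).trans ?_
    simp only [List.flatMap_append, sols, List.flatMap_map]
    exact (List.flatMap_append_perm E _ _)

theorem length_solsFrom (G E : List (List Bool)) : (solsFrom G E).length = 2 ^ G.length *
    E.length := by
  induction G generalizing E with
  | nil => simp [solsFrom]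
  | cons g G ih => simp [solsFrom, ih, pow_succ]; ring

theorem length_sols (G : List (List Bool)) (c : List Bool) : (sols G c).length = 2 ^ G.length := by
  induction G generalizing c with
  | nil => simp [sols]
  | cons g G ih => simp [sols, ih, pow_succ]; ring

theorem sols_perm {G G' : List (List Bool)} (h : G.Perm G') (c : List Bool) :
    (sols G c).Perm (sols G' c) := by
  induction h generalizing c with
  | nil => exact .refl _
  | cons g _ ih => exact (ih _).append (ih _)
  | swap g g' G =>
    simp only [sols, List.append_assoc]
    rw [vx_left_comm g' g c]
    refine List.Perm.append_left _ ?_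
    rw [← List.append_assoc, ← List.append_assoc]
    exact List.Perm.append_right _ List.perm_append_comm
  | trans _ _ ih ih' => exact (ih _).trans (ih' _)

/-- One step of Gaussian elimination, for the equation `⟨N, ·⟩ = 0`: the first vector that violates
the equation becomes the pivot, and is added to all later vectors that violate it. -/
def elimGo (N : List Bool) : Option (List Bool) → List (List Bool) →
    Option (List Bool) × List (List Bool)
  | P, [] => (P, [])
  | P, v :: vs =>
    if ip N v then
      match P with
      | none => elimGo N (some v) vs
      | some p => ((elimGo N P vs).1, vx p v :: (elimGo N P vs).2)
    else ((elimGo N P vs).1, v :: (elimGo N P vs).2)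

/-- Elimination for generators `G` and at most one point `U` of an affine space. -/
def elimStep (N : List Bool) (S : List (List Bool) × List (List Bool)) :
    List (List Bool) × List (List Bool) :=
  ((elimGo N none S.1).2, (elimGo N (elimGo N none S.1).1 S.2).2)

/-- The affine space with generators `G` and at most one point `U`. -/
def space (S : List (List Bool) × List (List Bool)) : List (List Bool) := S.2.flatMap (sols S.1)

/-- Adds the pivot to a vector that violates the equation. -/
def fixBy (N p v : List Bool) : List Bool := if ip N v then vx p v else v

theorem elimGo_some (N p : List Bool) (vs : List (List Bool)) :
    elimGo N (some p) vs = (some p, vs.map (fixBy N p)) := by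
  induction vs with
  | nil => rfl
  | cons v vs ih => by_cases h : ip N v <;> simp [elimGo, ih, fixBy, h]

/-- If there is no pivot, the left hand side of the equation is constant on the affine space. -/
theorem elimGo_none_of_fst (N : List Bool) (G : List (List Bool)) (h : (elimGo N none G).1 = none) :
    (elimGo N none G).2 = G ∧ ∀ g ∈ G, ip N g = false := by
  induction G with
  | nil => simp [elimGo]
  | cons g G ih =>
    by_cases hg : ip N g
    · simp [elimGo, hg, elimGo_some] at h
    · simp only [elimGo, hg] at h ⊢
      simpa [hg] using ih h

theorem fixBy_vx {m : ℕ} {N p h c : List Bool} (hp : p.length = m) (hh : h.length = m)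
    (hc : c.length = m) : vx (fixBy N p h) (fixBy N p c) = fixBy N p (vx h c) := by
  unfold fixBy
  rw [ip_vx N (hh.trans hc.symm)]
  cases ip N h <;> cases ip N c <;>
    simp only [Bool.xor_true, Bool.xor_false, Bool.not_true, Bool.not_false, if_true,
      Bool.false_eq_true, if_false]
  · exact vx_left_comm _ _ _
  · exact vx_assoc _ _ _
  · rw [vx_assoc, vx_left_comm h p c, vx_self_vx]
    rw [hp, length_vx hh hc]

/-- Of the points `v` and `p + v`, where `p` violates the equation, exactly one satisfies it, and
`fixBy` selects it. Hence fixing all vectors lists the points that satisfy the equation. -/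
theorem sols_map_fixBy {m : ℕ} {N p : List Bool} (hp : p.length = m) (hip : ip N p = true)
    {G : List (List Bool)} (hG : ∀ g ∈ G, g.length = m) {c : List Bool} (hc : c.length = m) :
    (sols (G.map (fixBy N p)) (fixBy N p c)).Perm
      ((sols G (vx p c) ++ sols G c).filter fun v => !ip N v) := by
  induction G generalizing c with
  | nil =>
    simp only [List.map_nil, sols, fixBy, List.cons_append, List.nil_append]
    have h := ip_vx N (hp.trans hc.symm)
    rw [hip] at h
    cases hc' : ip N c <;> simp [h, hc']
  | cons g G ih =>
    have hg := hG g (by simp)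
    have hG' : ∀ g ∈ G, g.length = m := fun g h => hG g (by simp [h])
    simp only [List.map_cons, sols]
    rw [fixBy_vx hp hg hc]
    refine ((ih hG' (length_vx hg hc)).append (ih hG' hc)).trans ?_
    rw [← List.filter_append, vx_left_comm p g c]
    refine List.Perm.filter _ ?_
    simp only [List.append_assoc]
    refine List.Perm.append_left _ ?_
    rw [← List.append_assoc, ← List.append_assoc]
    exact List.Perm.append_right _ List.perm_append_comm

/-- If there is a pivot, the affine space loses one dimension and half of its points. -/
theorem elimGo_none_perm {m : ℕ} {N p : List Bool} {G : List (List Bool)}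
    (hG : ∀ g ∈ G, g.length = m) (h : (elimGo N none G).1 = some p) :
    p.length = m ∧ ip N p = true ∧ ∀ c : List Bool, c.length = m →
      (sols (elimGo N none G).2 (fixBy N p c)).Perm ((sols G c).filter fun v => !ip N v) := by
  induction G with
  | nil => simp [elimGo] at h
  | cons g G ih =>
    have hg := hG g (by simp)
    have hG' : ∀ g ∈ G, g.length = m := fun g h => hG g (by simp [h])
    by_cases hgi : ip N g
    · simp only [elimGo, hgi, if_true, elimGo_some, Option.some.injEq] at h ⊢
      subst h
      exact ⟨hg, hgi, fun c hc => sols_map_fixBy hg hgi hG' hc⟩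
    · simp only [elimGo, hgi] at h ⊢
      obtain ⟨hp, hpi, H⟩ := ih hG' h
      refine ⟨hp, hpi, fun c hc => ?_⟩
      simp only [sols, List.filter_append, Bool.false_eq_true, if_false]
      refine List.Perm.append ?_ (H c hc)
      have e : vx g (fixBy N p c) = fixBy N p (vx g c) := by
        have := fixBy_vx (N := N) hp hg hc
        rwa [fixBy, if_neg hgi] at this
      rw [e]
      exact H _ (length_vx hg hc)

theorem ip_of_mem_sols {m : ℕ} {N : List Bool} {G : List (List Bool)} (hG : ∀ g ∈ G, g.length = m)
    (h : ∀ g ∈ G, ip N g = false) {c v : List Bool} (hc : c.length = m) (hv : v ∈ sols G c) :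
    ip N v = ip N c := by
  induction G generalizing c with
  | nil => simp only [sols, List.mem_singleton] at hv; rw [hv]
  | cons g G ih =>
    have hg := hG g (by simp)
    have hG' : ∀ g ∈ G, g.length = m := fun g h => hG g (by simp [h])
    have h' : ∀ g ∈ G, ip N g = false := fun g hg => h g (by simp [hg])
    simp only [sols, List.mem_append] at hv
    rcases hv with hv | hv
    · rw [ih hG' h' (length_vx hg hc) hv, ip_vx N (hg.trans hc.symm), h g (by simp), Bool.false_xor]
    · exact ih hG' h' hc hv

/-- Elimination computes the points of an affine space that satisfy an equation. -/
theorem space_elimStep {m : ℕ} (N : List Bool) (S : List (List Bool) × List (List Bool))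
    (hG : ∀ g ∈ S.1, g.length = m) (hU : ∀ c ∈ S.2, c.length = m) (hU1 : S.2.length ≤ 1) :
    (space (elimStep N S)).Perm ((space S).filter fun v => !ip N v) := by
  obtain ⟨G, U⟩ := S
  simp only [space, elimStep] at *
  match U, hU1 with
  | [], _ => simp [elimGo]
  | [c], _ =>
    have hc := hU c (by simp)
    simp only [List.flatMap_cons, List.flatMap_nil, List.append_nil]
    cases h : (elimGo N none G).1 with
    | some p =>
      rw [elimGo_some]
      simpa using (elimGo_none_perm hG h).2.2 c hc
    | none =>
      obtain ⟨h1, h2⟩ := elimGo_none_of_fst N G h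
      rw [h1]
      have key : ∀ v ∈ sols G c, (!ip N v) = !ip N c := fun v hv => by
        rw [ip_of_mem_sols hG h2 hc hv]
      rw [List.filter_congr key]
      cases hi : ip N c <;> simp [elimGo, hi]

theorem length_elimGo_le (N : List Bool) (P : Option (List Bool)) (vs : List (List Bool)) :
    (elimGo N P vs).2.length ≤ vs.length := by
  induction vs generalizing P with
  | nil => simp [elimGo]
  | cons v vs ih =>
    unfold elimGo
    split
    · split
      · exact (ih _).trans (by simp)
      · simpa using ih _
    · simpa using ih _

/-- `v` has `m` coordinates, the first of which is `h`: a point of affine space is written with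
first coordinate `true`, a direction with first coordinate `false`. -/
def IsVec (h : Bool) (m : ℕ) (v : List Bool) : Prop := v.length = m ∧ v.head? = some h

theorem IsVec.vx {h : Bool} {m : ℕ} {u v : List Bool} (hu : IsVec false m u) (hv : IsVec h m v) :
    IsVec h m (vx u v) := by
  refine ⟨length_vx hu.1 hv.1, ?_⟩
  rcases u with _ | ⟨a, u⟩
  · simpa using hu.2
  rcases v with _ | ⟨b, v⟩
  · simpa using hv.2
  have h1 := hu.2
  have h2 := hv.2
  simp only [List.head?_cons, Option.some.injEq] at h1 h2
  simp [DNFStream.vx, h1, h2]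

theorem IsVec.fixBy {h : Bool} {m : ℕ} {N p v : List Bool} (hp : IsVec false m p)
    (hv : IsVec h m v) : IsVec h m (fixBy N p v) := by
  unfold DNFStream.fixBy
  split
  · exact hp.vx hv
  · exact hv

theorem elimGo_none_isVec {m : ℕ} (N : List Bool) {G : List (List Bool)}
    (hG : ∀ g ∈ G, IsVec false m g) :
    (∀ p, (elimGo N none G).1 = some p → IsVec false m p) ∧
      ∀ g ∈ (elimGo N none G).2, IsVec false m g := by
  induction G with
  | nil => simp [elimGo]
  | cons g G ih =>
    have hg := hG g (by simp)
    have hG' : ∀ g ∈ G, IsVec false m g := fun g h => hG g (by simp [h])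
    by_cases hgi : ip N g
    · simp only [elimGo, hgi, if_true, elimGo_some, Option.some.injEq, forall_eq', hg, true_and,
        List.mem_map, forall_exists_index, and_imp, forall_apply_eq_imp_iff₂]
      exact fun v hv => hg.fixBy (hG' v hv)
    · simp only [elimGo, hgi, Bool.false_eq_true, if_false, List.mem_cons, forall_eq_or_imp, hg,
        true_and]
      exact ih hG'

/-- At most one point, and directions. -/
def IsSpace (m : ℕ) (S : List (List Bool) × List (List Bool)) : Prop :=
  (∀ g ∈ S.1, IsVec false m g) ∧ (∀ c ∈ S.2, IsVec true m c) ∧ S.2.length ≤ 1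

theorem IsSpace.elimStep {m : ℕ} (N : List Bool) {S : List (List Bool) × List (List Bool)}
    (hS : IsSpace m S) : IsSpace m (elimStep N S) := by
  obtain ⟨G, U⟩ := S
  obtain ⟨hG, hU, hU1⟩ := hS
  have h := elimGo_none_isVec N hG
  refine ⟨h.2, ?_, (length_elimGo_le _ _ _).trans hU1⟩
  simp only [DNFStream.elimStep]
  cases hp : (elimGo N none G).1 with
  | some p =>
    rw [elimGo_some]
    simp only [List.mem_map, forall_exists_index, and_imp, forall_apply_eq_imp_iff₂]
    exact fun v hv => (h.1 p hp).fixBy (hU v hv)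
  | none =>
    match U, hU1 with
    | [], _ => simp [elimGo]
    | [c], _ => cases hi : ip N c <;> simp_all [elimGo]

theorem IsSpace.perm_elimStep {m : ℕ} (N : List Bool) {S : List (List Bool) × List (List Bool)}
    (hS : IsSpace m S) :
    (space (DNFStream.elimStep N S)).Perm ((space S).filter fun v => !ip N v) :=
  space_elimStep N S (fun g h => (hS.1 g h).1) (fun c h => (hS.2.1 c h).1) hS.2.2

theorem IsSpace.isVec_of_mem {m : ℕ} {S : List (List Bool) × List (List Bool)}
    (hS : IsSpace m S) {v : List Bool} (hv : v ∈ space S) : IsVec true m v := by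
  obtain ⟨G, U⟩ := S
  obtain ⟨hG, hU, -⟩ := hS
  simp only [space, List.mem_flatMap] at hv hG hU
  obtain ⟨c, hc, hv⟩ := hv
  replace hc := hU c hc
  clear hU
  induction G generalizing c with
  | nil =>
    simp only [sols, List.mem_singleton] at hv
    exact hv ▸ hc
  | cons g G ih =>
    simp only [sols, List.mem_append] at hv
    have hG' : ∀ g ∈ G, IsVec false m g := fun g h => hG g (by simp [h])
    rcases hv with hv | hv
    · exact ih hG' _ hv ((hG g (by simp)).vx hc)
    · exact ih hG' c hv hc

/-! ### The assignments that satisfy a term -/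

/-- Whether an assignment satisfies a term. For each variable the term is given by two bits: whether
the variable occurs positively, and whether it occurs negated. -/
def satTerm : List (Bool × Bool) → List Bool → Bool
  | l :: ts, b :: v => !((l.1 && !b) || (l.2 && b)) && satTerm ts v
  | _, _ => true

/-- A generator for each variable that does not occur in the term. -/
def termGens : List (Bool × Bool) → List (List Bool)
  | [] => []
  | l :: ts =>
    if l = (false, false) then
      (true :: List.replicate ts.length false) :: (termGens ts).map (false :: ·)
    else (termGens ts).map (false :: ·)

/-- The assignment that makes true exactly the variables that occur positively. -/
def termPoint (ts : List (Bool × Bool)) : List Bool := ts.map Prod.fst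

theorem sols_map_false (G : List (List Bool)) (b : Bool) (c : List Bool) :
    sols (G.map (false :: ·)) (b :: c) = (sols G c).map (b :: ·) := by
  induction G generalizing c with
  | nil => rfl
  | cons g G ih =>
    have : vx (false :: g) (b :: c) = b :: vx g c := by simp [vx]
    simp [sols, this, ih]

theorem vx_replicate_false (c : List Bool) : vx (List.replicate c.length false) c = c := by
  induction c with
  | nil => rfl
  | cons a c ih =>
    unfold vx at *
    simp [List.replicate_succ, ih]

theorem length_termGens_le (ts : List (Bool × Bool)) : (termGens ts).length ≤ ts.length := by
  induction ts with
  | nil => simp [termGens]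
  | cons l ts ih =>
    unfold termGens
    split <;> simp <;> omega

theorem length_of_mem_termGens {ts : List (Bool × Bool)} {g : List Bool} (h : g ∈ termGens ts) :
    g.length = ts.length := by
  induction ts generalizing g with
  | nil => simp [termGens] at h
  | cons l ts ih =>
    unfold termGens at h
    split at h
    · simp only [List.mem_cons, List.mem_map] at h
      rcases h with rfl | ⟨g, hg, rfl⟩
      · simp
      · simp [ih hg]
    · simp only [List.mem_map] at h
      obtain ⟨g, hg, rfl⟩ := h
      simp [ih hg]

theorem nodup_sols_term (ts : List (Bool × Bool)) : (sols (termGens ts) (termPoint ts)).Nodup := by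
  induction ts with
  | nil => simp [termGens, termPoint, sols]
  | cons l ts ih =>
    have hinj : ∀ b : Bool, Injective (fun v : List Bool => b :: v) := fun b u v h => by simpa
      using h
    unfold termGens
    split_ifs with h
    · subst h
      have e : vx (true :: List.replicate ts.length false) (termPoint ((false, false) :: ts)) =
          true :: termPoint ts := by
        have := vx_replicate_false (termPoint ts)
        simp only [termPoint, List.length_map] at this
        simp [vx] at this
        simp [vx, termPoint, this]
      rw [sols, e, show termPoint ((false, false) :: ts) = false :: termPoint ts from rfl,
        sols_map_false, sols_map_false]
      refine List.Nodup.append (ih.map (hinj _)) (ih.map (hinj _)) ?_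
      intro v h1 h2
      simp only [List.mem_map] at h1 h2
      obtain ⟨u, -, rfl⟩ := h1
      obtain ⟨u', -, h⟩ := h2
      simp at h
    · rw [show termPoint (l :: ts) = l.1 :: termPoint ts from rfl, sols_map_false]
      exact ih.map (hinj _)

theorem mem_sols_term {ts : List (Bool × Bool)} (hts : (true, true) ∉ ts) (v : List Bool) :
    v ∈ sols (termGens ts) (termPoint ts) ↔ v.length = ts.length ∧ satTerm ts v = true := by
  induction ts generalizing v with
  | nil => simp [termGens, termPoint, sols, satTerm]
  | cons l ts ih =>
    simp only [List.mem_cons, not_or] at hts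
    have ih := ih hts.2
    unfold termGens
    split_ifs with h
    · subst h
      have e : vx (true :: List.replicate ts.length false) (termPoint ((false, false) :: ts)) =
          true :: termPoint ts := by
        have := vx_replicate_false (termPoint ts)
        simp only [termPoint, List.length_map] at this
        simp [vx] at this
        simp [vx, termPoint, this]
      rw [sols, e, show termPoint ((false, false) :: ts) = false :: termPoint ts from rfl,
        sols_map_false, sols_map_false]
      rcases v with _ | ⟨b, v⟩
      · simp
      · cases b <;> simp [ih, satTerm]
    · rw [show termPoint (l :: ts) = l.1 :: termPoint ts from rfl, sols_map_false]
      rcases v with _ | ⟨b, v⟩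
      · simp
      · obtain ⟨p, q⟩ := l
        have := hts.1
        revert h this
        cases b <;> cases p <;> cases q <;> simp [ih, satTerm]

/-- A term with complementary literals has no satisfying assignment. -/
theorem satTerm_eq_false {ts : List (Bool × Bool)} (hts : (true, true) ∈ ts) {v : List Bool}
    (hv : v.length = ts.length) : satTerm ts v = false := by
  induction ts generalizing v with
  | nil => simp at hts
  | cons l ts ih =>
    rcases v with _ | ⟨b, v⟩
    · simp at hv
    · rcases List.mem_cons.1 hts with rfl | h
      · cases b <;> simp [satTerm]
      · simp [satTerm, ih h (by simpa using hv)]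

/-- The affine space of the assignments that satisfy a term. -/
def termSpace (ts : List (Bool × Bool)) : List (List Bool) × List (List Bool) :=
  (((termGens ts).map (false :: ·)).reverse,
    if (true, true) ∈ ts then [] else [true :: termPoint ts])

theorem isSpace_termSpace (ts : List (Bool × Bool)) : IsSpace (ts.length + 1) (termSpace ts) := by
  refine ⟨?_, ?_, ?_⟩
  · simp only [termSpace, List.mem_reverse, List.mem_map, forall_exists_index, and_imp,
      forall_apply_eq_imp_iff₂]
    exact fun g hg => ⟨by simp [length_of_mem_termGens hg], rfl⟩
  · unfold termSpace
    split_ifs <;> simp [IsVec, termPoint]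
  · unfold termSpace
    split_ifs <;> simp

theorem space_termSpace_perm {ts : List (Bool × Bool)} (hts : (true, true) ∉ ts) :
    (space (termSpace ts)).Perm ((sols (termGens ts) (termPoint ts)).map (true :: ·)) := by
  simp only [space, termSpace, if_neg hts, List.flatMap_cons, List.flatMap_nil, List.append_nil]
  rw [← sols_map_false]
  exact sols_perm (List.reverse_perm _) _

theorem nodup_space_termSpace (ts : List (Bool × Bool)) : (space (termSpace ts)).Nodup := by
  by_cases hts : (true, true) ∈ ts
  · simp [space, termSpace, hts]
  · rw [(space_termSpace_perm hts).nodup_iff]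
    exact (nodup_sols_term ts).map fun u v h => by simpa using h

theorem mem_space_termSpace {ts : List (Bool × Bool)} (v : List Bool) :
    true :: v ∈ space (termSpace ts) ↔ v.length = ts.length ∧ satTerm ts v = true := by
  by_cases hts : (true, true) ∈ ts
  · simp only [space, termSpace, hts, if_true, List.flatMap_nil, List.not_mem_nil, false_iff,
      not_and]
    intro h
    simp [satTerm_eq_false hts h]
  · rw [(space_termSpace_perm hts).mem_iff]
    simp [mem_sols_term hts]

/-! ### Vectors on stacks -/

/-- A vector is written as its first coordinate followed by the other ones. -/
def vtext : List Bool → List Sym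
  | [] => []
  | h :: l => .hd h :: l.map .bit

/-- A list of vectors. -/
def vsText (vs : List (List Bool)) : List Sym := vs.flatMap vtext

/-- An optional vector. -/
def ptext : Option (List Bool) → List Sym
  | none => []
  | some p => vtext p

/-- A term, as it is written on the work stacks. -/
def ttext (ts : List (Bool × Bool)) : List Sym := .sep :: ts.map fun l => .con l.1 l.2

@[simp] theorem length_vtext (v : List Bool) : (vtext v).length = v.length := by
  cases v <;> simp [vtext]

theorem length_vsText {m : ℕ} {vs : List (List Bool)} (h : ∀ v ∈ vs, v.length = m) :
    (vsText vs).length = m * vs.length := by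
  induction vs with
  | nil => simp [vsText]
  | cons v vs ih =>
    have := ih fun v hv => h v (by simp [hv])
    simp only [vsText, List.flatMap_cons, List.length_append, length_vtext, List.length_cons] at *
    rw [this, h v (by simp)]; ring

@[simp] theorem length_ttext (ts : List (Bool × Bool)) : (ttext ts).length = ts.length + 1 := by
  simp [ttext]

@[simp] theorem vsText_nil : vsText [] = [] := rfl

@[simp] theorem vsText_cons (v : List Bool) (vs : List (List Bool)) :
    vsText (v :: vs) = vtext v ++ vsText vs := by simp [vsText]

@[simp] theorem vsText_append (vs ws : List (List Bool)) :
    vsText (vs ++ ws) = vsText vs ++ vsText ws := by simp [vsText]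

/-- The update of the bit for an inner product. -/
def dotBit (s u : Sym) (q : Bool) : Bool := xor q (s.toBit && u.toBit)

/-- The update of the bit for a term: has a literal been violated? -/
def termBit (s u : Sym) (q : Bool) : Bool :=
  q || match s with
    | .con p n => (p && !u.toBit) || (n && u.toBit)
    | _ => false

/-- The addition of vectors, symbol by symbol. -/
def addSym (s u : Sym) : Sym :=
  match u with
  | .hd h => .hd (xor s.toBit h)
  | u => .bit (xor s.toBit u.toBit)

theorem map_toBit_vtext (v : List Bool) : (vtext v).map Sym.toBit = v := by
  cases v <;> simp [vtext, Sym.toBit, Function.comp_def]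

theorem scanBit_dotBit (zs us : List Sym) (q : Bool) :
    scanBit dotBit zs us q = xor q (ip (zs.map Sym.toBit) (us.map Sym.toBit)) := by
  induction zs generalizing us q with
  | nil => simp [scanBit, ip]
  | cons s zs ih =>
    cases us with
    | nil => simp [scanBit, ip]
    | cons u us => simp [scanBit, ip, ih, dotBit]

theorem scanBit_vtext (N v : List Bool) : scanBit dotBit (vtext N) (vtext v) false = ip N v := by
  simp [scanBit_dotBit, map_toBit_vtext]

theorem scanBit_ttext (ts : List (Bool × Bool)) (v : List Bool) :
    scanBit termBit (ttext ts) (vtext (true :: v)) false = !satTerm ts v := by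
  have key : ∀ (v : List Bool) (q : Bool), scanBit termBit (ts.map fun l => .con l.1 l.2)
      (v.map .bit) q = (q || !satTerm ts v) := by
    induction ts with
    | nil => intro v q; simp [scanBit, satTerm]
    | cons l ts ih =>
      intro v q
      rcases v with _ | ⟨b, v⟩
      · simp [scanBit, satTerm]
      · simp only [List.map_cons, scanBit, ih, termBit, satTerm, Sym.toBit]
        generalize satTerm ts v = x
        obtain ⟨p, n⟩ := l
        clear ih
        revert b x q p n
        decide
  simp [ttext, vtext, scanBit, key, termBit]

theorem zipWith_snd (zs us : List Sym) (h : zs.length = us.length) :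
    List.zipWith (fun _ u => u) zs us = us := by
  induction zs generalizing us with
  | nil => simpa using h.symm
  | cons s zs ih =>
    cases us with
    | nil => simp at h
    | cons u us => simpa using ih us (by simpa using h)

theorem zipWith_addSym (p v : List Bool) :
    List.zipWith addSym (vtext p) (vtext v) = vtext (vx p v) := by
  rcases p with _ | ⟨a, p⟩
  · simp [vtext, vx]
  rcases v with _ | ⟨b, v⟩
  · simp [vtext, vx]
  · simp [vtext, vx, addSym, Sym.toBit, List.zipWith_map, List.map_zipWith]

/-- Whether a symbol is a coordinate of a vector other than the first one. -/
def Sym.isBit : Sym → Bool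
  | .bit _ => true
  | _ => false

/-- Moves the (reversed) vector on top of `Y` to `dst`. -/
def takeY (dst : Reg) : Prog :=
  mvWhile Sym.isBit .Y dst ;; .pop .Y fun o => .push dst (o.getD .sep)

theorem runs_takeY (dst : Reg) (hd : .Y ≠ dst) (S : Store) (v : List Bool) (hv : v ≠ [])
    (r : List Sym) (hY : S .Y = (vtext v).reverse ++ r) :
    Runs (takeY dst) S (update (update S .Y r) dst (vtext v ++ S dst)) (2 * v.length + 1) := by
  obtain ⟨h, l, rfl⟩ := List.exists_cons_of_ne_nil hv
  refine (Runs.seq (runs_mvWhile Sym.isBit .Y dst hd S (l.map Sym.bit).reverse (.hd h :: r)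
    (by simp [hY, vtext]) ?_ rfl) (Runs.pop_some (s := .hd h) (l := r) ?_ (Runs.push _ _ _))).of_eq
    ?_ ?_
  · simp only [List.mem_reverse, List.mem_map, forall_exists_index, and_imp,
      forall_apply_eq_imp_iff₂]
    exact fun _ _ => rfl
  · simp [hd]
  · funext k
    simp only [update_apply]
    split_ifs <;> simp_all [vtext]
  · simp; omega

/-- Deletes the (reversed) vector on top of `Y`. -/
def dropY : Prog := .each .Y Sym.isBit (fun _ => .skip) ;; .pop .Y fun _ => .skip

theorem runs_dropY (S : Store) (v : List Bool) (hv : v ≠ [])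
    (r : List Sym) (hY : S .Y = (vtext v).reverse ++ r) :
    Runs dropY S (update S .Y r) (v.length + 1) := by
  obtain ⟨h, l, rfl⟩ := List.exists_cons_of_ne_nil hv
  have key : ∀ (l : List Bool) (S : Store), S .Y = l.map .bit ++ .hd h :: r →
      Runs (.each .Y Sym.isBit (fun _ => .skip)) S (update S .Y (.hd h :: r)) (l.length + 1) := by
    intro l
    induction l with
    | nil =>
      intro S hS
      refine (Runs.each_stop (by simp [hS, Sym.isBit])).of_eq ?_ (by simp)
      simp only [List.map_nil, List.nil_append] at hS
      rw [← hS, update_eq_self]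
    | cons b l ih =>
      intro S hS
      refine (Runs.each_step hS rfl Runs.skip (ih _ ?_)).of_eq ?_ ?_
      · simp
      · simp
      · simp
  refine (Runs.seq (key l.reverse S (by simp [hY, vtext])) (Runs.pop_some (s := .hd h) (l := r) ?_
    Runs.skip)).of_eq ?_ ?_
  · simp
  · simp
  · simp

theorem Runs.each_peek {k : Reg} {c : Sym → Bool} {f : Sym → Prog} {s : Sym} {l : List Sym}
    {S S' S'' : Store} {t t' : ℕ} (hk : S k = s :: l) (hc : c s = true) (h : Runs (f s) S S' t)
    (h' : Runs (.each k c fun s => .push k s ;; f s) S' S'' t') :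
    Runs (.each k c fun s => .push k s ;; f s) S S'' (t + t' + 2) := by
  refine (Runs.each_step hk hc (Runs.push_seq (t := t) ?_) h').mono (by omega)
  have : update (update S k l) k (s :: update S k l k) = S := by
    rw [update_idem, update_self, ← hk, update_eq_self]
  rwa [this]

/-- Goes on with `f o`, where `o` is the top symbol of `k`, which is left in place. -/
def peek (k : Reg) (f : Option Sym → Prog) : Prog :=
  .pop k fun o => match o with
    | none => f none
    | some s => .push k s ;; f (some s)

theorem runs_peek {k : Reg} {f : Option Sym → Prog} {S S' : Store} {t : ℕ}
    (h : Runs (f (S k).head?) S S' t) : Runs (peek k f) S S' (t + 2) := by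
  cases hk : S k with
  | nil =>
    rw [hk] at h
    exact Runs.mono (t := t + 1) (Runs.pop_none hk h) (by omega)
  | cons s l =>
    rw [hk] at h
    refine Runs.pop_some (t := t + 1) hk (Runs.push_seq ?_)
    have : update (update S k l) k (s :: update S k l k) = S := by
      rw [update_idem, update_self, ← hk, update_eq_self]
    rwa [this]

/-- Goes on with `p` or `q` according to the bit on top of `Q`, which is popped. -/
def ifQ (p q : Prog) : Prog := .pop .Q fun o => if (o.getD .sep).toBit then p else q

theorem runs_ifQ {p q : Prog} {S S' : Store} {t : ℕ} {b : Bool} {l : List Sym}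
    (hQ : S .Q = .bit b :: l) (h : Runs (if b then p else q) (update S .Q l) S' t) :
    Runs (ifQ p q) S S' (t + 1) :=
  Runs.pop_some hQ h

/-- One vector of Gaussian elimination. -/
def elimBody (src : Reg) : Prog :=
  scan .N src dotBit (fun _ u => u) ;;
  ifQ (peek .P fun o => match o with
    | none => takeY .P
    | some _ => takeY src ;; scan .P src (fun _ _ q => q) addSym ;; .pop .Q fun _ => .skip)
  .skip

/-- One step of Gaussian elimination for the vectors on `src`, the equation being on `N` and the
pivot on `P`. -/
def elimProg (src : Reg) : Prog :=
  .each src (fun _ => true) (fun s => .push src s ;; elimBody src) ;; mv .Y src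

section Elim

variable (src : Reg) (hd : [src, .N, .P, .X, .Y, .Q].Nodup) (m : ℕ) (N : List Bool)
  (hN : N.length = m) (v : List Bool) (hv0 : v ≠ []) (hv : v.length = m) (S : Store)
  (hSN : S .N = vtext N) (r : List Sym) (hsrc : S src = vtext v ++ r) (hX : S .X = [])

include hd hN hv hSN hsrc hX

theorem runs_elimBody_scan :
    Runs (scan .N src dotBit fun _ u => u) S (update (update (update S src r)
      .Y ((vtext v).reverse ++ S .Y)) .Q (.bit (ip N v) :: S .Q)) (8 * m + 3) := by
  have hd1 : [Reg.N, src, .X, .Y, .Q].Nodup := by simp_all; tauto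
  have hlen : (vtext N).length = (vtext v).length := by simp [hN, ← hv]
  have hscan := runs_scan .N src dotBit (fun _ u => u) hd1 (vtext N) (vtext v) r S
    hSN hsrc hlen hX
  rw [scanBit_vtext, zipWith_snd _ _ hlen] at hscan
  exact hscan.mono (by simp [hN])

theorem runs_elimBody_false (hip : ip N v = false) :
    Runs (elimBody src) S (update (update S src r) .Y ((vtext v).reverse ++ S .Y)) (8 * m + 4) := by
  have hscan := runs_elimBody_scan src hd m N hN v hv S hSN r hsrc hX
  rw [hip] at hscan
  refine (hscan.seq (t' := 1) ?_)
  refine (runs_ifQ (b := false) (l := S .Q) (by simp) Runs.skip).of_eq ?_ le_rfl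
  clear hscan
  funext k
  simp only [update_apply]
  split_ifs <;> simp_all

include hv0

theorem runs_elimBody_pivot (hip : ip N v = true) (hSP : S .P = []) :
    Runs (elimBody src) S (update (update S src r) .P (vtext v)) (10 * m + 7) := by
  have hscan := runs_elimBody_scan src hd m N hN v hv S hSN r hsrc hX
  rw [hip] at hscan
  simp only [List.nodup_cons, List.mem_cons, List.not_mem_nil, or_false, not_or] at hd
  obtain ⟨⟨h1, h2, h3, h4, h5⟩, -⟩ := hd
  refine (hscan.seq (t' := 2 * m + 4) ?_).mono (by omega)
  clear hscan
  refine runs_ifQ (b := true) (l := S .Q) (by simp) ?_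
  rw [if_pos rfl]
  refine runs_peek ?_
  simp only [update_apply, hSP, List.head?_nil, reduceCtorEq, if_false, Ne.symm h2]
  refine (runs_takeY .P (by simp) _ v hv0 (S .Y) (by simp)).of_eq ?_ (by rw [hv])
  funext k
  simp only [update_apply]
  split_ifs <;> simp_all

theorem runs_elimBody_add (hip : ip N v = true) (p : List Bool) (hp : p.length = m)
    (hSP : S .P = vtext p) :
    Runs (elimBody src) S (update (update S src r) .Y ((vtext (vx p v)).reverse ++ S .Y))
      (18 * m + 12) := by
  have hscan := runs_elimBody_scan src hd m N hN v hv S hSN r hsrc hX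
  rw [hip] at hscan
  have hd2 : [Reg.P, src, .X, .Y, .Q].Nodup := by simp_all; tauto
  simp only [List.nodup_cons, List.mem_cons, List.not_mem_nil, or_false, not_or] at hd
  obtain ⟨⟨h1, h2, h3, h4, h5⟩, -⟩ := hd
  have hlenp : (vtext p).length = (vtext v).length := by simp [hp, ← hv]
  refine (hscan.seq (t' := 10 * m + 9) ?_).mono (by omega)
  clear hscan
  refine (runs_ifQ (b := true) (l := S .Q) (t := 10 * m + 8) (by simp) ?_)
  rw [if_pos rfl]
  refine runs_peek (t := 10 * m + 6) ?_
  obtain ⟨a, w, hw⟩ : ∃ a w, vtext p = a :: w := by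
    have hp0 : p ≠ [] := by
      rintro rfl
      exact hv0 (List.length_eq_zero_iff.1 (hv.trans hp.symm))
    obtain ⟨a, w, rfl⟩ := List.exists_cons_of_ne_nil hp0
    exact ⟨_, _, rfl⟩
  have hPh : ((update (update (update (update S src r) .Y ((vtext v).reverse ++ S .Y)) .Q
      (.bit true :: S .Q)) .Q (S .Q) : Store) .P).head? = some a := by
    simp [Ne.symm h2, hSP, hw]
  rw [hPh]
  refine (Runs.seq (runs_takeY src (Ne.symm h4) _ v hv0 (S .Y) (by simp))
    (Runs.seq (runs_scan .P src (fun _ _ q => q) addSym hd2 (vtext p) (vtext v)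
      r _ ?_ ?_ hlenp ?_) (Runs.pop_some
      (s := Sym.bit (scanBit (fun _ _ q => q) (vtext p) (vtext v) false)) (l := S .Q)
      ?_ Runs.skip))).of_eq ?_ ?_
  · simp [Ne.symm h2, hSP]
  · simp [h4, h5]
  · simp [Ne.symm h3, hX]
  · simp [Ne.symm h5]
  · rw [zipWith_addSym]
    clear hPh
    funext k
    simp only [update_apply]
    split_ifs <;> simp_all
  · simp [hv, hp]; omega

end Elim

theorem runs_elim_loop (src : Reg) (hd : [src, .N, .P, .X, .Y, .Q].Nodup) (m : ℕ) (N : List Bool)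
    (hN : N.length = m) (hm : m ≠ 0) (vs : List (List Bool)) (P : Option (List Bool)) (S : Store)
    (hSN : S .N = vtext N) (hsrc : S src = vsText vs) (hvs : ∀ v ∈ vs, v.length = m)
    (hSP : S .P = ptext P) (hP : ∀ p ∈ P, p.length = m) (hX : S .X = []) :
    Runs (.each src (fun _ => true) (fun s => .push src s ;; elimBody src)) S
      (update (update (update S src []) .P (ptext (elimGo N P vs).1))
        .Y ((vsText (elimGo N P vs).2).reverse ++ S .Y)) ((18 * m + 16) * vs.length + 1) := by
  have hd' := hd
  simp only [List.nodup_cons, List.mem_cons, List.not_mem_nil, or_false, not_or] at hd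
  obtain ⟨⟨h1, h2, h3, h4, h5⟩, -⟩ := hd
  induction vs generalizing S P with
  | nil =>
    refine (Runs.each_stop (by simp [hsrc])).of_eq ?_ (by simp)
    funext k
    simp only [update_apply]
    split_ifs <;> simp_all [elimGo]
  | cons v vs ih =>
    have hv := hvs v (by simp)
    have hvs' : ∀ v ∈ vs, v.length = m := fun v hv => hvs v (by simp [hv])
    have hv0 : v ≠ [] := by rintro rfl; exact hm hv.symm
    obtain ⟨h, l, rfl⟩ := List.exists_cons_of_ne_nil hv0
    have hsrc' : S src = vtext (h :: l) ++ vsText vs := by simpa using hsrc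
    by_cases hip : ip N (h :: l)
    · rcases P with _ | p
      · have hbody := runs_elimBody_pivot src hd' m N hN _ hv0 hv S hSN _ hsrc' hX hip hSP
        refine (Runs.each_peek (s := .hd h) hsrc' rfl hbody
          (ih (some (h :: l)) _ ?_ ?_ hvs' ?_ ?_ ?_)).of_eq ?_ ?_
        · simp [*, Ne.symm h1]
        · simp [*]
        · simp [ptext]
        · simpa using hv
        · simp [*, Ne.symm h3]
        · clear ih hbody
          funext k
          simp only [update_apply]
          split_ifs <;> simp_all [elimGo]
        · simp [List.length_cons]; ring_nf; omega
      · have hp : p.length = m := hP p rfl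
        have hbody := runs_elimBody_add src hd' m N hN _ hv0 hv S hSN _ hsrc' hX hip p hp hSP
        refine (Runs.each_peek (s := .hd h) hsrc' rfl hbody
          (ih (some p) _ ?_ ?_ hvs' ?_ hP ?_)).of_eq ?_ ?_
        · simp [*, Ne.symm h1]
        · simp [*]
        · simp [*, Ne.symm h2]
        · simp [*, Ne.symm h3]
        · clear ih hbody
          funext k
          simp only [update_apply]
          split_ifs <;> simp_all [elimGo]
        · simp [List.length_cons]; ring_nf; omega
    · rw [Bool.not_eq_true] at hip
      have hbody := runs_elimBody_false src hd' m N hN _ hv S hSN _ hsrc' hX hip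
      refine (Runs.each_peek (s := .hd h) hsrc' rfl hbody
        (ih P _ ?_ ?_ hvs' ?_ hP ?_)).of_eq ?_ ?_
      · simp [*, Ne.symm h1]
      · simp [*]
      · simp [*, Ne.symm h2]
      · simp [*, Ne.symm h3]
      · clear ih hbody
        funext k
        simp only [update_apply]
        split_ifs <;> simp_all [elimGo]
      · simp [List.length_cons]; ring_nf; omega

theorem length_of_mem_elimGo {m : ℕ} {N : List Bool} {P : Option (List Bool)}
    {vs : List (List Bool)} (hP : ∀ p ∈ P, p.length = m) (hvs : ∀ v ∈ vs, v.length = m) :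
    ∀ v ∈ (elimGo N P vs).2, v.length = m := by
  induction vs generalizing P with
  | nil => simp [elimGo]
  | cons v vs ih =>
    have hv := hvs v (by simp)
    have hvs' : ∀ v ∈ vs, v.length = m := fun v hv => hvs v (by simp [hv])
    unfold elimGo
    split
    · split
      · exact ih (by simpa using hv) hvs'
      · rename_i p
        simp only [List.mem_cons, forall_eq_or_imp]
        exact ⟨length_vx (hP p rfl) hv, ih hP hvs'⟩
    · simp only [List.mem_cons, forall_eq_or_imp]
      exact ⟨hv, ih hP hvs'⟩

theorem runs_elimProg (src : Reg) (hd : [src, .N, .P, .X, .Y, .Q].Nodup) (m : ℕ) (N : List Bool)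
    (hN : N.length = m) (hm : m ≠ 0) (vs : List (List Bool)) (P : Option (List Bool)) (S : Store)
    (hSN : S .N = vtext N) (hsrc : S src = vsText vs) (hvs : ∀ v ∈ vs, v.length = m)
    (hSP : S .P = ptext P) (hP : ∀ p ∈ P, p.length = m) (hX : S .X = []) (hY : S .Y = []) :
    Runs (elimProg src) S
      (update (update S src (vsText (elimGo N P vs).2)) .P (ptext (elimGo N P vs).1))
        ((20 * m + 16) * vs.length + 2) := by
  have hloop := runs_elim_loop src hd m N hN hm vs P S hSN hsrc hvs hSP hP hX
  simp only [List.nodup_cons, List.mem_cons, List.not_mem_nil, or_false, not_or] at hd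
  obtain ⟨⟨h1, h2, h3, h4, h5⟩, -⟩ := hd
  refine (hloop.seq (runs_mv .Y src (Ne.symm h4) _)).of_eq ?_ ?_
  · clear hloop
    funext k
    simp only [update_apply]
    split_ifs <;> simp_all
  · have hlen : (vsText (elimGo N P vs).2).length ≤ m * vs.length := by
      rw [length_vsText (length_of_mem_elimGo hP hvs)]
      exact Nat.mul_le_mul_left _ (length_elimGo_le _ _ _)
    simp only [update_self, hY, List.append_nil, List.length_reverse]
    ring_nf at hlen ⊢
    omega

/-! ### Filtering the points of a bucket -/

/-- Deletes from `B` all points for which the bit that `scan` computes, with the stack `z` as its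
other argument, is `pol`. For each of them a unary digit is pushed on `C`. -/
def filterProg (z : Reg) (f : Sym → Sym → Bool → Bool) (pol : Bool) : Prog :=
  .each .B (fun _ => true) (fun s => .push .B s ;; scan z .B f (fun _ u => u) ;;
    .pop .Q fun q => if (q.getD .sep).toBit = pol then dropY ;; .push .C .mark else .skip) ;;
  mv .Y .B

theorem runs_filter_loop (z : Reg) (f : Sym → Sym → Bool → Bool) (pol : Bool)
    (hd : [z, .B, .X, .Y, .Q, .C].Nodup) (m : ℕ) (zs : List Sym) (hzs : zs.length = m) (hm : m ≠ 0)
    (vs : List (List Bool)) (S : Store) (hz : S z = zs) (hB : S .B = vsText vs)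
    (hvs : ∀ v ∈ vs, v.length = m) (hX : S .X = []) :
    Runs (.each .B (fun _ => true) (fun s => .push .B s ;; scan z .B f (fun _ u => u) ;;
      .pop .Q fun q => if (q.getD .sep).toBit = pol then dropY ;; .push .C .mark else .skip)) S
      (update (update (update S .B [])
        .Y ((vsText (vs.filter fun v => scanBit f zs (vtext v) false != pol)).reverse ++ S .Y))
        .C (List.replicate (vs.countP fun v => scanBit f zs (vtext v) false == pol) .mark ++ S .C))
      ((9 * m + 9) * vs.length + 1) := by
  have hd1 : [z, .B, .X, .Y, .Q].Nodup := by simp_all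
  simp only [List.nodup_cons, List.mem_cons, List.not_mem_nil, or_false, not_or] at hd
  obtain ⟨⟨h1, h2, h3, h4, h5⟩, -⟩ := hd
  induction vs generalizing S with
  | nil =>
    refine (Runs.each_stop (by simp [hB])).of_eq ?_ (by simp)
    funext k
    simp only [update_apply]
    split_ifs <;> simp_all
  | cons v vs ih =>
    have hv := hvs v (by simp)
    have hvs' : ∀ v ∈ vs, v.length = m := fun v hv => hvs v (by simp [hv])
    have hv0 : v ≠ [] := by rintro rfl; exact hm hv.symm
    obtain ⟨h, l, rfl⟩ := List.exists_cons_of_ne_nil hv0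
    have hB' : S .B = vtext (h :: l) ++ vsText vs := by simpa using hB
    have hlen : zs.length = (vtext (h :: l)).length := by simp [hzs, ← hv]
    have hscan := runs_scan z .B f (fun _ u => u) hd1 zs (vtext (h :: l)) (vsText vs) S hz hB' hlen
      hX
    rw [zipWith_snd _ _ hlen] at hscan
    by_cases hb : scanBit f zs (vtext (h :: l)) false = pol
    · have hbody : Runs (scan z .B f (fun _ u => u) ;;
          .pop .Q fun q => if (q.getD .sep).toBit = pol then dropY ;; .push .C .mark else .skip) S
          (update (update S .B (vsText vs)) .C (.mark :: S .C)) (9 * m + 6) := by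
        refine (hscan.seq (t' := m + 3) ?_).mono (by omega)
        refine Runs.pop_some (s := .bit (scanBit f zs (vtext (h :: l)) false)) (l := S .Q) (by
          simp) ?_
        have : ((some (Sym.bit (scanBit f zs (vtext (h :: l)) false))).getD Sym.sep).toBit = pol :=
          hb
        rw [if_pos this]
        refine ((runs_dropY _ (h :: l) hv0 (S .Y) (by simp)).seq (Runs.push _ _ _)).of_eq ?_ ?_
        · clear hscan ih this hb hd1
          funext k
          simp only [update_apply]
          split_ifs <;> simp_all
        · rw [hv]
      refine (Runs.each_peek (s := .hd h) hB' rfl hbody (ih _ ?_ ?_ hvs' ?_)).of_eq ?_ ?_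
      · simp [*]
      · simp
      · simp [*]
      · clear ih hbody hscan hd1
        funext k
        simp only [update_apply]
        split_ifs <;> simp_all
        · rw [List.replicate_succ', List.append_assoc]; rfl
      · simp [List.length_cons]; ring_nf; omega
    · have hbody : Runs (scan z .B f (fun _ u => u) ;;
          .pop .Q fun q => if (q.getD .sep).toBit = pol then dropY ;; .push .C .mark else .skip) S
          (update (update S .B (vsText vs)) .Y ((vtext (h :: l)).reverse ++ S .Y)) (9 * m + 6) := by
        refine (hscan.seq (t' := 1) ?_).mono (by omega)
        refine Runs.pop_some (s := .bit (scanBit f zs (vtext (h :: l)) false)) (l := S .Q) (by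
          simp) ?_
        have : ¬ ((some (Sym.bit (scanBit f zs (vtext (h :: l)) false))).getD Sym.sep).toBit = pol
          := hb
        rw [if_neg this]
        refine Runs.skip.of_eq ?_ le_rfl
        clear hscan ih this hb hd1
        funext k
        simp only [update_apply]
        split_ifs <;> simp_all
      refine (Runs.each_peek (s := .hd h) hB' rfl hbody (ih _ ?_ ?_ hvs' ?_)).of_eq ?_ ?_
      · simp [*]
      · simp
      · simp [*]
      · clear ih hbody hscan hd1
        funext k
        simp only [update_apply]
        split_ifs <;> simp_all
      · simp [List.length_cons]; ring_nf; omega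

theorem runs_filterProg (z : Reg) (f : Sym → Sym → Bool → Bool) (pol : Bool)
    (hd : [z, .B, .X, .Y, .Q, .C].Nodup) (m : ℕ) (zs : List Sym) (hzs : zs.length = m) (hm : m ≠ 0)
    (vs : List (List Bool)) (S : Store) (hz : S z = zs) (hB : S .B = vsText vs)
    (hvs : ∀ v ∈ vs, v.length = m) (hX : S .X = []) (hY : S .Y = []) :
    Runs (filterProg z f pol) S
      (update (update S .B (vsText (vs.filter fun v => scanBit f zs (vtext v) false != pol)))
        .C (List.replicate (vs.countP fun v => scanBit f zs (vtext v) false == pol) .mark ++ S .C))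
      ((11 * m + 9) * vs.length + 2) := by
  have hloop := runs_filter_loop z f pol hd m zs hzs hm vs S hz hB hvs hX
  simp only [List.nodup_cons, List.mem_cons, List.not_mem_nil, or_false, not_or] at hd
  obtain ⟨⟨h1, h2, h3, h4, h5⟩, -⟩ := hd
  refine (hloop.seq (runs_mv .Y .B (by simp) _)).of_eq ?_ ?_
  · clear hloop
    funext k
    simp only [update_apply]
    split_ifs <;> simp_all
  · have hlen : (vsText (vs.filter fun v => scanBit f zs (vtext v) false != pol)).length
        ≤ m * vs.length := by
      rw [length_vsText fun v hv => hvs v (List.mem_filter.1 hv).1]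
      exact Nat.mul_le_mul_left _ (List.length_filter_le _ _)
    simp only [ne_eq, reduceCtorEq, not_false_eq_true, update_of_ne, update_self, hY,
      List.append_nil, List.length_reverse]
    ring_nf at hlen ⊢
    omega

/-! ### The equations of a row -/

/-- The coefficient on a tape cell. -/
def Sym.coef : Sym → Bool
  | .con a _ => a
  | .base a => a
  | _ => false

/-- The constant term of the equation that ends at a tape cell. -/
def Sym.const : Sym → Bool
  | .con _ b => b
  | .fls => true
  | _ => false

/-- The equation that ends at the top of the tape `L`: its constant term, and its `n` coefficients,
which are the last `n` cells of the tape, or zero if the top of the tape is the symbol for the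
unsatisfiable equation. -/
def equation (n : ℕ) (L : List Sym) : List Bool :=
  (L.head?.getD .sep).const ::
    ((L.take n).map fun s => L.head? != some .fls && s.coef).reverse

theorem length_equation {n : ℕ} {L : List Sym} (h : n ≤ L.length) :
    (equation n L).length = n + 1 := by simp [equation, h]

/-- One cell of `loadEq`, `o` being the top of the tape. -/
def loadEqStep (o : Option Sym) : Sym → Prog
  | .con p q => .push .X (.con p q) ;; .pop .L fun u => .push .Y (u.getD .sep) ;;
      .push .N (.bit (o != some .fls && (u.getD .sep).coef))
  | s => .push .X s

/-- Writes the equation that ends at the top of the tape `L` on `N`; the term on `T` serves as a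
counter. -/
def loadEq : Prog :=
  peek .L fun o => .each .T (fun _ => true) (loadEqStep o) ;;
    mv .X .T ;; mv .Y .L ;; .push .N (.hd (o.getD .sep).const)

theorem runs_loadEq_loop (o : Option Sym) (ts : List (Bool × Bool)) (S : Store)
    (hT : S .T = ts.map fun l => .con l.1 l.2) (l r : List Sym) (hL : S .L = l ++ r)
    (hl : l.length = ts.length) :
    Runs (.each .T (fun _ => true) (loadEqStep o)) S
      (update (update (update (update (update S .T []) .L r) .X ((S .T).reverse ++ S .X))
        .Y (l.reverse ++ S .Y)) .N ((l.map fun s => .bit (o != some .fls && s.coef)).reverse ++ S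
        .N))
      (5 * ts.length + 1) := by
  induction ts generalizing S l with
  | nil =>
    obtain rfl : l = [] := by simpa using hl
    refine (Runs.each_stop (by simp [hT])).of_eq ?_ (by simp)
    funext k
    simp only [update_apply]
    split_ifs <;> simp_all
  | cons t ts ih =>
    obtain ⟨u, l, rfl⟩ : ∃ u l', l = u :: l' := List.exists_cons_of_length_eq_add_one hl
    refine (Runs.each_step (s := .con t.1 t.2) hT rfl (Runs.push_seq (Runs.pop_some (s := u)
      (l := l ++ r) (by simp [hL]) (Runs.push_seq (Runs.push _ _ _)))) (ih _ ?_
      l ?_ ?_)).of_eq ?_ ?_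
    · simp
    · simp
    · simpa using hl
    · clear ih
      funext k
      simp only [update_apply]
      split_ifs <;> simp_all
    · simp; omega

theorem runs_loadEq (ts : List (Bool × Bool)) (S : Store) (hT : S .T = ttext ts)
    (hL : ts.length ≤ (S .L).length) (hX : S .X = []) (hY : S .Y = []) (hN : S .N = []) :
    Runs loadEq S (update S .N (vtext (equation ts.length (S .L)))) (9 * ts.length + 12) := by
  refine runs_peek (Runs.mono (t := 9 * ts.length + 10) ?_ (by omega))
  have hloop := runs_loadEq_loop (S .L).head? ts (update (update S .T (ts.map fun l => .con l.1
    l.2))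
    .X (.sep :: update S .T (ts.map fun l => .con l.1 l.2) .X))
    (by simp) ((S .L).take ts.length) ((S .L).drop ts.length) (by simp) (by simpa using hL)
  refine (Runs.seq (Runs.each_step (s := .sep) (l := ts.map fun l => .con l.1 l.2)
    (f := loadEqStep (S .L).head?) hT rfl
    (Runs.push _ _ _) hloop) (Runs.seq (runs_mv .X .T (by simp) _)
      (Runs.seq (runs_mv .Y .L (by simp) _) (Runs.push _ _ _)))).of_eq ?_ ?_
  · clear hloop
    funext k
    cases k <;> simp [hT, hX, hY, hN, equation, vtext, ttext, Function.comp_def]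
  · simp [hX, hY, hL]; omega

/-- Restricts the affine space on `V` and `U` by the equation at the top of the tape `L`, which is
left on `N`. -/
def applyEq : Prog := loadEq ;; elimProg .V ;; elimProg .U ;; clear .P

theorem runs_applyEq (ts : List (Bool × Bool)) (S : Store) (hT : S .T = ttext ts)
    (sp : List (List Bool) × List (List Bool)) (hsp : IsSpace (ts.length + 1) sp)
    (hd : sp.1.length ≤ ts.length)
    (hV : S .V = vsText sp.1) (hU : S .U = vsText sp.2)
    (hL : ts.length ≤ (S .L).length) (hX : S .X = []) (hY : S .Y = []) (hN : S .N = [])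
    (hP : S .P = []) :
    Runs applyEq S (update (update (update S
        .V (vsText (elimStep (equation ts.length (S .L)) sp).1))
        .U (vsText (elimStep (equation ts.length (S .L)) sp).2))
        .N (vtext (equation ts.length (S .L)))) (60 * (ts.length + 1) ^ 2) := by
  obtain ⟨hG, hU1, hU2⟩ := hsp
  have hp := elimGo_none_isVec (equation ts.length (S .L)) hG
  have hN' : (equation ts.length (S .L)).length = ts.length + 1 := length_equation hL
  set N := equation ts.length (S .L) with hNdef
  refine (Runs.seq (runs_loadEq ts S hT hL hX hY hN) (Runs.seq
    (runs_elimProg .V (by decide) (ts.length + 1) N hN' (by simp) sp.1 none _ ?_ ?_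
      (fun g h => (hG g h).1) ?_ ?_ ?_ ?_) (Runs.seq
    (runs_elimProg .U (by decide) (ts.length + 1) N hN' (by simp) sp.2 (elimGo N none
    sp.1).1 _ ?_ ?_
      (fun g h => (hU1 g h).1) ?_ ?_ ?_ ?_) (runs_clear .P _)))).of_eq ?_ ?_
  · simp [hNdef]
  · simp [hV]
  · simp [hP, ptext]
  · simp
  · simp [hX]
  · simp [hY]
  · simp [hNdef]
  · simp [hU]
  · simp
  · exact fun p h => (hp.1 p h).1
  · simp [hX]
  · simp [hY]
  · funext k
    cases k <;> simp [elimStep, hNdef, hP]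
  · have h1 : (ptext (elimGo N (elimGo N none sp.1).1 sp.2).1).length ≤ ts.length + 1 := by
      cases h : (elimGo N none sp.1).1 with
      | some p =>
        rw [elimGo_some]
        simp [ptext, (hp.1 p h).1]
      | none =>
        obtain ⟨G, U⟩ := sp
        match U, hU2 with
        | [], _ => simp [elimGo, ptext]
        | [c], _ =>
          have hc := (hU1 c (by simp)).1
          cases hi : ip N c <;> simp [elimGo, hi, ptext, hc]
    simp only [update_self]
    have h2 : (20 * (ts.length + 1) + 16) * sp.1.length ≤ (20 * (ts.length + 1) + 16) * ts.length :=
      Nat.mul_le_mul_left _ hd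
    have h3 : (20 * (ts.length + 1) + 16) * sp.2.length ≤ (20 * (ts.length + 1) + 16) * 1 :=
      Nat.mul_le_mul_left _ hU2
    nlinarith

/-- Whether a tape cell is the end of an equation. -/
def Sym.isEq : Sym → Bool
  | .con _ _ => true
  | .fls => true
  | _ => false

/-- Restricts an affine space by all equations on the tape. -/
def applyTape (n : ℕ) : List Sym → List (List Bool) × List (List Bool) →
    List (List Bool) × List (List Bool)
  | s :: L, sp => if s.isEq then applyTape n L (elimStep (equation n (s :: L)) sp) else sp
  | [], sp => sp

/-- Restricts the affine space on `V` and `U` by all equations on the tape `L`. -/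
def applyTapeProg : Prog :=
  .each .L Sym.isEq (fun s => .push .L s ;; applyEq ;; clear .N ;;
    .pop .L fun o => .push .W (o.getD .sep)) ;;
  mv .W .L

theorem length_elimStep_le (N : List Bool) (sp : List (List Bool) × List (List Bool)) :
    (elimStep N sp).1.length ≤ sp.1.length := length_elimGo_le _ _ _

theorem runs_applyTape_loop (ts : List (Bool × Bool)) (bs : List Sym) (hbs : ts.length = bs.length)
    (hb : bs.head?.any Sym.isEq = false) (es : List Sym) (he : ∀ s ∈ es, s.isEq = true)
    (S : Store) (hT : S .T = ttext ts)
    (sp : List (List Bool) × List (List Bool)) (hsp : IsSpace (ts.length + 1) sp)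
    (hd : sp.1.length ≤ ts.length)
    (hV : S .V = vsText sp.1) (hU : S .U = vsText sp.2)
    (hL : S .L = es ++ bs) (hX : S .X = []) (hY : S .Y = []) (hN : S .N = [])
    (hP : S .P = []) :
    Runs (.each .L Sym.isEq (fun s => .push .L s ;; applyEq ;; clear .N ;;
      .pop .L fun o => .push .W (o.getD .sep))) S (update (update (update (update S
        .V (vsText (applyTape ts.length (es ++ bs) sp).1))
        .U (vsText (applyTape ts.length (es ++ bs) sp).2))
        .L bs) .W (es.reverse ++ S .W)) (66 * (ts.length + 1) ^ 2 * es.length + 1) := by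
  induction es generalizing S sp with
  | nil =>
    refine (Runs.each_stop (by simp [hL, hb])).of_eq ?_ (by simp)
    have : applyTape ts.length bs sp = sp := by
      cases bs with
      | nil => rfl
      | cons s bs => simp only [List.head?_cons, Option.any_some] at hb; simp [applyTape, hb]
    funext k
    cases k <;> simp_all
  | cons s es ih =>
    have hs := he s (by simp)
    have hLn : ts.length ≤ (S .L).length := by simp [hL]; omega
    have hlen := length_equation hLn
    have happ := runs_applyEq ts S hT sp hsp hd hV hU hLn hX hY hN hP
    have hbody : Runs (applyEq ;; clear .N ;; .pop .L fun o => .push .W (o.getD .sep)) S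
        (update (update (update (update S
        .V (vsText (elimStep (equation ts.length (S .L)) sp).1))
        .U (vsText (elimStep (equation ts.length (S .L)) sp).2))
        .L (es ++ bs)) .W (s :: S .W)) (64 * (ts.length + 1) ^ 2) := by
      refine (happ.seq ((runs_clear .N _).seq (Runs.pop_some (s := s) (l := es ++ bs) (by simp [hL])
        (Runs.push _ _ _)))).of_eq ?_ ?_
      · funext k
        cases k <;> simp [hN]
      · simp only [update_self, length_vtext, hlen]
        nlinarith
    refine (Runs.each_peek (s := s) hL hs hbody (ih (fun s h => he s (by simp [h])) _ ?_
      (elimStep (equation ts.length (S .L)) sp) (hsp.elimStep _)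
      ((length_elimStep_le _ _).trans hd) ?_ ?_ ?_ ?_ ?_ ?_ ?_)).of_eq ?_ ?_
    · simp [hT]
    · simp
    · simp
    · simp
    · simp [hX]
    · simp [hY]
    · simp [hN]
    · simp [hP]
    · have : applyTape ts.length (s :: es ++ bs) sp =
          applyTape ts.length (es ++ bs) (elimStep (equation ts.length (S .L)) sp) := by
        rw [hL]; simp [applyTape, hs]
      rw [this]
      clear ih hbody happ
      funext k
      cases k <;> simp
    · simp only [List.length_cons]; nlinarith

theorem runs_applyTapeProg (ts : List (Bool × Bool)) (bs : List Sym) (hbs : ts.length = bs.length)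
    (hb : bs.head?.any Sym.isEq = false) (es : List Sym) (he : ∀ s ∈ es, s.isEq = true)
    (S : Store) (hT : S .T = ttext ts)
    (sp : List (List Bool) × List (List Bool)) (hsp : IsSpace (ts.length + 1) sp)
    (hd : sp.1.length ≤ ts.length)
    (hV : S .V = vsText sp.1) (hU : S .U = vsText sp.2)
    (hL : S .L = es ++ bs) (hX : S .X = []) (hY : S .Y = []) (hN : S .N = [])
    (hP : S .P = []) (hW : S .W = []) :
    Runs applyTapeProg S (update (update S
        .V (vsText (applyTape ts.length (S .L) sp).1))
        .U (vsText (applyTape ts.length (S .L) sp).2))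
        (68 * (ts.length + 1) ^ 2 * es.length + 2) := by
  refine ((runs_applyTape_loop ts bs hbs hb es he S hT sp hsp hd hV hU hL hX hY hN hP).seq
    (runs_mv .W .L (by simp) _)).of_eq ?_ ?_
  · funext k
    cases k <;> simp [hL, hW]
  · have := Nat.le_mul_of_pos_left es.length (show 0 < (ts.length + 1) ^ 2 by positivity)
    simp only [update_self, hW, List.append_nil, List.length_reverse]
    nlinarith

/-! ### Unary arithmetic -/

/-- A number in unary. -/
abbrev unary (c : ℕ) : List Sym := List.replicate c .mark

/-- Halves the unary number on `X`. If `keep` is set, a unary digit is pushed on `Z` if the number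
was odd. -/
def halve (keep : Bool) : Prog :=
  .each .X (fun _ => true) (fun _ => .pop .X fun o => match o with
    | none => if keep then .push .Z .mark else .skip
    | some s => .push .Y s) ;;
  mv .Y .X

theorem runs_halve_loop (keep : Bool) (c : ℕ) (S : Store) (hX : S .X = unary c) :
    Runs (.each .X (fun _ => true) (fun _ => .pop .X fun o => match o with
      | none => if keep then .push .Z .mark else .skip
      | some s => .push .Y s)) S
      (update (update (update S .X []) .Y (unary (c / 2) ++ S .Y))
        .Z (if keep && c % 2 == 1 then .mark :: S .Z else S .Z)) (3 * c + 1) := by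
  induction c using Nat.strong_induction_on generalizing S with
  | _ c ih =>
    match c with
    | 0 =>
      refine (Runs.each_stop (by simp [hX])).of_eq ?_ (by simp)
      funext k
      cases k <;> simp [hX]
    | 1 =>
      have hst : Runs (.each .X (fun _ => true) (fun _ => .pop .X fun o => match o with
          | none => if keep then .push .Z .mark else .skip
          | some s => .push .Y s)) (update (update S .X []) .Z
          (if keep then .mark :: S .Z else S .Z)) (update (update S .X []) .Z
          (if keep then .mark :: S .Z else S .Z)) 1 := Runs.each_stop (by simp)
      refine (Runs.each_step (s := .mark) (l := []) hX rfl (Runs.pop_none (by simp)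
        (t := 1) ?_) hst).of_eq ?_ le_rfl
      · cases keep
        · refine Runs.skip.of_eq ?_ (by simp)
          funext k
          cases k <;> simp
        · refine (Runs.push _ _ _).of_eq ?_ (by simp)
          funext k
          cases k <;> simp
      · funext k
        cases k <;> simp
    | c + 2 =>
      refine (Runs.each_step (s := .mark) (l := unary (c + 1)) (by simp [hX, List.replicate_succ])
        rfl
        (Runs.pop_some (s := .mark) (l := unary c) (by simp [List.replicate_succ]) (Runs.push _ _
        _))
        (ih c (by omega) _ ?_)).of_eq ?_ (by omega)
      · simp
      · have e : (c + 2) / 2 = c / 2 + 1 := by omega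
        have e2 : (c + 2) % 2 = c % 2 := by omega
        rw [e, e2]
        funext k
        cases k <;> simp [List.replicate_succ', List.append_assoc]

theorem runs_halve (keep : Bool) (c : ℕ) (S : Store) (hX : S .X = unary c) (hY : S .Y = []) :
    Runs (halve keep) S (update (update S .X (unary (c / 2)))
        .Z (if keep && c % 2 == 1 then .mark :: S .Z else S .Z)) (4 * c + 2) := by
  refine ((runs_halve_loop keep c S hX).seq (runs_mv .Y .X (by simp) _)).of_eq ?_ ?_
  · funext k
    cases k <;> simp [hY]
  · simp [hY]; omega

/-- Pushes a copy of `x` on `z`, in reverse order; `y` is used meanwhile. -/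
def copyRev (x y z : Reg) : Prog :=
  .each x (fun _ => true) (fun s => .push y s ;; .push z s) ;; mv y x

theorem runs_copyRev (x y z : Reg) (hxy : x ≠ y) (hyz : y ≠ z) (hxz : x ≠ z) (S : Store)
    (hy : S y = []) :
    Runs (copyRev x y z) S (update S z ((S x).reverse ++ S z)) (5 * (S x).length + 2) := by
  have key : ∀ (l : List Sym) (S : Store), S x = l →
      Runs (.each x (fun _ => true) (fun s => .push y s ;; .push z s)) S
        (update (update (update S x []) y (l.reverse ++ S y)) z (l.reverse ++ S z))
        (3 * l.length + 1) := by
    intro l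
    induction l with
    | nil =>
      intro S hl
      refine (Runs.each_stop (by simp [hl])).of_eq ?_ (by simp)
      funext k
      simp only [update_apply]
      split_ifs <;> simp_all
    | cons s l ih =>
      intro S hl
      refine (Runs.each_step hl rfl (Runs.push_seq (Runs.push _ _ _)) (ih _ ?_)).of_eq ?_ ?_
      · simp [hxy, hxz]
      · funext k
        simp only [update_apply]
        split_ifs <;> simp_all
      · simp; omega
  refine ((key _ S rfl).seq (runs_mv y x (Ne.symm hxy) _)).of_eq ?_ ?_
  · funext k
    simp only [update_apply]
    split_ifs <;> simp_all
  · simp [hyz, hy]; omega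

/-! ### Is there room for the points of an affine space? -/

/-- Halves the number on `X` once for each vector on `V`. -/
def halvePerVec : Prog :=
  .each .V (fun _ => true) (fun s => .push .W s ;; match s with
    | .hd _ => halve false
    | _ => .skip) ;; mv .W .V

theorem runs_halvePerVec_bits (l : List Bool) (r : List Sym) (S S' : Store) (t : ℕ)
    (hV : S .V = l.map .bit ++ r)
    (h : Runs (.each .V (fun _ => true) (fun s => .push .W s ;; match s with
      | .hd _ => halve false
      | _ => .skip)) (update (update S .V r) .W ((l.map Sym.bit).reverse ++ S .W)) S' t) :
    Runs (.each .V (fun _ => true) (fun s => .push .W s ;; match s with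
      | .hd _ => halve false
      | _ => .skip)) S S' (2 * l.length + t) := by
  induction l generalizing S with
  | nil =>
    have : update (update S .V r) .W (([] : List Sym) ++ S .W) = S := by
      simp only [List.map_nil, List.nil_append] at hV
      rw [← hV]; simp
    simp only [List.map_nil, List.reverse_nil] at h
    rw [this] at h
    exact h.mono (by simp)
  | cons b l ih =>
    refine Runs.mono (Runs.each_step (s := .bit b) hV rfl (Runs.push_seq Runs.skip)
      (ih _ (by simp) ?_)) (t := 0 + 1 + (2 * l.length + t) + 1) (by simp; omega)
    convert h using 1
    funext k
    cases k <;> simp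

theorem runs_halvePerVec (vs : List (List Bool)) (m : ℕ) (hm : m ≠ 0) (hvs : ∀ v ∈ vs, v.length = m)
    (c : ℕ) (S : Store) (hV : S .V = vsText vs) (hX : S .X = unary c) (hY : S .Y = [])
    (hW : S .W = []) :
    Runs halvePerVec S (update S .X (unary (c / 2 ^ vs.length)))
      ((4 * c + 4 * m + 4) * vs.length + 2) := by
  have key : ∀ (vs : List (List Bool)) (hvs : ∀ v ∈ vs, v.length = m) (c : ℕ) (S : Store),
      S .V = vsText vs → S .X = unary c → S .Y = [] →
      Runs (.each .V (fun _ => true) (fun s => .push .W s ;; match s with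
        | .hd _ => halve false
        | _ => .skip)) S (update (update (update S .X (unary (c / 2 ^ vs.length)))
          .W ((vsText vs).reverse ++ S .W)) .V []) ((4 * c + 2 * m + 4) * vs.length + 1) := by
    intro vs
    induction vs with
    | nil =>
      intro _ c S hV hX hY
      refine (Runs.each_stop (by simp [hV])).of_eq ?_ (by simp)
      funext k
      cases k <;> simp_all
    | cons v vs ih =>
      intro hvs c S hV hX hY
      have hv := hvs v (by simp)
      have hv0 : v ≠ [] := by rintro rfl; exact hm hv.symm
      obtain ⟨h, l, rfl⟩ := List.exists_cons_of_ne_nil hv0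
      have hV' : S .V = .hd h :: (l.map .bit ++ vsText vs) := by simpa [vtext] using hV
      refine (Runs.each_step (s := .hd h) hV' rfl (Runs.push_seq (runs_halve false c _ ?_ ?_))
        (runs_halvePerVec_bits l (vsText vs) _ _ _ ?_
        (ih (fun v h => hvs v (by simp [h])) (c / 2) _ ?_ ?_ ?_))).of_eq ?_ ?_
      · simp [hX]
      · simp [hY]
      · simp
      · simp
      · simp
      · simp [hY]
      · have e : c / 2 / 2 ^ vs.length = c / 2 ^ (vs.length + 1) := by
          rw [Nat.div_div_eq_div_mul, pow_succ, mul_comm]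
        rw [e, List.length_cons]
        clear ih
        funext k
        cases k <;> simp [vtext]
      · have : (4 * (c / 2) + 2 * m + 4) * vs.length ≤ (4 * c + 2 * m + 4) * vs.length :=
          Nat.mul_le_mul_right _ (by omega)
        simp only [List.length_cons] at hv ⊢
        nlinarith
  refine ((key vs hvs c S hV hX hY).seq (runs_mv .W .V (by simp) _)).of_eq ?_ ?_
  · funext k
    cases k <;> simp [hV, hW]
  · have := length_vsText hvs
    simp only [ne_eq, reduceCtorEq, not_false_eq_true, update_of_ne, update_self, hW,
      List.append_nil, List.length_reverse, this]
    nlinarith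

/-- Pushes on `Q` whether the points of the affine space on `V` and `U` are at most as many as the
unary number on `C` says. -/
def fitTest : Prog :=
  peek .U fun o => match o with
    | none => .push .Q (.bit true)
    | some _ => copyRev .C .Y .X ;; halvePerVec ;;
        peek .X (fun o => .push .Q (.bit o.isSome)) ;; clear .X

/-- Whether there is room for the points of an affine space. -/
def fits (cap : ℕ) (sp : List (List Bool) × List (List Bool)) : Bool :=
  sp.2.isEmpty || decide (2 ^ sp.1.length ≤ cap)

theorem runs_fitTest (m : ℕ) (hm : m ≠ 0) (sp : List (List Bool) × List (List Bool))
    (hsp : IsSpace m sp) (cap : ℕ) (S : Store)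
    (hV : S .V = vsText sp.1) (hU : S .U = vsText sp.2) (hC : S .C = unary cap)
    (hX : S .X = []) (hY : S .Y = []) (hW : S .W = []) :
    Runs fitTest S (update S .Q (.bit (fits cap sp) :: S .Q))
      ((4 * cap + 4 * m + 4) * sp.1.length + 6 * cap + 20) := by
  obtain ⟨hG, hU1, hU2⟩ := hsp
  obtain ⟨G, U⟩ := sp
  rcases U with _ | ⟨c, U⟩
  · refine Runs.mono (t := 3) (runs_peek ?_) (by omega)
    have hU : S .U = [] := hU
    rw [hU]
    exact Runs.push _ _ _
  · have hc := hU1 c (by simp)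
    have hc0 : c ≠ [] := by rintro rfl; exact hm hc.1.symm
    obtain ⟨h, l, rfl⟩ := List.exists_cons_of_ne_nil hc0
    refine Runs.mono (t := (4 * cap + 4 * m + 4) * G.length + 6 * cap + 18) (runs_peek ?_)
      (by simp only; omega)
    have hU : (S .U).head? = some (.hd h) := by rw [hU]; rfl
    rw [hU]
    have hfit : (unary (cap / 2 ^ G.length)).head?.isSome = fits cap (G, (h :: l) :: U) := by
      simp only [fits, List.isEmpty_cons, Bool.false_or]
      rcases Nat.eq_zero_or_pos (cap / 2 ^ G.length) with h0 | h0
      · rw [h0]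
        have : cap < 2 ^ G.length := by
          by_contra hcon
          have := Nat.div_pos (not_lt.1 hcon) (by positivity)
          omega
        simpa using this
      · have : 2 ^ G.length ≤ cap := by
          by_contra hcon
          rw [Nat.div_eq_of_lt (not_le.1 hcon)] at h0
          exact lt_irrefl _ h0
        obtain ⟨d, hd⟩ := Nat.exists_eq_succ_of_ne_zero h0.ne'
        rw [hd]
        simp [this, List.replicate_succ]
    refine (Runs.seq (runs_copyRev .C .Y .X (by simp) (by simp) (by simp) S hY) (Runs.seq
      (runs_halvePerVec G m hm (fun g h => (hG g h).1) cap _ ?_ ?_ ?_ ?_) (Runs.seq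
      (runs_peek (Runs.push _ _ _)) (runs_clear .X _)))).of_eq ?_ ?_
    · simp [hV]
    · simp [hC, hX]
    · simp [hY]
    · simp [hW]
    · simp only [update_self, hfit]
      funext k
      cases k <;> simp [hX]
    · have : cap / 2 ^ G.length ≤ cap := Nat.div_le_self _ _
      simp [hC]
      omega

/-! ### Raising the level of a row -/

/-- A row: the tape to the left and to the right of the head, the number of free places in the
bucket, and the points in the bucket. -/
structure Row where
  /-- the tape to the left of the head, the cell next to the head first -/
  left : List Sym
  /-- the tape to the right of the head -/
  right : List Sym
  /-- the number of free places -/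
  free : ℕ
  /-- the points in the bucket -/
  pts : List (List Bool)

/-- Raises the level by one: the next equation is imposed on the bucket. -/
def Row.raise (n : ℕ) (s : Sym) (R : List Sym) (row : Row) : Row where
  left := s :: row.left
  right := R
  free := row.free + row.pts.countP fun v => ip (equation n (s :: row.left)) v
  pts := row.pts.filter fun v => !ip (equation n (s :: row.left)) v

/-- Raises the level until there is room for the points of the affine space. -/
def climb (n : ℕ) : List Sym → Row → List (List Bool) × List (List Bool) →
    Row × (List (List Bool) × List (List Bool))
  | [], row, sp => (row, sp)
  | s :: R, row, sp =>
    if fits row.free sp then (row, sp)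
    else climb n R (row.raise n s R) (elimStep (equation n (s :: row.left)) sp)

/-- Raises the level by one. -/
def raiseProg : Prog :=
  .pop .R fun o => .push .L (o.getD .sep) ;; applyEq ;; filterProg .N dotBit true ;; clear .N

/-- Raises the level until there is room for the points of the affine space on `V` and `U`. -/
def climbProg : Prog :=
  fitTest ;; .each .Q (fun s => !s.toBit) (fun _ => raiseProg ;; fitTest) ;; .pop .Q fun _ => .skip

/-- The stacks that hold a row and an affine space. -/
def holds (S : Store) (row : Row) (sp : List (List Bool) × List (List Bool)) : Store :=
  update (update (update (update (update (update S .L row.left) .R row.right) .C (unary row.free))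
    .B (vsText row.pts)) .V (vsText sp.1)) .U (vsText sp.2)

theorem scanBit_filter (N : List Bool) (vs : List (List Bool)) :
    (vs.filter fun v => scanBit dotBit (vtext N) (vtext v) false != true) =
      vs.filter fun v => !ip N v := by
  congr 1; funext v; rw [scanBit_vtext]; cases ip N v <;> rfl

theorem scanBit_countP (N : List Bool) (vs : List (List Bool)) :
    (vs.countP fun v => scanBit dotBit (vtext N) (vtext v) false == true) =
      vs.countP fun v => ip N v := by
  congr 1; funext v; rw [scanBit_vtext]; cases ip N v <;> rfl

theorem runs_raiseProg (ts : List (Bool × Bool)) (S : Store) (hT : S .T = ttext ts)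
    (hX : S .X = []) (hY : S .Y = []) (hN : S .N = []) (hP : S .P = [])
    (row : Row) (sp : List (List Bool) × List (List Bool)) (hsp : IsSpace (ts.length + 1) sp)
    (hd : sp.1.length ≤ ts.length) (hrow : ∀ v ∈ row.pts, v.length = ts.length + 1)
    (hl : ts.length ≤ row.left.length) (s : Sym) (R : List Sym) (hR : row.right = s :: R) :
    Runs raiseProg (holds S row sp) (holds S (row.raise ts.length s R)
      (elimStep (equation ts.length (s :: row.left)) sp))
      (66 * (ts.length + 1) ^ 2 + 20 * (ts.length + 1) * row.pts.length) := by
  have hLn : ts.length ≤ (s :: row.left).length := by simp; omega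
  have hlen := length_equation hLn
  have e : update (update (holds S row sp) .R R) .L (s :: row.left) =
      holds S { row with left := s :: row.left, right := R } sp := by
    funext k
    cases k <;> simp [holds]
  have h1 := runs_applyEq ts (holds S { row with left := s :: row.left, right := R } sp)
    (by simp [holds, hT]) sp hsp hd (by simp [holds]) (by simp [holds]) (by simpa [holds] using hLn)
    (by simp [holds, hX]) (by simp [holds, hY]) (by simp [holds, hN]) (by simp [holds, hP])
  have e2 : (holds S { row with left := s :: row.left, right := R } sp) .L = s :: row.left := by
    simp [holds]
  rw [e2] at h1
  have e3 : update (update (holds S row sp) .R R) .L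
      ((some s).getD .sep :: update (holds S row sp) .R R .L) =
      holds S { row with left := s :: row.left, right := R } sp := by
    rw [← e]; simp [holds]
  have h2 := h1.seq ((runs_filterProg .N dotBit true (by decide) (ts.length + 1)
    (vtext (equation ts.length (s :: row.left))) (by simp [hlen]) (by simp) row.pts _ (by simp)
    (by simp [holds]) hrow (by simp [holds, hX]) (by simp [holds, hY])).seq (runs_clear .N _))
  refine (Runs.pop_some (s := s) (l := R) (by simp [holds, hR])
    (Runs.push_seq (by rw [e3]; exact h2))).of_eq ?_ ?_
  · clear h1 h2 e e2 e3
    rw [scanBit_filter, scanBit_countP]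
    funext k
    cases k <;> simp [holds, Row.raise, hN, add_comm]
  · simp [hlen]
    nlinarith [Nat.zero_le (ts.length * row.pts.length)]

theorem ip_zeros (k : ℕ) (l : List Bool) : ip (List.replicate k false) l = false := by
  induction k generalizing l with
  | zero => rfl
  | succ k ih => cases l <;> simp_all [ip, List.replicate_succ]

theorem equation_fls {n : ℕ} {L : List Sym} (h : n ≤ L.length + 1) :
    equation n (.fls :: L) = true :: List.replicate n false := by
  have h2 : ((Sym.fls :: L).take n).length = n := by simp; omega
  have e : (((Sym.fls :: L).take n).map fun s =>
      (Sym.fls :: L).head? != some .fls && s.coef) = List.replicate n false := by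
    rw [List.eq_replicate_iff]
    exact ⟨by simpa using h2, by intro b hb; obtain ⟨s, -, rfl⟩ := List.mem_map.1 hb; simp⟩
  rw [equation, e]
  simp [Sym.const]

/-- The last equation of the tape has no solution. -/
theorem elimStep_fls {n : ℕ} {L : List Sym} (h : n ≤ L.length + 1)
    {sp : List (List Bool) × List (List Bool)} (hsp : IsSpace (n + 1) sp) :
    (elimStep (equation n (.fls :: L)) sp).2 = [] := by
  have h1 := hsp.perm_elimStep (equation n (.fls :: L))
  have h2 : ((space sp).filter fun v => !ip (equation n (.fls :: L)) v) = [] := by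
    rw [List.filter_eq_nil_iff]
    intro v hv
    obtain ⟨-, hv⟩ := hsp.isVec_of_mem hv
    rcases v with _ | ⟨b, v⟩
    · simp at hv
    · obtain rfl : b = true := by simpa using hv
      have := ip_zeros n v
      rw [equation_fls h]
      simp only [ip] at this ⊢
      simp [this]
  rw [h2, List.perm_nil] at h1
  by_contra hne
  obtain ⟨c, U, hU⟩ := List.exists_cons_of_ne_nil hne
  have := length_sols (elimStep (equation n (.fls :: L)) sp).1 c
  rw [space, hU] at h1
  simp only [List.flatMap_cons, List.append_eq_nil_iff] at h1
  rw [h1.1, List.length_nil] at this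
  exact (Nat.two_pow_pos _).ne this

theorem length_raise (n : ℕ) (s : Sym) (R : List Sym) (row : Row) :
    (row.raise n s R).free + (row.raise n s R).pts.length = row.free + row.pts.length := by
  simp only [Row.raise]
  rw [add_assoc, Nat.add_left_cancel_iff, ← List.countP_eq_length_filter,
    List.length_eq_countP_add_countP (l := row.pts)
      (fun v => ip (equation n (s :: row.left)) v)]
  congr 2
  funext v
  cases ip (equation n (s :: row.left)) v <;> rfl

/-- There is a level with room for the affine space: there is an unsatisfiable equation on the tape
to the right, or the affine space is empty. -/
def CanClimb (R : List Sym) (sp : List (List Bool) × List (List Bool)) : Prop :=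
  R.getLast? = some .fls ∨ sp.2 = []

theorem CanClimb.step {n : ℕ} {s : Sym} {L R : List Sym}
    {sp : List (List Bool) × List (List Bool)} (h : CanClimb (s :: R) sp)
    (hn : n ≤ L.length + 1) (hsp : IsSpace (n + 1) sp) :
    CanClimb R (elimStep (equation n (s :: L)) sp) := by
  rcases h with h | h
  · rcases R with _ | ⟨r, R⟩
    · obtain rfl : s = .fls := by simpa using h
      exact .inr (elimStep_fls hn hsp)
    · exact .inl (by simpa using h)
  · refine .inr ?_
    simp only [elimStep]
    rw [h]
    simp [elimGo]

/-- The number of steps that suffice to raise the level by one, or to test whether there is room. -/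
def climbTime (n K : ℕ) : ℕ := 66 * (n + 1) ^ 2 + 20 * (n + 1) * K + (4 * K + 4 * (n + 1) + 4) * n
  + 6 * K + 20

theorem runs_climb_loop (ts : List (Bool × Bool)) (K : ℕ) (R : List Sym) (S : Store)
    (hT : S .T = ttext ts) (hX : S .X = []) (hY : S .Y = []) (hN : S .N = []) (hP : S .P = [])
    (hW : S .W = []) (hQ : S .Q = [])
    (row : Row) (sp : List (List Bool) × List (List Bool)) (hsp : IsSpace (ts.length + 1) sp)
    (hd : sp.1.length ≤ ts.length) (hrow : ∀ v ∈ row.pts, v.length = ts.length + 1)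
    (hl : ts.length ≤ row.left.length) (hR : row.right = R) (hK : row.free + row.pts.length ≤ K)
    (hc : CanClimb R sp) :
    Runs (.each .Q (fun s => !s.toBit) (fun _ => raiseProg ;; fitTest))
      (update (holds S row sp) .Q [.bit (fits row.free sp)])
      (update (holds S (climb ts.length R row sp).1 (climb ts.length R row sp).2) .Q [.bit true])
      ((climbTime ts.length K + 1) * R.length + 1) := by
  induction R generalizing row sp with
  | nil =>
    have hf : fits row.free sp = true := by
      rcases hc with h | h
      · simp at h
      · simp [fits, h]
    refine (Runs.each_stop (by simp [hf, Sym.toBit])).of_eq ?_ (by simp)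
    simp [climb, hf]
  | cons s R ih =>
    by_cases hf : fits row.free sp = true
    · refine (Runs.each_stop (by simp [hf, Sym.toBit])).of_eq ?_ (by simp)
      simp [climb, hf]
    · rw [Bool.not_eq_true] at hf
      have e1 : update (update (holds S row sp) .Q [.bit (fits row.free sp)]) .Q [] =
          holds S row sp := by
        funext k
        cases k <;> simp [holds, hQ]
      have hsp' := hsp.elimStep (equation ts.length (s :: row.left))
      have hd' := (length_elimStep_le (equation ts.length (s :: row.left)) sp).trans hd
      have hK' := (length_raise ts.length s R row).trans_le hK
      have h1 := runs_raiseProg ts S hT hX hY hN hP row sp hsp hd hrow hl s R hR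
      have h2 := runs_fitTest (ts.length + 1) (by omega) _ hsp' (row.raise ts.length s R).free
        (holds S (row.raise ts.length s R) (elimStep (equation ts.length (s :: row.left)) sp))
        (by simp [holds]) (by simp [holds]) (by simp [holds]) (by simp [holds, hX])
        (by simp [holds, hY]) (by simp [holds, hW])
      have e2 : (holds S (row.raise ts.length s R)
          (elimStep (equation ts.length (s :: row.left)) sp)) .Q = [] := by simp [holds, hQ]
      rw [e2] at h2
      have h3 := ih (row.raise ts.length s R) (elimStep (equation ts.length (s :: row.left)) sp)
        hsp' hd' (fun v hv => hrow v (List.mem_of_mem_filter hv)) (by simp [Row.raise]; omega)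
        rfl hK' (hc.step (by omega) hsp)
      have h4 := Runs.each_step (c := fun s => !s.toBit) (f := fun _ => raiseProg ;; fitTest)
        (k := .Q) (s := .bit (fits row.free sp)) (l := [])
        (S := update (holds S row sp) .Q [.bit (fits row.free sp)]) (by simp)
        (by simp [hf, Sym.toBit]) (by rw [e1]; exact h1.seq h2) h3
      refine h4.of_eq ?_ ?_
      · simp [climb, hf]
      · have b1 : row.pts.length ≤ K := by omega
        have b2 : (row.raise ts.length s R).free ≤ K := by omega
        have b3 := Nat.mul_le_mul_left (20 * (ts.length + 1)) b1
        have b4 : (4 * (row.raise ts.length s R).free + 4 * (ts.length + 1) + 4) *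
            (elimStep (equation ts.length (s :: row.left)) sp).1.length ≤
            (4 * K + 4 * (ts.length + 1) + 4) * ts.length := Nat.mul_le_mul (by omega) hd'
        simp only [List.length_cons, climbTime]
        linarith

theorem runs_climbProg (ts : List (Bool × Bool)) (K : ℕ) (S : Store)
    (hT : S .T = ttext ts) (hX : S .X = []) (hY : S .Y = []) (hN : S .N = []) (hP : S .P = [])
    (hW : S .W = []) (hQ : S .Q = [])
    (row : Row) (sp : List (List Bool) × List (List Bool)) (hsp : IsSpace (ts.length + 1) sp)
    (hd : sp.1.length ≤ ts.length) (hrow : ∀ v ∈ row.pts, v.length = ts.length + 1)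
    (hl : ts.length ≤ row.left.length) (hK : row.free + row.pts.length ≤ K)
    (hc : CanClimb row.right sp) :
    Runs climbProg (holds S row sp)
      (holds S (climb ts.length row.right row sp).1 (climb ts.length row.right row sp).2)
      ((climbTime ts.length K + 1) * (row.right.length + 1) + 2) := by
  have h2 := runs_fitTest (ts.length + 1) (by omega) _ hsp row.free
    (holds S row sp) (by simp [holds]) (by simp [holds]) (by simp [holds]) (by simp [holds, hX])
    (by simp [holds, hY]) (by simp [holds, hW])
  have e2 : (holds S row sp) .Q = [] := by simp [holds, hQ]
  rw [e2] at h2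
  have h3 := runs_climb_loop ts K row.right S hT hX hY hN hP hW hQ row sp hsp hd hrow hl rfl hK hc
  refine (h2.seq (h3.seq (Runs.pop_some (s := .bit true) (l := []) (by simp)
    Runs.skip))).of_eq ?_ ?_
  · funext k
    cases k <;> simp [holds, hQ]
  · have b4 : (4 * row.free + 4 * (ts.length + 1) + 4) * sp.1.length ≤
        (4 * K + 4 * (ts.length + 1) + 4) * ts.length := Nat.mul_le_mul (by omega) hd
    have b5 := Nat.zero_le (66 * (ts.length + 1) ^ 2 + 20 * (ts.length + 1) * K)
    have b6 : row.free ≤ K := by omega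
    simp only [climbTime]
    linarith

/-! ### Writing the affine space of a term -/

/-- Pushes on `z` the image of the content of `x` under `f`, in reverse order; `y` is used
meanwhile. -/
def copyMap (f : Sym → Sym) (x y z : Reg) : Prog :=
  .each x (fun _ => true) (fun s => .push y s ;; .push z (f s)) ;; mv y x

theorem runs_copyMap (f : Sym → Sym) (x y z : Reg) (hxy : x ≠ y) (hyz : y ≠ z) (hxz : x ≠ z)
    (S : Store) (hy : S y = []) :
    Runs (copyMap f x y z) S (update S z (((S x).map f).reverse ++ S z))
      (5 * (S x).length + 2) := by
  have key : ∀ (l : List Sym) (S : Store), S x = l →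
      Runs (.each x (fun _ => true) (fun s => .push y s ;; .push z (f s))) S
        (update (update (update S x []) y (l.reverse ++ S y)) z ((l.map f).reverse ++ S z))
        (3 * l.length + 1) := by
    intro l
    induction l with
    | nil =>
      intro S hx
      refine (Runs.each_stop (by simp [hx])).of_eq ?_ (by simp)
      funext k
      simp only [update_apply]
      split_ifs <;> simp_all
    | cons s l ih =>
      intro S hx
      refine (Runs.each_step hx rfl (Runs.push_seq (Runs.push _ _ _)) (ih _ ?_)).of_eq ?_ ?_
      · simp [update_apply, hxy, hxz]
      · clear ih
        funext k
        simp only [update_apply]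
        split_ifs <;> simp_all
      · simp; omega
  refine ((key _ S rfl).seq (runs_mv y x (Ne.symm hxy) _)).of_eq ?_ ?_
  · clear key
    funext k
    simp only [update_apply]
    split_ifs <;> simp_all
  · simp [hyz, hy]; omega

/-- One literal pair, or the marker, of `initU`. -/
def initUStep : Sym → Prog
  | .con p q => .push .U (.bit p) ;; if p && q then .push .Z .mark else .skip
  | _ => .push .U (.hd true)

/-- Writes on `U` the point of the affine space of the term on `T`, if the space is not empty. -/
def initU : Prog :=
  mv .T .X ;; .each .X (fun _ => true) (fun s => .push .T s ;; initUStep s) ;;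
  .pop .Z fun o => match o with
    | none => .skip
    | some _ => clear .U ;; clear .Z

theorem runs_initU_loop (l : List (Bool × Bool)) (S : Store)
    (hX : S .X = l.map (fun a => .con a.1 a.2) ++ [.sep]) :
    Runs (.each .X (fun _ => true) (fun s => .push .T s ;; initUStep s)) S
      (update (update (update (update S .X [])
        .T (.sep :: (l.map fun a => .con a.1 a.2).reverse ++ S .T))
        .U (.hd true :: (l.map fun a => .bit a.1).reverse ++ S .U))
        .Z (unary (l.count (true, true)) ++ S .Z)) (4 * l.length + 4) := by
  induction l generalizing S with
  | nil =>
    refine (Runs.each_step hX rfl (Runs.push_seq (Runs.push .U (.hd true) _))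
      (Runs.each_stop (by simp))).of_eq ?_ (by simp)
    funext k
    cases k <;> simp
  | cons a l ih =>
    obtain ⟨p, q⟩ := a
    have h1 : ∀ S, Runs (if p && q then .push .Z .mark else .skip) S
        (update S .Z (unary (if p && q then 1 else 0) ++ S .Z)) 1 := by
      intro S
      cases p && q
      · exact Runs.skip.of_eq (by simp) (by simp)
      · exact Runs.push _ _ _
    refine (Runs.each_step hX rfl (Runs.push_seq (Runs.push_seq (h1 _))) (ih _ ?_)).of_eq ?_ ?_
    · simp
    · have : (unary (List.count (true, true) ((p, q) :: l)) : List Sym) =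
        unary (List.count (true, true) l) ++ unary (if p && q then 1 else 0) := by
        rw [← List.replicate_add, List.count_cons]
        congr 2
        cases p <;> cases q <;> rfl
      rw [this]
      clear ih
      funext k
      cases k <;> simp
      rw [List.replicate_add, List.append_assoc]
    · simp only [List.length_cons]; omega

theorem runs_initU (ts : List (Bool × Bool)) (S : Store) (hT : S .T = ttext ts)
    (hX : S .X = []) (hZ : S .Z = []) (hU : S .U = []) :
    Runs initU S (update S .U (vsText (termSpace ts).2)) (8 * ts.length + 15) := by
  have hlast : ∀ (S' : Store) (l : List Sym), S' .U = l → Runs (.pop .Z fun o => match o with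
      | none => .skip
      | some _ => clear .U ;; clear .Z) S' (update (update S' .Z [])
        .U (if S' .Z = [] then S' .U else [])) (l.length + (S' .Z).length + 3) := by
    intro S' l hl
    rcases hz : S' .Z with _ | ⟨s, z⟩
    · refine (Runs.pop_none hz Runs.skip).of_eq ?_ (by omega)
      simp [← hz]
    · refine (Runs.pop_some hz ((runs_clear _ _).seq (runs_clear _ _))).of_eq ?_ ?_
      · funext k
        cases k <;> simp
      · simp [hl]; omega
  refine ((runs_mv .T .X (by simp) S).seq ((runs_initU_loop ts.reverse _ ?_).seq
    (hlast _ _ rfl))).of_eq ?_ ?_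
  · simp [hT, ttext, hX]
  · have h0 : (unary (ts.reverse.count (true, true)) = []) ↔ (true, true) ∉ ts := by
      rw [List.count_reverse, List.replicate_eq_nil_iff, List.count_eq_zero]
    clear hlast
    by_cases h : (true, true) ∈ ts
    · have h1 : unary (ts.reverse.count (true, true)) ≠ [] := by
        rw [ne_eq, h0]; simpa using h
      funext k
      cases k <;> simp_all [ttext, termSpace]
    · have h1 := h0.2 h
      funext k
      cases k <;> simp_all [ttext, termSpace, vtext, termPoint]
  · have := List.count_le_length (a := (true, true)) (l := ts)
    simp [hT, hU, hZ]
    omega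

/-- The coordinate of a generator at a place of the term before the current one. -/
def genSym : Sym → Sym
  | .con _ _ => .bit false
  | _ => .hd false

/-- Pushes on `V` the generator for the variable at the current place of the term, which is split
between `X` and `T`. -/
def genProg : Prog :=
  copyMap (fun _ => .bit false) .T .Y .V ;; .push .V (.bit true) ;;
  copyMap genSym .X .Y .V

/-- One symbol of the term in `initV`. -/
def initVStep : Sym → Prog
  | .con false false => genProg
  | _ => .skip

/-- Writes on `V` the generators of the affine space of the term on `T`. -/
def initV : Prog :=
  .each .T (fun _ => true) (fun s => initVStep s ;; .push .X s) ;; mv .X .T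

theorem runs_genProg (pre suf : List (Bool × Bool)) (S : Store)
    (hT : S .T = suf.map fun a => .con a.1 a.2)
    (hX : S .X = (pre.map fun a => .con a.1 a.2).reverse ++ [.sep]) (hY : S .Y = []) :
    Runs genProg S (update S .V (vtext (false :: (List.replicate pre.length false ++
      true :: List.replicate suf.length false)) ++ S .V))
      (5 * (pre.length + suf.length) + 10) := by
  refine ((runs_copyMap _ .T .Y .V (by simp) (by simp) (by simp) S hY).seq (Runs.push_seq
    (runs_copyMap _ .X .Y .V (by simp) (by simp) (by simp) _ (by simp [hY])))).of_eq ?_ ?_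
  · have e1 : (List.map ((fun _ : Sym => Sym.bit false) ∘ fun a : Bool × Bool => Sym.con a.1 a.2)
      suf).reverse = List.replicate suf.length (.bit false) := by
      rw [List.eq_replicate_iff]; simp
    have e2 : List.map (genSym ∘ fun a : Bool × Bool => Sym.con a.1 a.2) pre =
      List.replicate pre.length (.bit false) := by
      rw [List.eq_replicate_iff]; simp [genSym]
    funext k
    cases k <;> simp [hT, hX, vtext, e1, e2, genSym]
  · simp [hT, hX]; omega

theorem runs_initV_loop (pre suf : List (Bool × Bool)) (S : Store)
    (hT : S .T = suf.map fun a => .con a.1 a.2)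
    (hX : S .X = (pre.map fun a => .con a.1 a.2).reverse ++ [.sep]) (hY : S .Y = []) :
    Runs (.each .T (fun _ => true) (fun s => initVStep s ;; .push .X s)) S
      (update (update (update S .T []) .X ((suf.map fun a => .con a.1 a.2).reverse ++ S .X))
        .V (vsText ((termGens suf).map fun g =>
          false :: (List.replicate pre.length false ++ g)).reverse ++ S .V))
      ((5 * (pre.length + suf.length) + 12) * suf.length + 1) := by
  induction suf generalizing pre S with
  | nil =>
    refine (Runs.each_stop (by simp [hT])).of_eq ?_ (by simp)
    funext k
    cases k <;> simp_all [termGens]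
  | cons a suf ih =>
    have h1 : Runs (initVStep (.con a.1 a.2)) (update S .T (suf.map fun a => .con a.1 a.2))
        (update (update S .T (suf.map fun a => .con a.1 a.2)) .V
          (if a = (false, false) then vtext (false :: (List.replicate pre.length false ++
      true :: List.replicate suf.length false)) ++ S .V else S .V))
        (5 * (pre.length + suf.length) + 10) := by
      obtain ⟨p, q⟩ := a
      have hsk : Runs .skip (update S .T (suf.map fun a => .con a.1 a.2))
          (update (update S .T (suf.map fun a => .con a.1 a.2)) .V (S .V))
          (5 * (pre.length + suf.length) + 10) := by
        refine Runs.skip.of_eq ?_ (by simp)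
        funext k
        cases k <;> simp
      rcases p <;> rcases q
      · exact (runs_genProg pre suf _ (by simp) (by simp [hX]) (by simp [hY])).of_eq
          (by simp) le_rfl
      · exact hsk
      · exact hsk
      · exact hsk
    refine (Runs.each_step (by rw [hT]; rfl) rfl (h1.seq (Runs.push .X _ _))
      (ih (pre ++ [a]) _ ?_ ?_ ?_)).of_eq ?_ ?_
    · simp
    · simp [hX]
    · simp [hY]
    · have e : vsText ((termGens (a :: suf)).map fun g =>
            false :: (List.replicate pre.length false ++ g)).reverse =
          vsText ((termGens suf).map fun g =>
            false :: (List.replicate (pre ++ [a]).length false ++ g)).reverse ++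
          (if a = (false, false) then vtext (false :: (List.replicate pre.length false ++
            true :: List.replicate suf.length false)) else []) := by
        rw [List.length_append, List.length_singleton, List.replicate_add, termGens]
        split_ifs <;> simp [Function.comp_def]
      rw [e]
      clear ih h1
      funext k
      cases k <;> simp
      split_ifs <;> simp
    · simp only [List.length_append, List.length_cons, List.length_nil]
      nlinarith

theorem runs_initV (ts : List (Bool × Bool)) (S : Store) (hT : S .T = ttext ts)
    (hX : S .X = []) (hY : S .Y = []) (hV : S .V = []) :
    Runs initV S (update S .V (vsText (termSpace ts).1))
      (5 * ts.length ^ 2 + 14 * ts.length + 7) := by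
  refine ((Runs.each_step (s := .sep) hT rfl (Runs.skip.seq (Runs.push .X _ _))
      (runs_initV_loop [] ts _ ?_ ?_ ?_)).seq (runs_mv .X .T (by simp) _)).of_eq ?_ ?_
  · simp
  · simp [hX]
  · simp [hY]
  · funext k
    cases k <;> simp_all [ttext, termSpace]
  · simp [hX]
    nlinarith

/-! ### Inserting the points of an affine space into the bucket -/

/-- Adds the vector on `P` to each vector on `W`; the sums are put on top of `W`. -/
def doubleProg : Prog :=
  copyRev .W .Y .X ;; mv .X .Z ;;
  .each .Z (fun _ => true) (fun s => .push .Z s ;; scan .P .Z (fun _ _ q => q) addSym ;;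
    .pop .Q fun _ => .skip) ;; mv .Y .W

theorem runs_double_loop (m : ℕ) (hm : m ≠ 0) (p : List Bool) (hp : p.length = m)
    (E : List (List Bool)) (hE : ∀ v ∈ E, v.length = m) (S : Store)
    (hP : S .P = vtext p) (hZ : S .Z = vsText E) (hX : S .X = []) :
    Runs (.each .Z (fun _ => true) (fun s => .push .Z s ;; scan .P .Z (fun _ _ q => q) addSym ;;
      .pop .Q fun _ => .skip)) S
      (update (update S .Z []) .Y ((vsText (E.map (vx p))).reverse ++ S .Y))
      ((8 * m + 6) * E.length + 1) := by
  induction E generalizing S with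
  | nil =>
    refine (Runs.each_stop (by simp [hZ])).of_eq ?_ (by simp)
    funext k
    cases k <;> simp_all
  | cons v E ih =>
    have hv := hE v (by simp)
    have hv0 : vtext v ≠ [] := by
      rw [← List.length_pos_iff, length_vtext]; omega
    obtain ⟨s, l, hs⟩ := List.exists_cons_of_ne_nil hv0
    have hZ' : S .Z = s :: (l ++ vsText E) := by rw [hZ, vsText_cons, hs]; rfl
    have h1 := runs_scan .P .Z (fun _ _ q => q) addSym (by decide) (vtext p) (vtext v)
      (vsText E) S hP (by rw [hZ, vsText_cons]) (by simp [hp, hv]) hX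
    rw [zipWith_addSym] at h1
    refine (Runs.each_peek hZ' rfl (h1.seq (Runs.pop_some (s := .bit _) (l := S .Q)
      (by simp; rfl) Runs.skip))
      (ih (fun v h => hE v (by simp [h])) _ ?_ ?_ ?_)).of_eq ?_ ?_
    · simp [hP]
    · simp
    · simp [hX]
    · clear ih h1
      funext k
      cases k <;> simp
    · simp [hp]; nlinarith

theorem runs_doubleProg (m : ℕ) (hm : m ≠ 0) (p : List Bool) (hp : p.length = m)
    (E : List (List Bool)) (hE : ∀ v ∈ E, v.length = m) (S : Store)
    (hP : S .P = vtext p) (hW : S .W = vsText E) (hX : S .X = []) (hY : S .Y = [])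
    (hZ : S .Z = []) :
    Runs doubleProg S (update S .W (vsText (E.map (vx p) ++ E)))
      ((17 * m + 6) * E.length + 5) := by
  have hl := length_vsText hE
  have hl2 : (vsText (E.map (vx p))).length = m * E.length := by
    rw [length_vsText (m := m), List.length_map]
    intro v hv
    obtain ⟨w, hw, rfl⟩ := List.mem_map.1 hv
    exact length_vx hp (hE w hw)
  refine ((runs_copyRev .W .Y .X (by simp) (by simp) (by simp) S hY).seq
    ((runs_mv .X .Z (by simp) _).seq ((runs_double_loop m hm p hp E hE _ ?_ ?_ ?_).seq
    (runs_mv .Y .W (by simp) _)))).of_eq ?_ ?_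
  · simp [hP]
  · simp [hW, hX, hZ]
  · simp
  · funext k
    cases k <;> simp_all
  · simp [hW, hX, hY, hl, hl2]
    nlinarith

/-- Doubles the points on `W` for each generator on `V`. -/
def spanProg : Prog :=
  .each .V (fun _ => true) fun s => .push .Y s ;; mvWhile Sym.isBit .V .Y ;; takeY .P ;;
    doubleProg ;; clear .P

theorem runs_spanProg (m K : ℕ) (hm : m ≠ 0) (G : List (List Bool)) (hG : ∀ v ∈ G, v.length = m)
    (E : List (List Bool)) (hE : ∀ v ∈ E, v.length = m) (hK : 2 ^ G.length * E.length ≤ K)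
    (S : Store) (hV : S .V = vsText G) (hW : S .W = vsText E) (hX : S .X = []) (hY : S .Y = [])
    (hZ : S .Z = []) (hP : S .P = []) :
    Runs spanProg S (update (update S .V []) .W (vsText (solsFrom G E)))
      (((17 * m + 6) * K + 5 * m + 10) * G.length + 1) := by
  induction G generalizing E S with
  | nil =>
    refine (Runs.each_stop (by simp [hV])).of_eq ?_ (by simp)
    funext k
    cases k <;> simp_all [solsFrom]
  | cons g G ih =>
    have hg := hG g (by simp)
    have hg0 : g ≠ [] := by rintro rfl; exact hm hg.symm
    obtain ⟨h, l, rfl⟩ := List.exists_cons_of_ne_nil hg0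
    have hV' : S .V = .hd h :: (l.map .bit ++ vsText G) := by simpa [vtext] using hV
    have hE' : ∀ v ∈ E.map (vx (h :: l)) ++ E, v.length = m := by
      intro v hv
      rcases List.mem_append.1 hv with hv | hv
      · obtain ⟨w, hw, rfl⟩ := List.mem_map.1 hv
        exact length_vx hg (hE w hw)
      · exact hE v hv
    have hK' : 2 ^ G.length * (E.map (vx (h :: l)) ++ E).length ≤ K := by
      rw [List.length_append, List.length_map]
      rw [List.length_cons, pow_succ] at hK
      linarith
    have hEK : E.length ≤ K := by
      refine le_trans ?_ hK
      exact Nat.le_mul_of_pos_left _ (by positivity)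
    have hr : (vsText G).head?.any Sym.isBit = false := by
      rcases G with _ | ⟨g', G⟩
      · rfl
      · have : g' ≠ [] := by rintro rfl; exact hm (hG [] (by simp)).symm
        obtain ⟨h', l', rfl⟩ := List.exists_cons_of_ne_nil this
        rfl
    refine (Runs.each_step hV' rfl (Runs.push_seq ((runs_mvWhile Sym.isBit .V .Y (by simp) _
      (l.map .bit) (vsText G) (by simp)
      (by simp only [List.mem_map]; rintro s ⟨b, -, rfl⟩; rfl) hr).seq ((runs_takeY .P (by simp) _
      (h :: l) hg0 [] ?_).seq ((runs_doubleProg m hm (h :: l) hg E hE _ ?_ ?_ ?_ ?_ ?_).seq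
      (runs_clear .P _))))) (ih (fun v h => hG v (by simp [h])) _ hE'
      hK' _ ?_ ?_ ?_ ?_ ?_ ?_)).of_eq
      ?_ ?_
    · simp [hY, vtext]
    · simp [hP]
    · simp [hW]
    · simp [hX]
    · simp
    · simp [hZ]
    · simp
    · simp
    · simp [hX]
    · simp
    · simp [hZ]
    · simp
    · clear ih
      funext k
      cases k <;> simp [solsFrom, hP, hY]
    · have := Nat.mul_le_mul_left (17 * m + 6) hEK
      simp only [List.length_cons] at hg
      simp [hP]
      nlinarith

/-- Inserts the points on `W` into the bucket. -/
def pourProg : Prog :=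
  .each .W (fun _ => true) (fun s => .push .Y s ;; match s with
    | .hd _ => .pop .C fun _ => .skip
    | _ => .skip) ;; mv .Y .B

/-- Inserts the points of the affine space on `V` and `U` into the bucket. -/
def insertProg : Prog := mv .U .Y ;; mv .Y .W ;; spanProg ;; pourProg

theorem runs_pour_bits (l : List Bool) (r : List Sym) (S S' : Store) (t : ℕ)
    (hW : S .W = l.map .bit ++ r)
    (h : Runs (.each .W (fun _ => true) (fun s => .push .Y s ;; match s with
      | .hd _ => .pop .C fun _ => .skip
      | _ => .skip)) (update (update S .W r) .Y ((l.map Sym.bit).reverse ++ S .Y)) S' t) :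
    Runs (.each .W (fun _ => true) (fun s => .push .Y s ;; match s with
      | .hd _ => .pop .C fun _ => .skip
      | _ => .skip)) S S' (2 * l.length + t) := by
  induction l generalizing S with
  | nil =>
    have : update (update S .W r) .Y (([] : List Sym) ++ S .Y) = S := by
      simp only [List.map_nil, List.nil_append] at hW
      rw [← hW]; simp
    simp only [List.map_nil, List.reverse_nil] at h
    rw [this] at h
    exact h.mono (by simp)
  | cons b l ih =>
    refine Runs.mono (Runs.each_step (s := .bit b) hW rfl (Runs.push_seq Runs.skip)
      (ih _ (by simp) ?_)) (t := 0 + 1 + (2 * l.length + t) + 1) (by simp; omega)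
    convert h using 1
    funext k
    cases k <;> simp

theorem runs_pourProg (m : ℕ) (hm : m ≠ 0) (vs : List (List Bool)) (hvs : ∀ v ∈ vs, v.length = m)
    (c : ℕ) (S : Store) (hW : S .W = vsText vs) (hC : S .C = unary c) (hY : S .Y = []) :
    Runs pourProg S (update (update (update S .W []) .C (unary (c - vs.length)))
      .B (vsText vs ++ S .B)) ((4 * m + 3) * vs.length + 2) := by
  have key : ∀ (vs : List (List Bool)) (hvs : ∀ v ∈ vs, v.length = m) (c : ℕ) (S : Store),
      S .W = vsText vs → S .C = unary c →
      Runs (.each .W (fun _ => true) (fun s => .push .Y s ;; match s with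
        | .hd _ => .pop .C fun _ => .skip
        | _ => .skip)) S (update (update (update S .W []) .C (unary (c - vs.length)))
          .Y ((vsText vs).reverse ++ S .Y)) ((2 * m + 3) * vs.length + 1) := by
    intro vs
    induction vs with
    | nil =>
      intro _ c S hW hC
      refine (Runs.each_stop (by simp [hW])).of_eq ?_ (by simp)
      funext k
      cases k <;> simp_all
    | cons v vs ih =>
      intro hvs c S hW hC
      have hv := hvs v (by simp)
      have hv0 : v ≠ [] := by rintro rfl; exact hm hv.symm
      obtain ⟨h, l, rfl⟩ := List.exists_cons_of_ne_nil hv0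
      have hW' : S .W = .hd h :: (l.map .bit ++ vsText vs) := by simpa [vtext] using hW
      have hpop : ∀ S : Store, S .C = unary c → Runs (.pop .C fun _ => .skip) S
          (update S .C (unary (c - 1))) 1 := by
        intro S hC
        rcases c with _ | c
        · exact (Runs.pop_none hC Runs.skip).of_eq (by simp [← hC]) le_rfl
        · exact (Runs.pop_some hC Runs.skip).of_eq (by simp) le_rfl
      refine (Runs.each_step (s := .hd h) hW' rfl (Runs.push_seq (hpop _ (by simp [hC])))
        (runs_pour_bits l (vsText vs) _ _ _ ?_
        (ih (fun v h => hvs v (by simp [h])) (c - 1) _ ?_ ?_))).of_eq ?_ ?_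
      · simp
      · simp
      · simp
      · clear ih hpop
        rw [List.length_cons, Nat.sub_sub, Nat.add_comm 1]
        funext k
        cases k <;> simp [vtext]
      · simp only [List.length_cons] at hv ⊢
        nlinarith
  refine ((key vs hvs c S hW hC).seq (runs_mv .Y .B (by simp) _)).of_eq ?_ ?_
  · clear key
    funext k
    cases k <;> simp [hY]
  · have := length_vsText hvs
    simp [hY, this]
    nlinarith

/-- The row after the points of the affine space have been inserted into the bucket. -/
def Row.insert (row : Row) (sp : List (List Bool) × List (List Bool)) : Row where
  left := row.left
  right := row.right
  free := row.free - (solsFrom sp.1 sp.2).length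
  pts := solsFrom sp.1 sp.2 ++ row.pts

theorem length_of_mem_solsFrom {m : ℕ} {sp : List (List Bool) × List (List Bool)}
    (hsp : IsSpace m sp) {v : List Bool} (hv : v ∈ solsFrom sp.1 sp.2) : v.length = m :=
  (hsp.isVec_of_mem ((solsFrom_perm _ _).mem_iff.1 hv)).1

theorem runs_insertProg (m K : ℕ) (hm : m ≠ 0) (row : Row)
    (sp : List (List Bool) × List (List Bool)) (hsp : IsSpace m sp)
    (hK : (solsFrom sp.1 sp.2).length ≤ K) (S : Store) (hX : S .X = []) (hY : S .Y = [])
    (hZ : S .Z = []) (hP : S .P = []) (hW : S .W = []) :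
    Runs insertProg (holds S row sp) (holds S (row.insert sp) ([], []))
      (((17 * m + 6) * K + 5 * m + 10) * sp.1.length + (4 * m + 3) * K + 4 * m + 5) := by
  obtain ⟨hG, hU, hU1⟩ := id hsp
  have hUl := length_vsText fun v h => (hU v h).1
  refine ((runs_mv .U .Y (by simp) _).seq ((runs_mv .Y .W (by simp) _).seq
    ((runs_spanProg m K hm sp.1 (fun v h => (hG v h).1) sp.2 (fun v h => (hU v h).1)
      (by rwa [← length_solsFrom]) _ ?_ ?_ ?_ ?_ ?_ ?_).seq (runs_pourProg m hm
      (solsFrom sp.1 sp.2) (fun v h => length_of_mem_solsFrom hsp h) row.free _ ?_ ?_ ?_)))).of_eq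
      ?_ ?_
  · simp [holds]
  · simp [holds, hY, hW]
  · simp [holds, hX]
  · simp
  · simp [holds, hZ]
  · simp [holds, hP]
  · simp
  · simp [holds]
  · simp
  · funext k
    cases k <;> simp [holds, Row.insert, hY, hW]
  · have h1 : m * sp.2.length ≤ m * 1 := Nat.mul_le_mul_left _ hU1
    have h2 := Nat.mul_le_mul_left (4 * m + 3) hK
    simp [holds, hY, hUl]
    omega

/-! ### The tape of a row and its cells -/

/-- The random bits of a row: `n` bits that only serve as coefficients, and `n` pairs of bits. -/
structure Tape where
  /-- the first coefficients -/
  bs : List Bool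
  /-- the further coefficients, each together with the constant term of an equation -/
  cs : List (Bool × Bool)

namespace Tape

variable (tp : Tape)

/-- The cells of the tape at which an equation ends. The last equation is unsatisfiable. -/
def eqs : List Sym := tp.cs.map (fun c => .con c.1 c.2) ++ [.fls]

/-- The tape to the left of the head at level `j`. -/
def left (j : ℕ) : List Sym := (tp.eqs.take j).reverse ++ tp.bs.map .base

/-- The tape to the right of the head at level `j`. -/
def right (j : ℕ) : List Sym := tp.eqs.drop j

/-- The equation that is imposed when the level is raised from `j` to `j + 1`. -/
def eqv (j : ℕ) : List Bool := equation tp.bs.length (tp.left (j + 1))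

/-- Whether a point lies in the cell of level `j`. -/
def inCell (j : ℕ) (v : List Bool) : Bool := (List.range j).all fun i => !ip (tp.eqv i) v

/-- The tape is long enough for points with `n` coordinates. -/
def Valid (n : ℕ) : Prop := tp.bs.length = n ∧ tp.cs.length = n

variable {tp} {n : ℕ}

theorem Valid.length_eqs (h : tp.Valid n) : tp.eqs.length = n + 1 := by
  simp [eqs, h.2]

theorem isEq_of_mem_eqs {s : Sym} (h : s ∈ tp.eqs) : s.isEq = true := by
  rcases List.mem_append.1 h with h | h
  · obtain ⟨c, -, rfl⟩ := List.mem_map.1 h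
    rfl
  · obtain rfl : s = .fls := by simpa using h
    rfl

theorem right_eq (j : ℕ) (hj : j < tp.eqs.length) : tp.right j = tp.eqs[j] :: tp.right (j + 1) :=
  List.drop_eq_getElem_cons hj

theorem left_succ (j : ℕ) (hj : j < tp.eqs.length) :
    tp.left (j + 1) = tp.eqs[j] :: tp.left j := by
  rw [left, List.take_succ_eq_append_getElem hj, List.reverse_append]
  rfl

theorem inCell_succ (j : ℕ) (v : List Bool) :
    tp.inCell (j + 1) v = (tp.inCell j v && !ip (tp.eqv j) v) := by
  simp [inCell, List.range_succ]

theorem filter_inCell_succ (j : ℕ) (A : List (List Bool)) :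
    A.filter (tp.inCell (j + 1)) =
      (A.filter (tp.inCell j)).filter fun v => !ip (tp.eqv j) v := by
  rw [List.filter_filter]
  congr 1
  funext v
  rw [inCell_succ, Bool.and_comm]

theorem Valid.length_left (h : tp.Valid n) (j : ℕ) : n ≤ (tp.left j).length := by
  simp [left, h.1]

theorem Valid.length_right (h : tp.Valid n) (j : ℕ) : (tp.right j).length ≤ n + 1 := by
  simp [right, h.length_eqs]

theorem Valid.fls (h : tp.Valid n) : tp.eqs[n]'(by rw [h.length_eqs]; omega) = .fls := by
  have h2 := h.2
  subst h2
  simp [eqs]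

theorem Valid.getLast?_right (h : tp.Valid n) {j : ℕ} (hj : j ≤ n) :
    (tp.right j).getLast? = some .fls := by
  have h2 := h.2
  rw [right, eqs, List.drop_append_of_le_length (by simp; omega)]
  simp

theorem Valid.right_eq_nil (h : tp.Valid n) : tp.right (n + 1) = [] := by
  rw [right, List.drop_eq_nil_iff, h.length_eqs]

theorem applyTape_snd (L : List Sym) (sp : List (List Bool) × List (List Bool)) (h : sp.2 = []) :
    (applyTape n L sp).2 = [] := by
  induction L generalizing sp with
  | nil => exact h
  | cons s L ih =>
    rw [applyTape]
    split_ifs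
    · exact ih _ (by simp [elimStep, h, elimGo])
    · exact h

theorem Valid.applyTape_succ (h : tp.Valid n) (j : ℕ) (hj : j < n + 1)
    (sp : List (List Bool) × List (List Bool)) :
    applyTape n (tp.left (j + 1)) sp = applyTape n (tp.left j) (elimStep (tp.eqv j) sp) := by
  have hj' : j < tp.eqs.length := by rw [h.length_eqs]; exact hj
  rw [eqv, h.1, left_succ j hj', applyTape, isEq_of_mem_eqs (List.getElem_mem _), if_pos rfl]

theorem applyTape_zero (sp : List (List Bool) × List (List Bool)) :
    applyTape n (tp.left 0) sp = sp := by
  rcases hb : tp.bs with _ | ⟨b, bs⟩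
  · simp [left, hb, applyTape]
  · simp [left, hb, applyTape, Sym.isEq]

/-- The equations on the tape to the left of the head define the cell. -/
theorem Valid.applyTape (h : tp.Valid n) (j : ℕ) (hj : j ≤ n + 1)
    (sp : List (List Bool) × List (List Bool)) (hsp : IsSpace (n + 1) sp) :
    IsSpace (n + 1) (applyTape n (tp.left j) sp) ∧
      (applyTape n (tp.left j) sp).1.length ≤ sp.1.length ∧
      (space (DNFStream.applyTape n (tp.left j) sp)).Perm ((space sp).filter (tp.inCell j)) := by
  induction j generalizing sp with
  | zero =>
    rw [applyTape_zero]
    refine ⟨hsp, le_rfl, ?_⟩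
    rw [List.filter_eq_self.2]
    intro v _
    simp [inCell]
  | succ j ih =>
    rw [h.applyTape_succ j (by omega)]
    obtain ⟨h1, h2, h3⟩ := ih (by omega) _ (hsp.elimStep (tp.eqv j))
    refine ⟨h1, h2.trans (length_elimStep_le _ _), h3.trans ?_⟩
    have := (hsp.perm_elimStep (tp.eqv j)).filter (tp.inCell j)
    refine this.trans ?_
    rw [filter_inCell_succ, List.filter_filter, List.filter_filter]
    simp only [Bool.and_comm]
    rfl

theorem Valid.canClimb (h : tp.Valid n) (j : ℕ) (hj : j ≤ n + 1)
    (sp : List (List Bool) × List (List Bool)) (hsp : IsSpace (n + 1) sp) :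
    CanClimb (tp.right j) (DNFStream.applyTape n (tp.left j) sp) := by
  rcases Nat.lt_or_ge n j with hj' | hj'
  · obtain rfl : j = n + 1 := by omega
    right
    rw [h.applyTape_succ n (by omega)]
    refine applyTape_snd _ _ ?_
    rw [eqv, h.1, left_succ n (by rw [h.length_eqs]; omega), h.fls]
    exact elimStep_fls ((h.length_left n).trans (by omega)) hsp
  · exact .inl (h.getLast?_right hj')

end Tape

/-- The points of an affine space are counted by means of its dimension, without listing them. -/
theorem fits_iff {m : ℕ} {sp : List (List Bool) × List (List Bool)} (hsp : IsSpace m sp) (c : ℕ) :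
    fits c sp = true ↔ (space sp).length ≤ c := by
  obtain ⟨G, U⟩ := sp
  obtain ⟨-, -, h⟩ := hsp
  rcases U with _ | ⟨u, _ | ⟨u', U⟩⟩
  · simp [fits, space]
  · simp [fits, space, length_sols]
  · simp at h

/-- The bucket of a row holds the points of `A` that lie in the cell of some level `j`, which is the
least level for which there are at most `K` such points. -/
def Row.Inv (tp : Tape) (K : ℕ) (A : List (List Bool)) (row : Row) : Prop :=
  ∃ j ≤ tp.bs.length + 1, row.left = tp.left j ∧ row.right = tp.right j ∧
    row.free + row.pts.length = K ∧ row.pts.Perm (A.filter (tp.inCell j)) ∧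
    ∀ i < j, K < (A.filter (tp.inCell i)).length

/-- The case of `climb_inv` in which there is room at the present level. -/
theorem insert_inv {tp : Tape} {n : ℕ} (h : tp.Valid n) (K : ℕ) (A₁ A₂ : List (List Bool))
    (row : Row) (sp : List (List Bool) × List (List Bool)) (hsp : IsSpace (n + 1) sp) (j : ℕ)
    (hj : j ≤ n + 1) (hl : row.left = tp.left j) (hr : row.right = tp.right j)
    (hK : row.free + row.pts.length = K) (h1 : row.pts.Perm (A₁.filter (tp.inCell j)))
    (h2 : (space sp).Perm (A₂.filter (tp.inCell j)))
    (hmin : ∀ i < j, K < ((A₂ ++ A₁).filter (tp.inCell i)).length) (hf : fits row.free sp = true) :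
    (row.insert sp).Inv tp K (A₂ ++ A₁) ∧ IsSpace (n + 1) sp ∧ sp.1.length ≤ sp.1.length ∧
      (solsFrom sp.1 sp.2).length ≤ K := by
  have hlen : (solsFrom sp.1 sp.2).length = (space sp).length := (solsFrom_perm _ _).length_eq
  rw [fits_iff hsp, ← hlen] at hf
  refine ⟨⟨j, by rw [h.1]; exact hj, hl, hr, ?_, ?_, hmin⟩, hsp, le_rfl, by omega⟩
  · simp only [Row.insert, List.length_append]; omega
  · rw [List.filter_append]
    exact ((solsFrom_perm _ _).trans h2).append h1

/-- Raising the level and inserting an affine space yields a row for the points `A₂ ++ A₁`, where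
`A₁` are the points in the row (up to its level) and `A₂` those in the affine space. The bounds on
the affine space that is inserted in the end are needed for the time. -/
theorem climb_inv {tp : Tape} {n : ℕ} (h : tp.Valid n) (K : ℕ) (A₁ A₂ : List (List Bool))
    (row : Row) (sp : List (List Bool) × List (List Bool)) (hsp : IsSpace (n + 1) sp) (j : ℕ)
    (hj : j ≤ n + 1) (hl : row.left = tp.left j) (hr : row.right = tp.right j)
    (hK : row.free + row.pts.length = K) (h1 : row.pts.Perm (A₁.filter (tp.inCell j)))
    (h2 : (space sp).Perm (A₂.filter (tp.inCell j)))
    (hmin : ∀ i < j, K < ((A₂ ++ A₁).filter (tp.inCell i)).length)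
    (hc : CanClimb (tp.right j) sp) :
    ((climb n (tp.right j) row sp).1.insert (climb n (tp.right j) row sp).2).Inv tp K (A₂ ++ A₁) ∧
      IsSpace (n + 1) (climb n (tp.right j) row sp).2 ∧
      (climb n (tp.right j) row sp).2.1.length ≤ sp.1.length ∧
      (solsFrom (climb n (tp.right j) row sp).2.1 (climb n (tp.right j) row sp).2.2).length ≤
        K := by
  generalize hR : tp.right j = R
  induction R generalizing row sp j with
  | nil =>
    refine insert_inv h K A₁ A₂ row sp hsp j hj hl hr hK h1 h2 hmin ?_
    rcases hc with hc | hc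
    · rw [hR] at hc; simp at hc
    · simp [fits, hc]
  | cons s R ih =>
    rw [climb]
    split_ifs with hf
    · exact insert_inv h K A₁ A₂ row sp hsp j hj hl (hr.trans (by rw [hR])) hK h1 h2 hmin hf
    · have hjn : j < n + 1 := by
        by_contra hcon
        obtain rfl : j = n + 1 := by omega
        rw [h.right_eq_nil] at hR
        simp at hR
      have hje : j < tp.eqs.length := by rw [h.length_eqs]; exact hjn
      rw [Tape.right_eq j hje, List.cons.injEq] at hR
      obtain ⟨rfl, rfl⟩ := hR
      have hN : equation n (tp.eqs[j] :: row.left) = tp.eqv j := by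
        rw [Tape.eqv, h.1, Tape.left_succ j hje, hl]
      rw [Bool.not_eq_true] at hf
      have hlt : row.free < (space sp).length := by
        by_contra hcon
        rw [(fits_iff hsp _).2 (by omega)] at hf
        simp at hf
      have hlen := length_elimStep_le (equation n (tp.eqs[j] :: row.left)) sp
      rw [Tape.right_eq j hje] at hc
      have hc' := hc.step (by rw [hl]; exact (h.length_left j).trans (by omega)) hsp (n := n)
        (L := row.left)
      obtain ⟨i1, i2, i3, i4⟩ := ih (row.raise n tp.eqs[j] (tp.right (j + 1)))
        (elimStep (equation n (tp.eqs[j] :: row.left)) sp) (hsp.elimStep _) (j + 1) (by omega)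
        (by simp only [Row.raise]; rw [Tape.left_succ j hje, hl]) rfl
        ((length_raise _ _ _ _).trans hK)
        (by
          rw [Tape.filter_inCell_succ]
          simp only [Row.raise, hN]
          exact h1.filter _)
        (by
          rw [Tape.filter_inCell_succ, hN]
          exact (hsp.perm_elimStep _).trans (h2.filter _))
        (by
          intro i hi
          rcases Nat.lt_succ_iff_lt_or_eq.1 hi with hi | rfl
          · exact hmin i hi
          · rw [List.filter_append, List.length_append, ← h1.length_eq, ← h2.length_eq]
            omega)
        hc' rfl
      exact ⟨i1, i2, i3.trans hlen, i4⟩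

/-! ### Processing a term -/

/-- The row after the points that satisfy a term have been deleted from the bucket. -/
def Row.clean (ts : List (Bool × Bool)) (row : Row) : Row where
  left := row.left
  right := row.right
  free := row.free + row.pts.countP fun v => satTerm ts v.tail
  pts := row.pts.filter fun v => !satTerm ts v.tail

/-- The row after a term has been processed. -/
def rowStep (ts : List (Bool × Bool)) (row : Row) : Row :=
  (climb ts.length row.right (row.clean ts) (applyTape ts.length row.left (termSpace ts))).1.insert
    (climb ts.length row.right (row.clean ts) (applyTape ts.length row.left (termSpace ts))).2

/-- Processes a term. -/
def rowProg : Prog :=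
  initU ;; initV ;; applyTapeProg ;; filterProg .T termBit false ;; climbProg ;; insertProg

/-- The points after a term has been processed. -/
def addTerm (ts : List (Bool × Bool)) (A : List (List Bool)) : List (List Bool) :=
  space (termSpace ts) ++ A.filter fun v => !satTerm ts v.tail

/-- A list of different points with `n` coordinates. -/
def IsPoints (n : ℕ) (A : List (List Bool)) : Prop := A.Nodup ∧ ∀ v ∈ A, IsVec true (n + 1) v

theorem length_clean (ts : List (Bool × Bool)) (row : Row) :
    (row.clean ts).free + (row.clean ts).pts.length = row.free + row.pts.length := by
  simp only [Row.clean]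
  rw [add_assoc, Nat.add_left_cancel_iff, ← List.countP_eq_length_filter,
    List.length_eq_countP_add_countP (l := row.pts) (fun v => satTerm ts v.tail)]
  congr 2
  funext v
  cases satTerm ts v.tail <;> rfl

theorem mem_addTerm {ts : List (Bool × Bool)} {A : List (List Bool)} {v : List Bool}
    (hv : v.length = ts.length) :
    true :: v ∈ addTerm ts A ↔ true :: v ∈ A ∨ satTerm ts v = true := by
  rw [addTerm, List.mem_append, mem_space_termSpace, List.mem_filter]
  simp only [hv, List.tail_cons]
  cases satTerm ts v <;> simp

theorem IsPoints.addTerm {ts : List (Bool × Bool)} {A : List (List Bool)}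
    (hA : IsPoints ts.length A) : IsPoints ts.length (addTerm ts A) := by
  refine ⟨List.nodup_append.2 ⟨nodup_space_termSpace ts, hA.1.filter _, ?_⟩, ?_⟩
  · rintro v hv w hw rfl
    rw [List.mem_filter] at hw
    obtain ⟨h1, h2⟩ := hA.2 v hw.1
    obtain ⟨x, rfl⟩ : ∃ x, v = true :: x := by
      rcases v with _ | ⟨b, x⟩
      · simp at h2
      · exact ⟨x, by simpa using h2⟩
    rw [mem_space_termSpace] at hv
    simp [hv.2] at hw
  · intro v hv
    rcases List.mem_append.1 hv with hv | hv
    · exact (isSpace_termSpace ts).isVec_of_mem hv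
    · exact hA.2 v (List.mem_of_mem_filter hv)

theorem subset_addTerm {ts : List (Bool × Bool)} {A : List (List Bool)}
    (hA : IsPoints ts.length A) : A ⊆ addTerm ts A := by
  intro v hv
  obtain ⟨h1, h2⟩ := hA.2 v hv
  rcases v with _ | ⟨b, v⟩
  · simp at h2
  · obtain rfl : b = true := by simpa using h2
    rw [mem_addTerm (by simpa using h1)]
    exact .inl hv

/-- Processing a term preserves the invariant of a row. The bounds on the affine space that is
inserted are needed for the time. -/
theorem rowStep_aux {ts : List (Bool × Bool)} {tp : Tape} {K : ℕ} (h : tp.Valid ts.length)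
    {A : List (List Bool)} (hA : IsPoints ts.length A) {row : Row} (hrow : row.Inv tp K A) :
    (rowStep ts row).Inv tp K (addTerm ts A) ∧ IsSpace (ts.length + 1) (climb ts.length row.right
        (row.clean ts) (applyTape ts.length row.left (termSpace ts))).2 ∧
      (climb ts.length row.right (row.clean ts)
        (applyTape ts.length row.left (termSpace ts))).2.1.length ≤ ts.length ∧
      (solsFrom (climb ts.length row.right (row.clean ts)
        (applyTape ts.length row.left (termSpace ts))).2.1 (climb ts.length row.right (row.clean ts)
        (applyTape ts.length row.left (termSpace ts))).2.2).length ≤ K := by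
  obtain ⟨j, hj, hl, hr, hK, hp, hmin⟩ := hrow
  rw [h.1] at hj
  obtain ⟨a1, a2, a3⟩ := h.applyTape j hj (termSpace ts) (isSpace_termSpace ts)
  have hd : (termSpace ts).1.length ≤ ts.length := by
    simpa [termSpace] using length_termGens_le ts
  have := climb_inv h K (A.filter fun v => !satTerm ts v.tail) (space (termSpace ts))
    (row.clean ts) (applyTape ts.length (tp.left j) (termSpace ts)) a1 j hj hl hr
    ((length_clean ts row).trans hK) ?_ a3 ?_ (h.canClimb j hj _ (isSpace_termSpace ts))
  · rw [rowStep, hl, hr]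
    exact ⟨this.1, this.2.1, this.2.2.1.trans (a2.trans hd), this.2.2.2⟩
  · simp only [Row.clean]
    have := hp.filter fun v => !satTerm ts v.tail
    rw [List.filter_filter] at this ⊢
    simpa only [Bool.and_comm] using this
  · intro i hi
    refine (hmin i hi).trans_le ?_
    refine ((hA.1.filter _).subperm ?_).length_le
    intro v hv
    rw [List.mem_filter] at hv ⊢
    exact ⟨subset_addTerm hA hv.1, hv.2⟩

/-- The number of steps that suffice to process a term for one row. -/
def rowTime (n K : ℕ) : ℕ :=
  8 * n + 15 + (5 * n ^ 2 + 14 * n + 7) + (68 * (n + 1) ^ 2 * (n + 1) + 2) +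
    ((11 * (n + 1) + 9) * K + 2) + ((climbTime n K + 1) * (n + 2) + 2) +
    (((17 * (n + 1) + 6) * K + 5 * (n + 1) + 10) * n + (4 * (n + 1) + 3) * K + 4 * (n + 1) + 5)

theorem runs_rowProg {ts : List (Bool × Bool)} {tp : Tape} {K : ℕ} (h : tp.Valid ts.length)
    {A : List (List Bool)} (hA : IsPoints ts.length A) {row : Row} (hrow : row.Inv tp K A)
    (S : Store) (hT : S .T = ttext ts) (hX : S .X = []) (hY : S .Y = []) (hZ : S .Z = [])
    (hN : S .N = []) (hP : S .P = []) (hW : S .W = []) (hQ : S .Q = []) :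
    Runs rowProg (holds S row ([], [])) (holds S (rowStep ts row) ([], []))
      (rowTime ts.length K) := by
  obtain ⟨-, b1, b2, b3⟩ := rowStep_aux h hA hrow
  obtain ⟨j, hj, hl, hr, hK, hp, hmin⟩ := hrow
  rw [h.1] at hj
  obtain ⟨a1, a2, a3⟩ := h.applyTape j hj (termSpace ts) (isSpace_termSpace ts)
  have hd : (termSpace ts).1.length ≤ ts.length := by
    simpa [termSpace] using length_termGens_le ts
  have hvec : ∀ v ∈ row.pts, IsVec true (ts.length + 1) v := fun v hv =>
    hA.2 v (List.mem_of_mem_filter (hp.mem_iff.1 hv))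
  have hsat : ∀ v ∈ row.pts, scanBit termBit (ttext ts) (vtext v) false = !satTerm ts v.tail := by
    intro v hv
    obtain ⟨-, h2⟩ := hvec v hv
    rcases v with _ | ⟨b, v⟩
    · simp at h2
    · obtain rfl : b = true := by simpa using h2
      exact scanBit_ttext ts v
  have s1 := runs_initU ts (holds S row ([], [])) (by simp [holds, hT]) (by simp [holds, hX])
    (by simp [holds, hZ]) (by simp [holds])
  have s2 := runs_initV ts (update (holds S row ([], [])) .U (vsText (termSpace ts).2))
    (by simp [holds, hT]) (by simp [holds, hX]) (by simp [holds, hY]) (by simp [holds])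
  have e2 : update (update (holds S row ([], [])) .U (vsText (termSpace ts).2)) .V
      (vsText (termSpace ts).1) = holds S row (termSpace ts) := by
    funext k
    cases k <;> simp [holds]
  rw [e2] at s2
  have s3 := runs_applyTapeProg ts (tp.bs.map .base) (by simp [h.1])
    (by rcases tp.bs with _ | ⟨b, bs⟩ <;> simp [Sym.isEq]) (tp.eqs.take j).reverse
    (fun s hs => Tape.isEq_of_mem_eqs (List.mem_of_mem_take (List.mem_reverse.1 hs)))
    (holds S row (termSpace ts)) (by simp [holds, hT]) (termSpace ts) (isSpace_termSpace ts) hd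
    (by simp [holds]) (by simp [holds]) (by simp [holds, hl, Tape.left]) (by simp [holds, hX])
    (by simp [holds, hY]) (by simp [holds, hN]) (by simp [holds, hP]) (by simp [holds, hW])
  have e3 : holds S row (termSpace ts) .L = row.left := by simp [holds]
  rw [e3] at s3
  generalize hsp : applyTape ts.length row.left (termSpace ts) = sp at *
  rw [← hl, hsp] at a1 a2
  have s4 := runs_filterProg .T termBit false (by decide) (ts.length + 1) (ttext ts) (by simp)
    (by simp) row.pts (holds S row sp) (by simp [holds, hT]) (by simp [holds])
    (fun v hv => (hvec v hv).1) (by simp [holds, hX]) (by simp [holds, hY])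
  have e4 : update (update (holds S row sp) .B (vsText (row.pts.filter fun v =>
      scanBit termBit (ttext ts) (vtext v) false != false))) .C (unary (row.pts.countP fun v =>
      scanBit termBit (ttext ts) (vtext v) false == false) ++ holds S row sp .C) =
      holds S (row.clean ts) sp := by
    have e5 : (row.pts.filter fun v => scanBit termBit (ttext ts) (vtext v) false != false) =
        row.pts.filter fun v => !satTerm ts v.tail :=
      List.filter_congr fun v hv => by rw [hsat v hv]; simp
    have e6 : (row.pts.countP fun v => scanBit termBit (ttext ts) (vtext v) false == false) =
        row.pts.countP fun v => satTerm ts v.tail :=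
      List.countP_congr fun v hv => by rw [hsat v hv]; simp
    rw [e5, e6]
    funext k
    cases k <;> simp [holds, Row.clean, add_comm]
  rw [e4] at s4
  have hcl := (length_clean ts row).trans hK
  have s5 := runs_climbProg ts K S hT hX hY hN hP hW hQ (row.clean ts) sp a1 (a2.trans hd)
    (fun v hv => (hvec v (List.mem_of_mem_filter hv)).1)
    (by rw [show (row.clean ts).left = row.left from rfl, hl]; exact h.length_left j) hcl.le
    (by
      rw [show (row.clean ts).right = row.right from rfl, hr, ← hsp, hl]
      exact h.canClimb j hj _ (isSpace_termSpace ts))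
  rw [show (row.clean ts).right = row.right from rfl] at s5
  have s6 := runs_insertProg (ts.length + 1) K (by omega) _ b1 b3 S hX hY hZ hP hW
    (row := (climb ts.length row.right (row.clean ts) sp).1)
  refine (s1.seq (s2.seq ((s3.of_eq ?_ le_rfl).seq (s4.seq (s5.seq s6))))).of_eq ?_ ?_
  · funext k
    cases k <;> simp [holds]
  · rw [rowStep, hsp]
  · have t1 : ((tp.eqs.take j).reverse).length ≤ ts.length + 1 := by
      simp [h.length_eqs]
    have t2 : row.right.length ≤ ts.length + 1 := by rw [hr]; exact h.length_right j
    have t3 : row.pts.length ≤ K := by omega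
    have t4 := Nat.mul_le_mul_left (68 * (ts.length + 1) ^ 2) t1
    have t5 := Nat.mul_le_mul_left (climbTime ts.length K + 1) (Nat.add_le_add_right t2 1)
    have t6 := Nat.mul_le_mul_left (11 * (ts.length + 1) + 9) t3
    have t7 := Nat.mul_le_mul_left ((17 * (ts.length + 1) + 6) * K + 5 * (ts.length + 1) + 10) b2
    simp only [rowTime]
    linarith

theorem rowTime_le (n K : ℕ) : rowTime n K ≤ 500 * (n + 1) ^ 3 * (K + 1) := by
  simp only [rowTime, climbTime]
  ring_nf
  nlinarith [Nat.zero_le (n ^ 3 * K), Nat.zero_le (n ^ 2 * K), Nat.zero_le (n * K),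
    Nat.zero_le (n ^ 3)]

/-! ### The memory -/

/-- The bits that stand for a symbol in the memory. -/
def enc : Sym → List Bool
  | .bit b => [false, false, false, b]
  | .hd h => [false, false, true, h]
  | .con a b => [false, true, a, b]
  | .base b => [true, false, false, b]
  | .fls => [true, false, true, false]
  | .mark => [true, false, true, true]
  | .sep => [true, true, false, false]

/-- The symbol that four bits of the memory stand for. -/
def dec : Bool → Bool → Bool → Bool → Sym
  | false, false, false, b => .bit b
  | false, false, true, h => .hd h
  | false, true, a, b => .con a b
  | true, false, false, b => .base b
  | true, false, true, false => .fls
  | true, false, true, true => .mark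
  | true, true, _, _ => .sep

/-- A row, as it is written in the memory. -/
def rowText (row : Row) : List Sym :=
  row.left ++ .sep :: (row.right ++ .sep :: (unary row.free ++ .sep :: (vsText row.pts ++ [.sep])))

/-- A list of rows. -/
def memText (rows : List Row) : List Sym := rows.flatMap rowText

@[simp] theorem memText_nil : memText [] = [] := rfl

@[simp] theorem memText_cons (row : Row) (rows : List Row) :
    memText (row :: rows) = rowText row ++ memText rows := by simp [memText]

/-- Whether a symbol is not a separator. -/
def Sym.notSep : Sym → Bool
  | .sep => false
  | _ => true

/-- The work stacks outside the processing of a row. -/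
def idle (A F I D T : List Sym) : Store := fun k => match k with
  | .A => A
  | .F => F
  | .I => I
  | .D => D
  | .T => T
  | _ => []

/-- Reads the memory from `A`, where its end is on top, and writes its symbols on `I`. -/
def decodeProg : Prog :=
  .each .A (fun _ => true) fun d => .pop .A fun c => .pop .A fun b => .pop .A fun a =>
    .push .I (dec (a.getD .sep).coef (b.getD .sep).coef (c.getD .sep).coef d.coef)

theorem runs_decodeProg (w : List Sym) (F I D T : List Sym) :
    Runs decodeProg (idle ((w.flatMap enc).map .base).reverse F I D T) (idle [] F (w ++ I) D T)
      (5 * w.length + 1) := by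
  induction w using List.reverseRecOn generalizing I with
  | nil => exact (Runs.each_stop (by simp [idle])).mono (by simp)
  | append_singleton w s ih =>
    obtain ⟨a, b, c, d, h1, h2⟩ : ∃ a b c d, enc s = [a, b, c, d] ∧ dec a b c d = s := by
      cases s <;> exact ⟨_, _, _, _, rfl, by simp [dec]⟩
    have e : ((((w ++ [s]).flatMap enc).map Sym.base).reverse) =
        .base d :: .base c :: .base b :: .base a :: ((w.flatMap enc).map Sym.base).reverse := by
      simp [h1]
    rw [e]
    have h3 : Runs (.pop .A fun c => .pop .A fun b => .pop .A fun a =>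
        .push .I (dec (a.getD .sep).coef (b.getD .sep).coef (c.getD .sep).coef d))
        (idle (.base c :: .base b :: .base a :: ((w.flatMap enc).map Sym.base).reverse) F I D T)
        (idle ((w.flatMap enc).map .base).reverse F (s :: I) D T) 4 := by
      refine (Runs.pop_some (s := .base c)
        (l := .base b :: .base a :: ((w.flatMap enc).map Sym.base).reverse) rfl
        (Runs.pop_some (s := .base b) (l := .base a :: ((w.flatMap enc).map Sym.base).reverse)
        (by simp) (Runs.pop_some (s := .base a) (l := ((w.flatMap enc).map Sym.base).reverse)
        (by simp) (Runs.push _ _ _)))).of_eq ?_ le_rfl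
      funext k
      cases k <;> simp [idle, Sym.coef, h2]
    have e2 : update (idle (.base d :: .base c :: .base b :: .base a ::
        ((w.flatMap enc).map Sym.base).reverse) F I D T) .A
        (.base c :: .base b :: .base a :: ((w.flatMap enc).map Sym.base).reverse) =
        idle (.base c :: .base b :: .base a :: ((w.flatMap enc).map Sym.base).reverse) F I D T := by
      funext k
      cases k <;> simp [idle]
    refine (Runs.each_step (s := .base d) (l := .base c :: .base b :: .base a ::
      ((w.flatMap enc).map Sym.base).reverse) rfl rfl (e2 ▸ h3) (ih (s :: I))).of_eq ?_ ?_
    · simp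
    · simp; omega

/-- Moves the symbols of `I` up to the next separator to `k`. -/
def loadField (k : Reg) : Prog :=
  mvWhile Sym.notSep .I .X ;; (.pop .I fun _ => .skip) ;; mv .X k

/-- Appends the content of `k` and a separator to the text on `D`. -/
def storeField (k : Reg) : Prog := mv k .D ;; .push .D .sep

theorem runs_loadField (k : Reg) (hk : k ≠ .I) (hk2 : k ≠ .X) (S : Store) (l r : List Sym)
    (hl : ∀ s ∈ l, s.notSep = true) (hI : S .I = l ++ .sep :: r) (hX : S .X = [])
    (hS : S k = []) :
    Runs (loadField k) S (update (update S .I r) k l) (4 * l.length + 3) := by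
  refine ((runs_mvWhile Sym.notSep .I .X (by simp) S l (.sep :: r) hI hl rfl).seq
    ((Runs.pop_some (s := .sep) (l := r) (by simp) Runs.skip).seq
    (runs_mv .X k (Ne.symm hk2) _))).of_eq ?_ ?_
  · funext j
    simp only [update_apply]
    split_ifs <;> simp_all
  · simp [hX]; omega

theorem runs_storeField (k : Reg) (hk : k ≠ .D) (S : Store) :
    Runs (storeField k) S (update (update S k []) .D (.sep :: ((S k).reverse ++ S .D)))
      (2 * (S k).length + 2) := by
  refine ((runs_mv k .D hk _).seq (Runs.push _ _ _)).of_eq ?_ ?_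
  · simp
  · omega

/-- Loads a row from `I`. -/
def loadRow : Prog := loadField .L ;; loadField .R ;; loadField .C ;; loadField .B

/-- Appends a row to the text on `D`. -/
def storeRow : Prog := storeField .L ;; storeField .R ;; storeField .C ;; storeField .B

theorem notSep_vsText (vs : List (List Bool)) : ∀ s ∈ vsText vs, s.notSep = true := by
  intro s hs
  obtain ⟨v, -, hs⟩ := List.mem_flatMap.1 hs
  rcases v with _ | ⟨b, v⟩
  · simp [vtext] at hs
  · rcases List.mem_cons.1 hs with rfl | hs
    · rfl
    · obtain ⟨c, -, rfl⟩ := List.mem_map.1 hs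
      rfl

/-- The tape of a row contains no separators. -/
def Row.Clean (row : Row) : Prop :=
  (∀ s ∈ row.left, s.notSep = true) ∧ ∀ s ∈ row.right, s.notSep = true

theorem runs_loadRow (row : Row) (h : row.Clean) (A F r D T : List Sym) :
    Runs loadRow (idle A F (rowText row ++ r) D T) (holds (idle A F r D T) row ([], []))
      (4 * (rowText row).length + 12) := by
  refine ((runs_loadField .L (by simp) (by simp) _ row.left _ h.1 (by simp [idle, rowText]; rfl)
    rfl rfl).seq ((runs_loadField .R (by simp) (by simp) _ row.right _ h.2 (by simp; rfl)
    (by simp [idle]) (by simp [idle])).seq ((runs_loadField .C (by simp) (by simp) _ (unary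
    row.free)
    _ ?_ (by simp; rfl) (by simp [idle]) (by simp [idle])).seq (runs_loadField .B (by simp) (by
    simp)
    _ (vsText row.pts) r (notSep_vsText _) (by simp) (by simp [idle]) (by simp
    [idle]))))).of_eq ?_ ?_
  · intro s hs
    rw [List.eq_of_mem_replicate hs]
    rfl
  · funext k
    cases k <;> simp [holds, idle]
  · simp [rowText]
    omega

theorem runs_storeRow (row : Row) (A F I D T : List Sym) :
    Runs storeRow (holds (idle A F I D T) row ([], []))
      (idle A F I ((rowText row).reverse ++ D) T) (2 * (rowText row).length + 8) := by
  refine ((runs_storeField .L (by simp) _).seq ((runs_storeField .R (by simp) _).seq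
    ((runs_storeField .C (by simp) _).seq (runs_storeField .B (by simp) _)))).of_eq ?_ ?_
  · funext k
    cases k <;> simp [holds, idle, rowText]
  · simp [holds, idle, rowText]
    omega

theorem Row.Inv.clean {tp : Tape} {K : ℕ} {A : List (List Bool)} {row : Row}
    (h : row.Inv tp K A) : row.Clean := by
  obtain ⟨j, -, hl, hr, -⟩ := h
  have he : ∀ s ∈ tp.eqs, s.notSep = true := by
    intro s hs
    have := Tape.isEq_of_mem_eqs hs
    cases s <;> simp_all [Sym.isEq, Sym.notSep]
  constructor
  · intro s hs
    rw [hl, Tape.left, List.mem_append, List.mem_reverse] at hs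
    rcases hs with hs | hs
    · exact he s (List.mem_of_mem_take hs)
    · obtain ⟨b, -, rfl⟩ := List.mem_map.1 hs
      rfl
  · intro s hs
    rw [hr] at hs
    exact he s (List.mem_of_mem_drop hs)

/-- The space that a row takes. -/
def rowSize (n K : ℕ) : ℕ := 2 * n + 5 + (n + 1) * K

theorem Row.Inv.length_rowText {tp : Tape} {n K : ℕ} {A : List (List Bool)} {row : Row}
    (h : row.Inv tp K A) (htp : tp.Valid n) (hA : IsPoints n A) :
    (rowText row).length ≤ rowSize n K := by
  obtain ⟨j, hj, hl, hr, hK, hp, -⟩ := h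
  rw [htp.1] at hj
  have h1 : (vsText row.pts).length = (n + 1) * row.pts.length :=
    length_vsText fun v hv => (hA.2 v (List.mem_of_mem_filter (hp.mem_iff.1 hv))).1
  have h2 : row.left.length + row.right.length = 2 * n + 1 := by
    rw [hl, hr, Tape.left, Tape.right]
    simp [htp.length_eqs, htp.1]
    omega
  have h3 : (n + 1) * K = (n + 1) * row.free + (n + 1) * row.pts.length := by
    rw [← hK, Nat.mul_add]
  have h4 : row.free ≤ (n + 1) * row.free := Nat.le_mul_of_pos_left _ (by omega)
  simp [rowText, rowSize, h1]
  omega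

/-! ### Processing an item -/

/-- Processes the term on `T` for all rows. -/
def termProg : Prog :=
  .each .I (fun _ => true) (fun s => .push .I s ;; loadRow ;; rowProg ;; storeRow) ;; mv .D .I ;;
    clear .T

/-- The rows of the memory belong to the tapes `tps` and the points `A`. -/
def MemInv (n K : ℕ) (tps : List Tape) (A : List (List Bool)) (rows : List Row) : Prop :=
  List.Forall₂ (fun tp row => tp.Valid n ∧ row.Inv tp K A) tps rows

theorem MemInv.map {ts : List (Bool × Bool)} {K : ℕ} {tps : List Tape} {A : List (List Bool)}
    {rows : List Row} (h : MemInv ts.length K tps A rows) (hA : IsPoints ts.length A) :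
    MemInv ts.length K tps (addTerm ts A) (rows.map (rowStep ts)) := by
  induction h with
  | nil => exact .nil
  | cons h _ ih => exact .cons ⟨h.1, (rowStep_aux h.1 hA h.2).1⟩ ih

theorem MemInv.length_memText {n K : ℕ} {tps : List Tape} {A : List (List Bool)}
    {rows : List Row} (h : MemInv n K tps A rows) (hA : IsPoints n A) :
    (memText rows).length ≤ tps.length * rowSize n K := by
  induction h with
  | nil => simp
  | cons h _ ih =>
    have := h.2.length_rowText h.1 hA
    rw [memText_cons, List.length_append, List.length_cons, Nat.add_one_mul]
    omega

theorem runs_term_loop {ts : List (Bool × Bool)} {K : ℕ} {tps : List Tape} {A : List (List Bool)}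
    {rows : List Row} (h : MemInv ts.length K tps A rows) (hA : IsPoints ts.length A)
    (A' F D : List Sym) :
    Runs (.each .I (fun _ => true) (fun s => .push .I s ;; loadRow ;; rowProg ;; storeRow))
      (idle A' F (memText rows) D (ttext ts))
      (idle A' F [] ((memText (rows.map (rowStep ts))).reverse ++ D) (ttext ts))
      ((rowTime ts.length K + 6 * rowSize ts.length K + 22) * tps.length + 1) := by
  induction h generalizing D with
  | nil => exact (Runs.each_stop (by simp [idle])).mono (by simp)
  | @cons tp row tps rows h _ ih =>
    have hne : rowText row ≠ [] := by simp [rowText]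
    obtain ⟨s, l, hs⟩ := List.exists_cons_of_ne_nil hne
    have h1 := runs_loadRow row h.2.clean A' F (memText rows) D (ttext ts)
    have h2 := runs_rowProg h.1 hA h.2 (idle A' F (memText rows) D (ttext ts)) rfl rfl rfl rfl rfl
      rfl rfl rfl
    have h3 := runs_storeRow (rowStep ts row) A' F (memText rows) D (ttext ts)
    have h4 := h.2.length_rowText h.1 hA
    have h5 := (rowStep_aux h.1 hA h.2).1.length_rowText h.1 hA.addTerm
    refine (Runs.each_peek (s := s) (l := l ++ memText rows) (by simp [idle, hs]) rfl
      (h1.seq (h2.seq h3)) (ih _)).of_eq ?_ ?_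
    · simp
    · rw [List.length_cons, Nat.mul_add_one]
      omega

theorem runs_termProg {ts : List (Bool × Bool)} {K : ℕ} {tps : List Tape} {A : List (List Bool)}
    {rows : List Row} (h : MemInv ts.length K tps A rows) (hA : IsPoints ts.length A)
    (A' F : List Sym) :
    Runs termProg (idle A' F (memText rows) [] (ttext ts))
      (idle A' F (memText (rows.map (rowStep ts))) [] [])
      ((rowTime ts.length K + 8 * rowSize ts.length K + 22) * tps.length + ts.length + 4) := by
  have h1 := (h.map hA).length_memText hA.addTerm
  refine ((runs_term_loop h hA A' F []).seq ((runs_mv .D .I (by simp) _).seq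
    (runs_clear .T _))).of_eq ?_ ?_
  · funext k
    cases k <;> simp [idle]
  · simp [idle]
    rw [Nat.mul_comm tps.length] at h1
    ring_nf at h1 ⊢
    omega

/-- A symbol of a formula as it is read from the input, the last symbol first. -/
def readStep : Sym → Prog
  | .bit q => .pop .A fun o => .push .F (.con (o.getD .sep).toBit q)
  | s => .push .F s

/-- Whether a symbol is not a bit of the memory. -/
def Sym.notBase : Sym → Bool
  | .base _ => false
  | _ => true

/-- Processes an item: reads the formula and the memory, processes the terms one after the other and
writes the memory. -/
def updateProg : Prog :=
  .each .A Sym.notBase readStep ;; decodeProg ;;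
  .each .F (fun _ => true) (fun s => mvWhile Sym.isEq .F .X ;; mv .X .T ;; .push .T s ;;
    termProg) ;; mv .I .D

/-- A formula as it is read from the input. -/
def inputText (tss : List (List (Bool × Bool))) : List Sym :=
  tss.flatMap fun ts => .sep :: ts.flatMap fun l => [.bit l.1, .bit l.2]

theorem runs_read_pairs (ts : List (Bool × Bool)) (r F I D T : List Sym) (S' : Store) (t : ℕ)
    (h : Runs (.each .A Sym.notBase readStep)
      (idle r (ts.map (fun l => .con l.1 l.2) ++ F) I D T) S' t) :
    Runs (.each .A Sym.notBase readStep)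
      (idle ((ts.flatMap fun l => [Sym.bit l.1, .bit l.2]).reverse ++ r) F I D T) S'
      (3 * ts.length + t) := by
  induction ts using List.reverseRecOn generalizing F with
  | nil => simpa using h
  | append_singleton ts l ih =>
    have e : ((ts ++ [l]).flatMap fun l => [Sym.bit l.1, .bit l.2]).reverse ++ r =
        .bit l.2 :: .bit l.1 :: ((ts.flatMap fun l => [Sym.bit l.1, .bit l.2]).reverse ++ r) := by
      simp
    rw [e]
    have h1 : Runs (readStep (.bit l.2)) (update (idle (.bit l.2 :: .bit l.1 ::
        ((ts.flatMap fun l => [Sym.bit l.1, .bit l.2]).reverse ++ r)) F I D T) .A (.bit l.1 ::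
        ((ts.flatMap fun l => [Sym.bit l.1, .bit l.2]).reverse ++ r)))
        (idle ((ts.flatMap fun l => [Sym.bit l.1, .bit l.2]).reverse ++ r)
          (.con l.1 l.2 :: F) I D T) 2 := by
      refine (Runs.pop_some (s := .bit l.1)
        (l := (ts.flatMap fun l => [Sym.bit l.1, .bit l.2]).reverse ++ r)
        (by simp) (Runs.push _ _ _)).of_eq ?_ le_rfl
      funext k
      cases k <;> simp [idle, Sym.toBit]
    refine (Runs.each_step (s := .bit l.2) rfl rfl h1 (ih _ (by simpa using h))).mono ?_
    simp
    omega

theorem runs_read (tss : List (List (Bool × Bool))) (n : ℕ) (hn : ∀ ts ∈ tss, ts.length = n)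
    (r F I D T : List Sym) (hr : r.head?.any Sym.notBase = false) :
    Runs (.each .A Sym.notBase readStep) (idle ((inputText tss).reverse ++ r) F I D T)
      (idle r (tss.flatMap ttext ++ F) I D T) ((3 * n + 2) * tss.length + 1) := by
  induction tss using List.reverseRecOn generalizing F with
  | nil => exact (Runs.each_stop hr).mono (by simp)
  | append_singleton tss ts ih =>
    have hts := hn ts (by simp)
    have e : (inputText (tss ++ [ts])).reverse ++ r =
        (ts.flatMap fun l => [Sym.bit l.1, .bit l.2]).reverse ++
          (.sep :: ((inputText tss).reverse ++ r)) := by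
      simp [inputText]
    rw [e]
    have h1 : Runs (readStep .sep) (update (idle (.sep :: ((inputText tss).reverse ++ r))
        (ts.map (fun l => .con l.1 l.2) ++ F) I D T) .A ((inputText tss).reverse ++ r))
        (idle ((inputText tss).reverse ++ r) (ttext ts ++ F) I D T) 1 := by
      refine (Runs.push _ _ _).of_eq ?_ le_rfl
      funext k
      cases k <;> simp [idle, ttext]
    refine (runs_read_pairs ts _ F I D T _ _ (Runs.each_step (s := .sep) rfl rfl h1
      (ih (fun ts h => hn ts (by simp [h])) _))).of_eq ?_ ?_
    · simp
    · simp only [List.length_append, List.length_singleton, hts]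
      ring_nf
      omega

/-- The rows after the terms of an item have been processed. -/
def procTerms (tss : List (List (Bool × Bool))) (rows : List Row) : List Row :=
  tss.foldl (fun rows ts => rows.map (rowStep ts)) rows

/-- The points after the terms of an item have been processed. -/
def addTerms (tss : List (List (Bool × Bool))) (A : List (List Bool)) : List (List Bool) :=
  tss.foldl (fun A ts => addTerm ts A) A

theorem MemInv.procTerms {n K : ℕ} {tps : List Tape} {A : List (List Bool)}
    {rows : List Row} (h : MemInv n K tps A rows) (hA : IsPoints n A)
    (tss : List (List (Bool × Bool))) (hn : ∀ ts ∈ tss, ts.length = n) :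
    MemInv n K tps (addTerms tss A) (procTerms tss rows) ∧ IsPoints n (addTerms tss A) := by
  induction tss generalizing A rows with
  | nil => exact ⟨h, hA⟩
  | cons ts tss ih =>
    obtain rfl := hn ts (by simp)
    exact ih (h.map hA) hA.addTerm fun ts h => hn ts (by simp [h])

/-- The number of steps that suffice to process a term. -/
def termTime (n K t : ℕ) : ℕ := (rowTime n K + 8 * rowSize n K + 22) * t + 5 * n + 10

theorem runs_terms {n K : ℕ} {tps : List Tape} {A : List (List Bool)}
    {rows : List Row} (h : MemInv n K tps A rows) (hA : IsPoints n A)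
    (tss : List (List (Bool × Bool))) (hn : ∀ ts ∈ tss, ts.length = n) (A' : List Sym) :
    Runs (.each .F (fun _ => true) (fun s => mvWhile Sym.isEq .F .X ;; mv .X .T ;; .push .T s ;;
      termProg)) (idle A' (tss.flatMap ttext) (memText rows) [] [])
      (idle A' [] (memText (procTerms tss rows)) [] []) (termTime n K tps.length * tss.length +
      1) := by
  induction tss generalizing A rows with
  | nil => exact (Runs.each_stop rfl).mono (by simp)
  | cons ts tss ih =>
    obtain rfl := hn ts (by simp)
    have hr : (tss.flatMap ttext).head?.any Sym.isEq = false := by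
      rcases tss with _ | ⟨ts', tss⟩ <;> simp [ttext, Sym.isEq]
    have h1 := runs_mvWhile Sym.isEq .F .X (by simp) (update (idle A' ((ts :: tss).flatMap ttext)
      (memText rows) [] []) .F (ts.map (fun l => .con l.1 l.2) ++ tss.flatMap ttext))
      (ts.map (fun l => .con l.1 l.2)) (tss.flatMap ttext) (by simp)
      (by intro s hs; obtain ⟨l, -, rfl⟩ := List.mem_map.1 hs; rfl) hr
    have h2 := runs_termProg h hA A' (tss.flatMap ttext)
    refine (Runs.each_step (s := .sep) (l := ts.map (fun l => .con l.1 l.2) ++ tss.flatMap ttext)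
      (by simp [idle, ttext]) rfl (h1.seq ((runs_mv .X .T (by simp) _).seq (Runs.push_seq
      (t := (rowTime ts.length K + 8 * rowSize ts.length K + 22) * tps.length + ts.length + 4) ?_)))
      (ih (h.map hA) hA.addTerm fun ts h => hn ts (by simp [h]))).of_eq rfl ?_
    · convert h2 using 1
      funext k
      cases k <;> simp [idle, ttext]
    · simp [idle, termTime]
      ring_nf
      omega

/-- The number of steps that suffice to process an item with `k` terms. -/
def itemTime (n K t k : ℕ) : ℕ :=
  (3 * n + 2) * k + 5 * (t * rowSize n K) + termTime n K t * k + 2 * (t * rowSize n K) + 4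

theorem runs_updateProg {n K : ℕ} {tps : List Tape} {A : List (List Bool)}
    {rows : List Row} (h : MemInv n K tps A rows) (hA : IsPoints n A)
    (tss : List (List (Bool × Bool))) (hn : ∀ ts ∈ tss, ts.length = n) :
    Runs updateProg (idle ((inputText tss).reverse ++ (((memText rows).flatMap enc).map
      .base).reverse) [] [] [] []) (update Store.nil .D (memText (procTerms tss rows)).reverse)
      (itemTime n K tps.length tss.length) := by
  obtain ⟨h1, hA1⟩ := h.procTerms hA tss hn
  have h2 := h.length_memText hA
  have h3 := h1.length_memText hA1
  have hr : ((((memText rows).flatMap enc).map Sym.base).reverse).head?.any Sym.notBase =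
      false := by
    rw [List.head?_reverse, List.getLast?_map]
    cases ((memText rows).flatMap enc).getLast? <;> rfl
  have s1 := runs_read tss n hn _ [] [] [] [] hr
  have s2 := runs_decodeProg (memText rows) (tss.flatMap ttext ++ []) [] [] []
  rw [List.append_nil, List.append_nil] at s2
  rw [List.append_nil] at s1
  refine (s1.seq (s2.seq ((runs_terms h hA tss hn []).seq (runs_mv .I .D (by simp) _)))).of_eq ?_ ?_
  · funext k
    cases k <;> simp [idle]
  · simp [idle, itemTime]
    omega

/-- The Turing machine that processes an item. -/
noncomputable def updateMachine : Machine (Bool ⊕ Option Bool) Bool :=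
  machine (fun a => match a with
    | .inl b => .base b
    | .inr (some b) => .bit b
    | .inr none => .sep) enc updateProg

/-- A term, given by a pair of bits for each variable. -/
def termPairs {n : ℕ} (T : Term n) : List (Bool × Bool) :=
  (List.finRange n).map fun i => (decide ((i, true) ∈ T), decide ((i, false) ∈ T))

@[simp] theorem length_termPairs {n : ℕ} (T : Term n) : (termPairs T).length = n := by
  simp [termPairs]

/-- The memory with the given rows. -/
def memory (rows : List Row) : List Bool := (memText rows).flatMap enc

theorem length_enc (s : Sym) : (enc s).length = 4 := by cases s <;> rfl

theorem length_memory (rows : List Row) : (memory rows).length = 4 * (memText rows).length := by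
  simp [memory, List.length_flatMap, length_enc, mul_comm]

theorem update_outputsWithin {n K : ℕ} {tps : List Tape} {A : List (List Bool)}
    {rows : List Row} (h : MemInv n K tps A rows) (hA : IsPoints n A) (φ : DNF n) :
    updateMachine.OutputsWithin ((memory rows).map .inl ++ (encodeDNF φ).map .inr)
      (memory (procTerms (φ.map termPairs) rows))
      (itemTime n K tps.length φ.length + 6 * (tps.length * rowSize n K) + (2 * n + 1) * φ.length
        + 2) := by
  have hn : ∀ ts ∈ φ.map termPairs, ts.length = n := by
    intro ts hts
    obtain ⟨T, -, rfl⟩ := List.mem_map.1 hts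
    exact length_termPairs T
  obtain ⟨h1, hA1⟩ := h.procTerms hA _ hn
  have h2 := h.length_memText hA
  have h3 := h1.length_memText hA1
  obtain ⟨t, ht, hrun⟩ := runs_updateProg h hA (φ.map termPairs) hn
  have e : ∀ x : List (Bool ⊕ Option Bool), x = (memory rows).map .inl ++ (encodeDNF φ).map .inr →
      idle ((inputText (φ.map termPairs)).reverse ++ (((memText rows).flatMap enc).map
      .base).reverse) [] [] [] [] = update Store.nil .A (x.map fun a => match a with
    | .inl b => Sym.base b
    | .inr (some b) => .bit b
    | .inr none => .sep).reverse := by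
    rintro x rfl
    have e1 : ((encodeDNF φ).map Sum.inr).map (fun a : Bool ⊕ Option Bool => match a with
        | .inl b => Sym.base b
        | .inr (some b) => .bit b
        | .inr none => .sep) = inputText (φ.map termPairs) := by
      simp [encodeDNF, encodeTerm, inputText, termPairs, List.map_flatMap, List.flatMap_map]
    rw [List.map_append, e1, List.reverse_append]
    funext k
    cases k <;> simp [idle, memory]
  rw [e _ rfl] at hrun
  have := hrun.outputsWithin (g := enc)
  rw [List.reverse_reverse] at this
  refine this.mono ?_
  have e2 : (encodeDNF φ).length = (2 * n + 1) * φ.length := by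
    simp [encodeDNF, encodeTerm, List.length_flatMap, mul_comm]
  simp only [List.length_append, List.length_map, length_memory, e2, List.length_reverse] at ht ⊢
  omega

/-! ### Reading the parameters -/

/-- Started with the stacks `S`, the program `p` ends with the stacks `S'`. -/
def Does (p : Prog) (S S' : Store) : Prop := ∃ t, Run p S t S'

theorem Runs.does {p : Prog} {S S' : Store} {t : ℕ} (h : Runs p S S' t) : Does p S S' :=
  ⟨_, h.choose_spec.2⟩

namespace Does

variable {p q : Prog} {S S' S'' : Store} {k : Reg}

theorem of_eq (h : Does p S S') (hS : S' = S'') : Does p S S'' := hS ▸ h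

theorem skip : Does .skip S S := Runs.skip.does

theorem push (k : Reg) (s : Sym) (S : Store) : Does (.push k s) S (update S k (s :: S k)) :=
  (Runs.push k s S).does

theorem pop_some {f : Option Sym → Prog} {s : Sym} {l : List Sym} (hk : S k = s :: l)
    (h : Does (f (some s)) (update S k l) S') : Does (.pop k f) S S' := by
  obtain ⟨u, h⟩ := h
  exact (Runs.pop_some hk ⟨u, le_rfl, h⟩).does

theorem pop_none {f : Option Sym → Prog} (hk : S k = [])
    (h : Does (f none) S S') : Does (.pop k f) S S' := by
  obtain ⟨u, h⟩ := h
  exact (Runs.pop_none hk ⟨u, le_rfl, h⟩).does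

theorem seq (h : Does p S S') (h' : Does q S' S'') : Does (p ;; q) S S'' := by
  obtain ⟨u, h⟩ := h
  obtain ⟨u', h'⟩ := h'
  exact ⟨_, .seq h h'⟩

theorem push_seq {s : Sym} (h : Does q (update S k (s :: S k)) S') :
    Does (.push k s ;; q) S S' := (push k s S).seq h

theorem each_stop {c : Sym → Bool} {f : Sym → Prog} (h : (S k).head?.any c = false) :
    Does (.each k c f) S S := (Runs.each_stop h).does

theorem each_step {c : Sym → Bool} {f : Sym → Prog} {s : Sym} {l : List Sym} (hk : S k = s :: l)
    (hc : c s = true) (h : Does (f s) (update S k l) S') (h' : Does (.each k c f) S' S'') :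
    Does (.each k c f) S S'' := by
  obtain ⟨u, h⟩ := h
  obtain ⟨u', h'⟩ := h'
  exact ⟨_, .step hk hc h h'⟩

theorem each_peek {c : Sym → Bool} {f : Sym → Prog} {s : Sym} {l : List Sym}
    (hk : S k = s :: l) (hc : c s = true) (h : Does (f s) S S')
    (h' : Does (.each k c fun s => .push k s ;; f s) S' S'') :
    Does (.each k c fun s => .push k s ;; f s) S S'' := by
  obtain ⟨u, h⟩ := h
  obtain ⟨u', h'⟩ := h'
  exact (Runs.each_peek hk hc ⟨u, le_rfl, h⟩ ⟨u', le_rfl, h'⟩).does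

theorem peek {f : Option Sym → Prog} (h : Does (f (S k).head?) S S') :
    Does (DNFStream.peek k f) S S' := by
  obtain ⟨u, h⟩ := h
  exact (runs_peek ⟨u, le_rfl, h⟩).does

end Does

theorem unary_succ (c : ℕ) : unary (c + 1) = .mark :: unary c := List.replicate_succ

/-- Doubles the unary number on `k`. -/
def dbl (k y : Reg) : Prog :=
  mv k y ;; .each y (fun _ => true) fun _ => .push k .mark ;; .push k .mark

theorem does_dbl (k y : Reg) (hky : k ≠ y) (c : ℕ) (S : Store) (hk : S k = unary c)
    (hy : S y = []) : Does (dbl k y) S (update S k (unary (2 * c))) := by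
  have key : ∀ (c d : ℕ) (S : Store), S y = unary c → S k = unary d →
      Does (.each y (fun _ => true) fun _ => .push k .mark ;; .push k .mark) S
        (update (update S y []) k (unary (d + 2 * c))) := by
    intro c
    induction c with
    | zero =>
      intro d S hy hk
      refine (Does.each_stop (by simp [hy])).of_eq ?_
      funext j
      simp only [update_apply]
      split_ifs <;> simp_all
    | succ c ih =>
      intro d S hy hk
      refine (Does.each_step (by rw [hy, unary_succ]) rfl (Does.push_seq (Does.push _ _ _))
        (ih (d + 2) _ ?_ ?_)).of_eq ?_
      · simp [Ne.symm hky]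
      · simp [hky, hk, unary_succ]
      · rw [show d + 2 + 2 * c = d + 2 * (c + 1) by ring]
        clear ih
        funext j
        simp only [update_apply]
        split_ifs <;> simp_all
  refine ((runs_mv k y hky S).does.seq (key c 0 _ ?_ ?_)).of_eq ?_
  · simp [hk, hy]
  · simp [hky]
  · clear key
    funext j
    simp only [update_apply]
    split_ifs <;> simp_all

/-- Reads a binary number from `A`, most significant digit first, and writes it in unary on `k`. -/
def parseNum (k : Reg) : Prog :=
  (.pop .A fun _ => .skip) ;; .each .A Sym.isBit fun s => dbl k .Y ;; match s with
    | .bit true => .push k .mark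
    | _ => .skip

theorem does_parse_loop (k : Reg) (hk : k ≠ .A) (hk2 : k ≠ .Y) (l : List Bool) (r : List Sym)
    (hr : r.head?.any Sym.isBit = false) (d : ℕ) (S : Store) (hA : S .A = l.map .bit ++ r)
    (hS : S k = unary d) (hY : S .Y = []) :
    Does (.each .A Sym.isBit fun s => dbl k .Y ;; match s with
      | .bit true => .push k .mark
      | _ => .skip) S (update (update S .A r) k
        (unary (l.foldl (fun d b => 2 * d + b.toNat) d))) := by
  induction l generalizing d S with
  | nil =>
    refine (Does.each_stop (by rw [hA]; exact hr)).of_eq ?_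
    rw [List.map_nil, List.nil_append] at hA
    simp [← hA, ← hS]
  | cons b l ih =>
    have h1 := does_dbl k .Y hk2 d (update S .A (l.map .bit ++ r)) (by simp [hk, hS]) (by simp [hY])
    have h2 : Does (match Sym.bit b with
      | .bit true => .push k .mark
      | _ => .skip) (update (update S .A (l.map .bit ++ r)) k (unary (2 * d)))
        (update (update S .A (l.map .bit ++ r)) k (unary (2 * d + b.toNat))) := by
      cases b
      · exact Does.skip
      · exact (Does.push _ _ _).of_eq (by simp [unary_succ])
    refine (Does.each_step hA rfl (h1.seq h2) (ih (2 * d + b.toNat) _ ?_ ?_ ?_)).of_eq ?_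
    · simp [Ne.symm hk]
    · simp
    · simp [Ne.symm hk2, hY]
    · clear ih h1 h2
      funext j
      simp only [update_apply]
      split_ifs <;> simp_all

theorem foldl_bits (a : ℕ) :
    a.bits.reverse.foldl (fun d b => 2 * d + b.toNat) 0 = a := by
  rw [List.foldl_reverse]
  induction a using Nat.binaryRec' with
  | zero => simp
  | bit b n h ih =>
    rw [Nat.bits_append_bit n b h, List.foldr_cons, ih, Nat.bit_val]

/-- Numbers in binary, most significant digit first. -/
def numText : List ℕ → List Sym
  | [] => []
  | a :: l => .sep :: (a.bits.reverse.map .bit ++ numText l)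

theorem head?_numText (l : List ℕ) : (numText l).head?.any Sym.isBit = false := by
  cases l <;> rfl

theorem does_parseNum (k : Reg) (hk : k ≠ .A) (hk2 : k ≠ .Y) (a : ℕ) (l : List ℕ) (S : Store)
    (hA : S .A = numText (a :: l)) (hS : S k = []) (hY : S .Y = []) :
    Does (parseNum k) S (update (update S .A (numText l)) k (unary a)) := by
  refine ((Does.pop_some hA Does.skip).seq (does_parse_loop k hk hk2 a.bits.reverse _
    (head?_numText l) 0 _
    ?_ ?_ ?_)).of_eq ?_
  · simp
  · simp [hk, hS]
  · simp [hY]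
  · rw [foldl_bits]
    funext j
    simp only [update_apply]
    split_ifs <;> simp_all

/-- Divides the unary number on `P` by the one on `Q`; the quotient is written on `X`. -/
def divProg : Prog :=
  .each .P (fun _ => true) (fun s => (.pop .Q fun _ => .skip) ;; .push .N s ;;
    peek .Q fun o => match o with
      | none => .push .X .mark ;; mv .N .Q
      | some _ => .skip) ;;
  clear .Q ;; clear .N

theorem does_div_loop (q : ℕ) (hq : 0 < q) (p a : ℕ) (S : Store) (hP : S .P = unary p)
    (hQ : S .Q = unary (q - a % q)) (hN : S .N = unary (a % q)) (hX : S .X = unary (a / q)) :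
    Does (.each .P (fun _ => true) (fun s => (.pop .Q fun _ => .skip) ;; .push .N s ;;
      peek .Q fun o => match o with
        | none => .push .X .mark ;; mv .N .Q
        | some _ => .skip)) S (update (update (update (update S .P []) .X (unary ((a + p) / q)))
        .Q (unary (q - (a + p) % q))) .N (unary ((a + p) % q))) := by
  induction p generalizing a S with
  | zero =>
    refine (Does.each_stop (by simp [hP])).of_eq ?_
    funext k
    cases k <;> simp_all
  | succ p ih =>
    have hlt := Nat.mod_lt a hq
    obtain ⟨d, hd⟩ : ∃ d, q - a % q = d + 1 := ⟨q - a % q - 1, by omega⟩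
    have h1 : Does (peek .Q fun o => match o with
        | none => .push .X .mark ;; mv .N .Q
        | some _ => .skip) (update (update (update S .P (unary p)) .Q (unary d))
          .N (unary (a % q + 1)))
        (update (update (update (update S .P (unary p)) .Q (unary (q - (a + 1) % q)))
          .N (unary ((a + 1) % q))) .X (unary ((a + 1) / q))) := by
      refine Does.peek ?_
      rcases d with _ | d
      · have e0 : a + 1 = q * (a / q + 1) := by
          have := Nat.div_add_mod a q
          rw [Nat.mul_add_one]
          omega
        have e1 : (a + 1) % q = 0 := by rw [e0, Nat.mul_mod_right]
        have e2 : (a + 1) / q = a / q + 1 := by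
          conv_lhs => rw [e0]
          exact Nat.mul_div_cancel_left _ hq
        have e3 : a % q + 1 = q := by omega
        rw [e1, e2, e3]
        refine (Does.push_seq (runs_mv .N .Q (by simp) _).does).of_eq ?_
        funext k
        cases k <;> simp [hX, unary_succ]
      · have e0 : a + 1 = (a % q + 1) + q * (a / q) := by
          have := Nat.div_add_mod a q
          omega
        have e1 : (a + 1) % q = a % q + 1 := by
          rw [e0, Nat.add_mul_mod_self_left, Nat.mod_eq_of_lt (by omega)]
        have e2 : (a + 1) / q = a / q := by
          conv_lhs => rw [e0]
          rw [Nat.add_mul_div_left _ _ hq, Nat.div_eq_of_lt (by omega), zero_add]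
        rw [e1, e2, show q - (a % q + 1) = d + 1 by omega]
        refine Does.skip.of_eq ?_
        funext k
        cases k <;> simp [hX]
    refine (Does.each_step (s := .mark) (l := unary p) (by rw [hP, unary_succ]) rfl
      ((Does.pop_some (s := .mark) (l := unary d) (by simp [hQ, hd, unary_succ]) Does.skip).seq
      (Does.push_seq (S' := update (update (update (update S .P (unary p))
        .Q (unary (q - (a + 1) % q))) .N (unary ((a + 1) % q))) .X (unary ((a + 1) / q))) ?_))
      (ih (a + 1) _ ?_ ?_ ?_ ?_)).of_eq ?_
    · convert h1 using 1
      funext k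
      cases k <;> simp [hN, unary_succ]
    · simp
    · simp
    · simp
    · simp
    · rw [show a + 1 + p = a + (p + 1) by ring]
      clear ih h1
      funext k
      cases k <;> simp

theorem does_divProg (p q : ℕ) (hq : 0 < q) (S : Store) (hP : S .P = unary p)
    (hQ : S .Q = unary q) (hN : S .N = []) (hX : S .X = []) :
    Does divProg S (update (update (update S .P []) .Q []) .X (unary (p / q))) := by
  refine ((does_div_loop q hq p 0 S hP (by simp [hQ]) (by simp [hN]) (by simp [hX])).seq
    ((runs_clear .Q _).does.seq (runs_clear .N _).does)).of_eq ?_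
  funext k
  cases k <;> simp [hN]

/-- Writes the number of binary digits of the number on `X` on `U`. -/
def sizeProg : Prog :=
  .each .X (fun _ => true) fun s => .push .X s ;; halve false ;; .push .U .mark

theorem does_sizeProg (c d : ℕ) (S : Store) (hX : S .X = unary c) (hU : S .U = unary d)
    (hY : S .Y = []) : Does sizeProg S (update (update S .X []) .U (unary (d + Nat.size c))) := by
  induction c using Nat.strong_induction_on generalizing d S with
  | _ c ih =>
    rcases Nat.eq_zero_or_pos c with rfl | hc
    · refine (Does.each_stop (by simp [hX])).of_eq ?_
      funext k
      cases k <;> simp_all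
    · obtain ⟨c', hc'⟩ := Nat.exists_eq_succ_of_ne_zero hc.ne'
      have e : Nat.size c = Nat.size (c / 2) + 1 := by
        conv_lhs => rw [← Nat.bit_bodd_div2 c]
        rw [Nat.size_bit (by rw [Nat.bit_bodd_div2]; omega), Nat.div2_val]
      refine (Does.each_peek (s := .mark) (l := unary c') (by rw [hX, hc', unary_succ]) rfl
        ((runs_halve false c S hX hY).does.seq (Does.push _ _ _))
        (ih (c / 2) (by omega) (d + 1) _ ?_ ?_ ?_)).of_eq ?_
      · simp
      · simp [hU, unary_succ]
      · simp [hY]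
      · rw [e, show d + 1 + Nat.size (c / 2) = d + (Nat.size (c / 2) + 1) by ring]
        clear ih
        funext k
        cases k <;> simp

/-- Performs a program several times. -/
def rep : ℕ → Prog → Prog
  | 0, _ => .skip
  | m + 1, p => p ;; rep m p

theorem does_rep_dbl (k y : Reg) (hky : k ≠ y) (m c : ℕ) (S : Store) (hk : S k = unary c)
    (hy : S y = []) : Does (rep m (dbl k y)) S (update S k (unary (2 ^ m * c))) := by
  induction m generalizing c S with
  | zero => exact Does.skip.of_eq (by simp [← hk])
  | succ m ih =>
    refine ((does_dbl k y hky c S hk hy).seq (ih (2 * c) _ ?_ ?_)).of_eq ?_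
    · simp
    · simp [Ne.symm hky, hy]
    · rw [update_idem, pow_succ, mul_assoc]

/-- If `p` adds `b` to the unary number on `z`, then a loop over the unary number `a` on `x` adds
`a * b`. -/
theorem does_mul (x z : Reg) (hxz : x ≠ z) (p : Prog) (b : ℕ) (J : Store → Prop)
    (hp : ∀ (S : Store) (c : ℕ), J S → S z = unary c → Does p S (update S z (unary (c + b))))
    (hJx : ∀ S l, J S → J (update S x l)) (hJz : ∀ S l, J S → J (update S z l))
    (a c : ℕ) (S : Store) (hJ : J S) (hx : S x = unary a) (hz : S z = unary c) :
    Does (.each x (fun _ => true) fun _ => p) S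
      (update (update S x []) z (unary (c + a * b))) := by
  induction a generalizing c S with
  | zero =>
    refine (Does.each_stop (by simp [hx])).of_eq ?_
    funext j
    simp only [update_apply]
    split_ifs <;> simp_all
  | succ a ih =>
    refine (Does.each_step (by rw [hx, unary_succ]) rfl (hp _ c (hJx _ _ hJ) (by simp [hxz.symm,
      hz]))
      (ih (c + b) _ (hJz _ _ (hJx _ _ hJ)) ?_ ?_)).of_eq ?_
    · simp [hxz]
    · simp
    · rw [show c + b + a * b = c + (a + 1) * b by ring]
      clear ih
      funext j
      simp only [update_apply]
      split_ifs <;> simp_all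

/-- Writes on `Z` the size of the buckets that belongs to the number on `X`. -/
def threshProg : Prog :=
  .push .X .mark ;; copyRev .X .Y .V ;; .each .V (fun _ => true) (fun _ => copyRev .X .Y .Z) ;;
    clear .X ;; rep 10 (dbl .Z .Y)

/-- The size of the buckets. -/
def thresh (ε : ℚ) : ℕ := 2 ^ 10 * ((ε.den / ε.num.natAbs + 1) * (ε.den / ε.num.natAbs + 1))

/-- The number of rows. -/
def numRows (δ : ℚ) : ℕ := Nat.size (δ.den / δ.num.natAbs)

theorem does_threshProg (c : ℕ) (S : Store) (hX : S .X = unary c) (hY : S .Y = [])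
    (hV : S .V = []) (hZ : S .Z = []) : Does threshProg S
      (update (update S .X []) .Z (unary (2 ^ 10 * ((c + 1) * (c + 1))))) := by
  have h1 := does_mul .V .Z (by simp) (copyRev .X .Y .Z) (c + 1)
    (fun S => S .X = unary (c + 1) ∧ S .Y = [])
    (fun S d h hz => (runs_copyRev .X .Y .Z (by simp) (by simp) (by simp) S h.2).does.of_eq (by
      rw [h.1, hz, List.reverse_replicate, ← List.replicate_add, add_comm]))
    (fun S l h => by simpa using h) (fun S l h => by simpa using h) (c + 1) 0
    (update (update S .X (unary (c + 1))) .V (unary (c + 1))) (by simp [hY]) (by simp)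
    (by simp [hZ])
  have h2 := runs_copyRev .X .Y .V (by simp) (by simp) (by simp) (update S .X (unary (c + 1)))
    (by simp [hY])
  refine (Does.push_seq (S' := _) (Does.seq (S' := update (update S .X (unary (c + 1)))
    .V (unary (c + 1))) ?_ (h1.seq ((runs_clear .X _).does.seq
    (does_rep_dbl .Z .Y (by simp) 10 ((c + 1) * (c + 1)) _ ?_ ?_))))).of_eq ?_
  · rw [hX, ← unary_succ]
    refine h2.does.of_eq ?_
    simp [hV]
  · simp
  · simp [hY]
  · funext k
    cases k <;> simp [hV]

/-- Reads the parameters. What precedes them on `A` is moved to `I`; the number of rows is written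
on `U`, the size of the buckets on `Z` and the number of variables on `N`, in unary. -/
def paramsProg : Prog :=
  mvWhile Sym.isBit .A .I ;;
  parseNum .P ;; parseNum .Q ;; divProg ;; sizeProg ;;
  parseNum .P ;; parseNum .Q ;; divProg ;; threshProg ;;
  parseNum .N

/-- The symbols of the input that consists of the parameters and the random bits. -/
def optSym : Option Bool → Sym
  | some b => .bit b
  | none => .sep

/-- The work stacks after the parameters have been read. -/
def paramStore (n t K : ℕ) (r : List Bool) (D : List Sym) : Store := fun k => match k with
  | .I => r.map .bit
  | .U => unary t
  | .Z => unary K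
  | .N => unary n
  | .D => D
  | _ => []

theorem does_paramsProg (n : ℕ) (ε δ : ℚ) (hε : 0 < ε) (hδ : 0 < δ) (r : List Bool) :
    Does paramsProg (update Store.nil .A ((encodeParams n ε δ ++ r.map some).map optSym).reverse)
      (paramStore n (numRows δ) (thresh ε) r []) := by
  have hε' : 0 < ε.num.natAbs := Int.natAbs_pos.2 (Rat.num_pos.2 hε).ne'
  have hδ' : 0 < δ.num.natAbs := Int.natAbs_pos.2 (Rat.num_pos.2 hδ).ne'
  have e : ((encodeParams n ε δ ++ r.map some).map optSym).reverse = (r.map Sym.bit).reverse ++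
      numText [δ.den, δ.num.natAbs, ε.den, ε.num.natAbs, n] := by
    have ho : optSym ∘ some = Sym.bit := rfl
    simp [encodeParams, optSym, ho, numText]
  rw [e]
  refine ((runs_mvWhile Sym.isBit .A .I (by simp) _ (r.map Sym.bit).reverse
      (numText [δ.den, δ.num.natAbs, ε.den, ε.num.natAbs, n]) (by simp)
      (by
        intro s hs
        obtain ⟨b, -, rfl⟩ := List.mem_map.1 (List.mem_reverse.1 hs)
        rfl) (head?_numText _)).does.seq
    ((does_parseNum .P (by simp) (by simp) δ.den [δ.num.natAbs, ε.den, ε.num.natAbs, n] _ (by simp)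
      (by simp) (by simp)).seq
    ((does_parseNum .Q (by simp) (by simp) δ.num.natAbs [ε.den, ε.num.natAbs, n] _ (by simp)
      (by simp) (by simp)).seq
    ((does_divProg δ.den δ.num.natAbs hδ' _ (by simp) (by simp) (by simp) (by simp)).seq
    ((does_sizeProg (δ.den / δ.num.natAbs) 0 _ (by simp) (by simp) (by simp)).seq
    ((does_parseNum .P (by simp) (by simp) ε.den [ε.num.natAbs, n] _ (by simp) (by simp)
      (by simp)).seq
    ((does_parseNum .Q (by simp) (by simp) ε.num.natAbs [n] _ (by simp) (by simp) (by simp)).seq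
    ((does_divProg ε.den ε.num.natAbs hε' _ (by simp) (by simp) (by simp) (by simp)).seq
    ((does_threshProg (ε.den / ε.num.natAbs) _ (by simp) (by simp) (by simp) (by simp)).seq
    (does_parseNum .N (by simp) (by simp) n [] _ (by simp) (by simp) (by simp))))))))))).of_eq ?_
  funext k
  cases k <;> simp [paramStore, numRows, thresh, numText]

/-! ### Drawing the random bits and initialisation -/

/-- Writes a symbol on `D` for each random bit. -/
def coinsProg : Prog :=
  paramsProg ;;
  .each .U (fun _ => true) (fun _ => copyRev .N .Y .D ;; copyRev .N .Y .D ;; copyRev .N .Y .D) ;;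
  clear .N ;; clear .Z

theorem does_coinsProg (n : ℕ) (ε δ : ℚ) (hε : 0 < ε) (hδ : 0 < δ) :
    Does coinsProg (update Store.nil .A ((encodeParams n ε δ).map optSym).reverse)
      (update Store.nil .D (unary (numRows δ * (3 * n)))) := by
  have h0 := does_paramsProg n ε δ hε hδ []
  rw [List.map_nil, List.append_nil] at h0
  have h1 := does_mul .U .D (by simp) (copyRev .N .Y .D ;; copyRev .N .Y .D ;; copyRev .N .Y .D)
    (3 * n) (fun S => S .N = unary n ∧ S .Y = [])
    (fun S d h hz => by
      refine ((runs_copyRev .N .Y .D (by simp) (by simp) (by simp) S h.2).does.seq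
        ((runs_copyRev .N .Y .D (by simp) (by simp) (by simp) _ (by simp [h.2])).does.seq
        (runs_copyRev .N .Y .D (by simp) (by simp) (by simp) _ (by simp [h.2])).does)).of_eq ?_
      have : unary (d + 3 * n) = unary n ++ (unary n ++ (unary n ++ unary d)) := by
        simp only [← List.replicate_add]
        congr 1
        ring
      rw [this]
      funext k
      cases k <;> simp [h.1, hz])
    (fun S l h => by simpa using h) (fun S l h => by simpa using h) (numRows δ) 0
    (paramStore n (numRows δ) (thresh ε) [] []) (by simp [paramStore]) rfl rfl
  refine (h0.seq (h1.seq ((runs_clear .N _).does.seq (runs_clear .Z _).does))).of_eq ?_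
  funext k
  cases k <;> simp [paramStore]

/-- The Turing machine that computes the number of random bits. -/
noncomputable def coinsMachine : Machine (Option Bool) Unit :=
  machine optSym (fun _ => [()]) coinsProg

theorem coins_outputs (n : ℕ) (ε δ : ℚ) (hε : 0 < ε) (hδ : 0 < δ) :
    coinsMachine.Outputs (encodeParams n ε δ) (List.replicate (numRows δ * (3 * n)) ()) := by
  obtain ⟨t, h⟩ := does_coinsProg n ε δ hε hδ
  have := h.outputsWithin (g := fun _ => [()])
  refine ⟨_, Eq.mp (congrArg (fun y => Machine.OutputsWithin _ _ y _) ?_) this⟩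
  rw [List.eq_replicate_iff]
  simp

/-- The row for the tape `tp` before the stream starts. -/
def Tape.row (tp : Tape) (K : ℕ) : Row := ⟨tp.left 0, tp.right 0, K, []⟩

/-- The random bits of a row in the order in which they are drawn. -/
def Tape.bits (tp : Tape) : List Bool := tp.bs ++ tp.cs.flatMap fun c => [c.1, c.2]

/-- Writes a row on `D`, using random bits from `I`. -/
def rowInit : Prog :=
  .each .N (fun _ => true) (fun s => .push .Y s ;; .pop .I fun o =>
    .push .D (.base (o.getD .sep).toBit)) ;; mv .Y .N ;; .push .D .sep ;;
  .each .N (fun _ => true) (fun s => .push .Y s ;; .pop .I fun p => .pop .I fun q =>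
    .push .D (.con (p.getD .sep).toBit (q.getD .sep).toBit)) ;; mv .Y .N ;;
  .push .D .fls ;; .push .D .sep ;; copyRev .Z .Y .D ;; .push .D .sep ;; .push .D .sep

theorem does_bases (bs : List Bool) (r : List Sym) (S : Store) (hN : S .N = unary bs.length)
    (hI : S .I = bs.map .bit ++ r) :
    Does (.each .N (fun _ => true) (fun s => .push .Y s ;; .pop .I fun o =>
      .push .D (.base (o.getD .sep).toBit))) S (update (update (update (update S .N []) .I r)
        .Y (unary bs.length ++ S .Y)) .D ((bs.map .base).reverse ++ S .D)) := by
  induction bs generalizing S with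
  | nil =>
    refine (Does.each_stop (by simp [hN])).of_eq ?_
    funext k
    cases k <;> simp_all
  | cons b bs ih =>
    refine (Does.each_step (by rw [hN, List.length_cons, unary_succ]) rfl (Does.push_seq
      (Does.pop_some (s := .bit b) (l := bs.map .bit ++ r) (by simp [hI]) (Does.push _ _ _)))
      (ih _ ?_ ?_)).of_eq ?_
    · simp
    · simp
    · clear ih
      have : ∀ l : List Sym, unary (bs.length + 1) ++ l = unary bs.length ++ .mark :: l := by
        intro l
        rw [unary, List.replicate_succ', List.append_assoc]
        rfl
      funext k
      cases k <;> simp [Sym.toBit, this]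

theorem does_cons (cs : List (Bool × Bool)) (r : List Sym) (S : Store)
    (hN : S .N = unary cs.length)
    (hI : S .I = (cs.flatMap fun c => [c.1, c.2]).map .bit ++ r) :
    Does (.each .N (fun _ => true) (fun s => .push .Y s ;; .pop .I fun p => .pop .I fun q =>
      .push .D (.con (p.getD .sep).toBit (q.getD .sep).toBit))) S
      (update (update (update (update S .N []) .I r) .Y (unary cs.length ++ S .Y))
        .D ((cs.map fun c => .con c.1 c.2).reverse ++ S .D)) := by
  induction cs generalizing S with
  | nil =>
    refine (Does.each_stop (by simp [hN])).of_eq ?_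
    funext k
    cases k <;> simp_all
  | cons c cs ih =>
    refine (Does.each_step (by rw [hN, List.length_cons, unary_succ]) rfl (Does.push_seq
      (Does.pop_some (s := .bit c.1)
      (l := .bit c.2 :: ((cs.flatMap fun c => [c.1, c.2]).map .bit ++ r)) (by simp [hI])
      (Does.pop_some (s := .bit c.2) (l := (cs.flatMap fun c => [c.1, c.2]).map .bit ++ r) (by simp)
      (Does.push _ _ _)))) (ih _ ?_ ?_)).of_eq ?_
    · simp
    · simp
    · clear ih
      have : ∀ l : List Sym, unary (cs.length + 1) ++ l = unary cs.length ++ .mark :: l := by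
        intro l
        rw [unary, List.replicate_succ', List.append_assoc]
        rfl
      funext k
      cases k <;> simp [Sym.toBit, this]

theorem does_rowInit {n : ℕ} {tp : Tape} (h : tp.Valid n) (K t : ℕ) (r : List Bool)
    (D : List Sym) : Does rowInit (paramStore n t K (tp.bits ++ r) D)
      (paramStore n t K r ((rowText (tp.row K)).reverse ++ D)) := by
  refine ((does_bases tp.bs ((tp.cs.flatMap fun c => [c.1, c.2]).map .bit ++ r.map .bit) _
    (by rw [h.1]; rfl) (by simp [paramStore, Tape.bits])).seq ((runs_mv .Y .N (by simp) _).does.seq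
    (Does.push_seq ((does_cons tp.cs (r.map .bit) _ ?_ ?_).seq
    ((runs_mv .Y .N (by simp) _).does.seq (Does.push_seq (Does.push_seq
    ((runs_copyRev .Z .Y .D (by simp) (by simp) (by simp) _ ?_).does.seq (Does.push_seq
    (Does.push _ _ _)))))))))).of_eq ?_
  · simp [paramStore, h.1, h.2]
  · simp
  · simp
  · funext k
    cases k <;> simp [paramStore, rowText, Tape.row, Tape.left, Tape.right, Tape.eqs, h.2]

/-- Writes the initial memory. -/
def initProg : Prog :=
  paramsProg ;; .each .U (fun _ => true) (fun _ => rowInit) ;; clear .N ;; clear .Z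

theorem does_rows {n : ℕ} (K : ℕ) (tps : List Tape) (h : ∀ tp ∈ tps, tp.Valid n) (D : List Sym) :
    Does (.each .U (fun _ => true) (fun _ => rowInit))
      (paramStore n tps.length K (tps.flatMap Tape.bits) D)
      (paramStore n 0 K [] ((memText (tps.map fun tp => tp.row K)).reverse ++ D)) := by
  induction tps generalizing D with
  | nil => exact Does.each_stop (by simp [paramStore])
  | cons tp tps ih =>
    have e : update (paramStore n (tp :: tps).length K ((tp :: tps).flatMap Tape.bits) D) .U
        (unary tps.length) = paramStore n tps.length K (tp.bits ++ tps.flatMap Tape.bits) D := by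
      funext k
      cases k <;> simp [paramStore]
    refine (Does.each_step (s := .mark) (l := unary tps.length) rfl rfl
      (by rw [e]; exact does_rowInit (h tp (by simp)) K _ _ D)
      (ih (fun tp h' => h tp (by simp [h'])) _)).of_eq ?_
    simp

/-- The Turing machine that computes the initial memory. -/
noncomputable def initMachine : Machine (Option Bool) Bool := machine optSym enc initProg

theorem init_outputs {n : ℕ} {ε δ : ℚ} (hε : 0 < ε) (hδ : 0 < δ) (tps : List Tape)
    (h : ∀ tp ∈ tps, tp.Valid n) (ht : tps.length = numRows δ) :
    initMachine.Outputs (encodeParams n ε δ ++ (tps.flatMap Tape.bits).map some)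
      (memory (tps.map fun tp => tp.row (thresh ε))) := by
  have h1 := does_rows (thresh ε) tps h []
  rw [ht] at h1
  obtain ⟨t, h2⟩ := (does_paramsProg n ε δ hε hδ (tps.flatMap Tape.bits)).seq (h1.seq
    ((runs_clear .N _).does.seq (runs_clear .Z _).does))
  have e : update (update (paramStore n 0 (thresh ε) []
      ((memText (tps.map fun tp => tp.row (thresh ε))).reverse ++ [])) .N []) .Z [] =
      update Store.nil .D (memText (tps.map fun tp => tp.row (thresh ε))).reverse := by
    funext k
    cases k <;> simp [paramStore]
  rw [e] at h2
  have h3 := h2.outputsWithin (g := enc)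
  rw [List.reverse_reverse] at h3
  exact ⟨_, h3⟩

theorem MemInv.start {n : ℕ} (K : ℕ) (tps : List Tape) (h : ∀ tp ∈ tps, tp.Valid n) :
    MemInv n K tps [] (tps.map fun tp => tp.row K) := by
  induction tps with
  | nil => exact .nil
  | cons tp tps ih =>
    exact .cons ⟨h tp (by simp), 0, by omega, rfl, rfl, by simp [Tape.row], by simp [Tape.row],
      by simp⟩ (ih fun tp h' => h tp (by simp [h']))

/-! ### The estimate -/

/-- The estimate of a row. -/
def Row.est (row : Row) : ℕ := 2 ^ row.left.countP Sym.isEq * row.pts.length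

/-- Counts one point in `estProg`. -/
def countStep : Sym → Prog
  | .hd _ => .push .X .mark
  | _ => .skip

/-- Appends the estimate of the row that has been loaded to the text on `F`. -/
def estProg : Prog :=
  .each .B (fun _ => true) countStep ;;
  .each .L (fun _ => true) (fun s => if s.isEq then dbl .X .Y else .skip) ;;
  clear .R ;; clear .C ;; mv .X .F ;; .push .F .sep

theorem does_count_bits (l : List Bool) (r : List Sym) (S S' : Store) (hB : S .B = l.map .bit ++ r)
    (h : Does (.each .B (fun _ => true) countStep) (update S .B r) S') :
    Does (.each .B (fun _ => true) countStep) S S' := by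
  induction l generalizing S with
  | nil =>
    have : update S .B r = S := by
      rw [List.map_nil, List.nil_append] at hB
      rw [← hB, update_eq_self]
    rwa [this] at h
  | cons b l ih =>
    exact Does.each_step hB rfl Does.skip (ih _ (by simp) (by simpa using h))

theorem does_count (vs : List (List Bool)) (hvs : [] ∉ vs) (c : ℕ) (S : Store)
    (hB : S .B = vsText vs) (hX : S .X = unary c) :
    Does (.each .B (fun _ => true) countStep) S
      (update (update S .B []) .X (unary (c + vs.length))) := by
  induction vs generalizing c S with
  | nil =>
    refine (Does.each_stop (by simp [hB])).of_eq ?_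
    funext k
    cases k <;> simp_all
  | cons v vs ih =>
    obtain ⟨h, l, rfl⟩ := List.exists_cons_of_ne_nil (fun e : v = [] => hvs (by simp [e]))
    refine Does.each_step (s := .hd h) (l := l.map .bit ++ vsText vs) (by simp [hB, vtext]) rfl
      (Does.push _ _ _) (does_count_bits l (vsText vs) _ _ (by simp)
      ((ih (fun h => hvs (by simp [h])) (c + 1) _ ?_ ?_).of_eq ?_))
    · simp
    · simp [hX, unary_succ]
    · rw [List.length_cons, show c + 1 + vs.length = c + (vs.length + 1) by ring]
      clear ih
      funext k
      cases k <;> simp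

theorem does_levels (l : List Sym) (c : ℕ) (S : Store) (hL : S .L = l) (hX : S .X = unary c)
    (hY : S .Y = []) :
    Does (.each .L (fun _ => true) (fun s => if s.isEq then dbl .X .Y else .skip)) S
      (update (update S .L []) .X (unary (2 ^ l.countP Sym.isEq * c))) := by
  induction l generalizing c S with
  | nil =>
    refine (Does.each_stop (by simp [hL])).of_eq ?_
    funext k
    cases k <;> simp_all
  | cons s l ih =>
    have h1 : Does (if s.isEq then dbl .X .Y else .skip) (update S .L l)
        (update (update S .L l) .X (unary ((if s.isEq then 2 else 1) * c))) := by
      split_ifs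
      · exact does_dbl .X .Y (by simp) c _ (by simp [hX]) (by simp [hY])
      · refine Does.skip.of_eq ?_
        funext k
        cases k <;> simp [hX]
    refine (Does.each_step hL rfl h1 (ih ((if s.isEq then 2 else 1) * c) _ ?_ ?_ ?_)).of_eq ?_
    · simp
    · simp
    · simp [hY]
    · have e : 2 ^ l.countP Sym.isEq * ((if s.isEq then 2 else 1) * c) =
          2 ^ (s :: l).countP Sym.isEq * c := by
        rw [List.countP_cons]
        split_ifs
        · ring
        · simp
      rw [e]
      clear ih h1
      funext k
      cases k <;> simp

/-- A list of numbers in unary. -/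
def blocks (es : List ℕ) : List Sym := es.flatMap fun e => .sep :: unary e

theorem does_estProg (row : Row) (h : [] ∉ row.pts) (F r : List Sym) :
    Does estProg (holds (idle [] F r [] []) row ([], []))
      (idle [] (blocks [row.est] ++ F) r [] []) := by
  refine ((does_count row.pts h 0 _ (by simp [holds]) (by simp [holds, idle])).seq
    ((does_levels row.left (0 + row.pts.length) _ (by simp [holds]) (by simp)
    (by simp [holds, idle])).seq ((runs_clear .R _).does.seq ((runs_clear .C _).does.seq
    ((runs_mv .X .F (by simp) _).does.seq (Does.push _ _ _)))))).of_eq ?_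
  funext k
  cases k <;> simp [holds, idle, blocks, Row.est]

theorem does_ests (rows : List Row) (h : ∀ row ∈ rows, row.Clean ∧ [] ∉ row.pts) (F : List Sym) :
    Does (.each .I (fun _ => true) (fun s => .push .I s ;; loadRow ;; estProg))
      (idle [] F (memText rows) [] [])
      (idle [] (blocks (rows.map Row.est).reverse ++ F) [] [] []) := by
  induction rows generalizing F with
  | nil => exact Does.each_stop (by simp [idle])
  | cons row rows ih =>
    have hne : rowText row ≠ [] := by simp [rowText]
    obtain ⟨s, l, hs⟩ := List.exists_cons_of_ne_nil hne
    obtain ⟨h1, h2⟩ := h row (by simp)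
    refine (Does.each_peek (s := s) (l := l ++ memText rows) (by simp [idle, hs]) rfl
      ((runs_loadRow row h1 [] F (memText rows) [] []).does.seq
      (does_estProg row h2 F (memText rows))) (ih (fun row h' => h row (by simp [h'])) _)).of_eq ?_
    simp [blocks]

/-- One symbol of a round: the number at the top is decreased by one, and it is counted on `P` or
`N` whether it was positive. -/
def roundStep : Sym → Prog
  | .sep => .push .W .sep ;; .pop .F fun o => match o with
    | some .mark => .push .P .mark
    | some s => .push .N .mark ;; .push .F s
    | none => .push .N .mark
  | s => .push .W s

/-- Subtracts one from all numbers on `F`, and pushes on `Q` whether more than half of them were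
positive. -/
def roundProg : Prog :=
  .each .F (fun _ => true) roundStep ;; mv .W .F ;;
  .each .P (fun _ => true) (fun _ => .pop .N fun o => match o with
    | none => .push .Y .mark
    | some _ => .skip) ;;
  peek .Y (fun o => .push .Q (.bit o.isSome)) ;; clear .Y ;; clear .N

theorem does_marks (a : ℕ) (r : List Sym) (S S' : Store) (hF : S .F = unary a ++ r)
    (h : Does (.each .F (fun _ => true) roundStep)
      (update (update S .F r) .W (unary a ++ S .W)) S') :
    Does (.each .F (fun _ => true) roundStep) S S' := by
  induction a generalizing S with
  | zero =>
    have : update (update S .F r) .W (unary 0 ++ S .W) = S := by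
      have hF : S .F = r := by simpa using hF
      rw [← hF]; simp
    rwa [this] at h
  | succ a ih =>
    refine Does.each_step (s := .mark) (l := unary a ++ r) (by rw [hF, unary_succ]; rfl) rfl
      (Does.push _ _ _) (ih _ (by simp) ?_)
    convert h using 1
    have : ∀ l : List Sym, unary (a + 1) ++ l = unary a ++ .mark :: l := by
      intro l
      rw [unary, List.replicate_succ', List.append_assoc]
      rfl
    funext k
    cases k <;> simp [this]

theorem does_round_loop (es : List ℕ) (S : Store) (hF : S .F = blocks es) :
    Does (.each .F (fun _ => true) roundStep) S
      (update (update (update (update S .F []) .W ((blocks (es.map (· - 1))).reverse ++ S .W))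
        .P (unary (es.countP (0 < ·)) ++ S .P)) .N (unary (es.countP (· = 0)) ++ S .N)) := by
  induction es generalizing S with
  | nil =>
    refine (Does.each_stop (by simp [hF, blocks])).of_eq ?_
    funext k
    cases k <;> simp_all [blocks]
  | cons e es ih =>
    have key : ∀ l : List Sym, ∀ a, unary (a + 1) ++ l = unary a ++ .mark :: l := by
      intro l a
      rw [unary, List.replicate_succ', List.append_assoc]
      rfl
    rcases e with _ | e
    · have h1 : Does (roundStep .sep) (update S .F (blocks es))
          (update (update (update S .F (blocks es)) .W (.sep :: S .W)) .N (.mark :: S .N)) := by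
        refine Does.push_seq ?_
        rcases es with _ | ⟨e, es⟩
        · refine (Does.pop_none (by simp [blocks]) (Does.push _ _ _)).of_eq ?_
          funext k
          cases k <;> simp
        · refine (Does.pop_some (s := .sep) (l := unary e ++ blocks es) (by simp [blocks])
            (Does.push_seq (Does.push _ _ _))).of_eq ?_
          funext k
          cases k <;> simp [blocks]
      refine (Does.each_step (s := .sep) (l := blocks es) (by simp [hF, blocks]) rfl h1
        (ih _ (by simp))).of_eq ?_
      clear ih h1
      funext k
      cases k <;> simp [blocks, key]
    · have h1 : Does (roundStep .sep) (update S .F (unary (e + 1) ++ blocks es))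
          (update (update (update S .F (unary e ++ blocks es)) .W (.sep :: S .W))
            .P (.mark :: S .P)) := by
        refine Does.push_seq ((Does.pop_some (s := .mark) (l := unary e ++ blocks es)
          (by simp [unary_succ]) (Does.push _ _ _)).of_eq ?_)
        funext k
        cases k <;> simp
      refine (Does.each_step (s := .sep) (l := unary (e + 1) ++ blocks es) (by simp [hF, blocks])
        rfl h1 (does_marks e (blocks es) _ _ (by simp) (ih _ (by simp)))).of_eq ?_
      clear ih h1
      funext k
      cases k <;> simp [blocks, key]

theorem does_compare (a b y : ℕ) (S : Store) (hP : S .P = unary a) (hN : S .N = unary b)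
    (hY : S .Y = unary y) :
    Does (.each .P (fun _ => true) (fun _ => .pop .N fun o => match o with
      | none => .push .Y .mark
      | some _ => .skip)) S (update (update (update S .P []) .N (unary (b - a)))
        .Y (unary (y + (a - b)))) := by
  induction a generalizing b y S with
  | zero =>
    refine (Does.each_stop (by simp [hP])).of_eq ?_
    funext k
    cases k <;> simp_all
  | succ a ih =>
    rcases b with _ | b
    · refine (Does.each_step (by rw [hP, unary_succ]) rfl (Does.pop_none (by simpa using hN)
        (Does.push _ _ _)) (ih 0 (y + 1) _ ?_ ?_ ?_)).of_eq ?_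
      · simp
      · simpa using hN
      · simp [hY, unary_succ]
      · rw [show y + 1 + (a - 0) = y + (a + 1 - 0) by omega]
        clear ih
        funext k
        cases k <;> simp
    · refine (Does.each_step (by rw [hP, unary_succ]) rfl (Does.pop_some (s := .mark)
        (l := unary b) (by simp [hN, unary_succ]) Does.skip) (ih b y _ ?_ ?_ ?_)).of_eq ?_
      · simp
      · simp
      · simpa using hY
      · clear ih
        funext k
        cases k <;> simp

/-- Whether more than half of the numbers are greater than `r`. -/
def majority (es : List ℕ) (r : ℕ) : Bool := decide (es.countP (· ≤ r) < es.countP (r < ·))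

theorem does_roundProg (es : List ℕ) (S : Store) (hF : S .F = blocks es) (hW : S .W = [])
    (hP : S .P = []) (hN : S .N = []) (hY : S .Y = []) :
    Does roundProg S (update (update S .F (blocks (es.map (· - 1))))
      .Q (.bit (majority es 0) :: S .Q)) := by
  refine ((does_round_loop es S hF).seq ((runs_mv .W .F (by simp) _).does.seq
    ((does_compare (es.countP (0 < ·)) (es.countP (· = 0)) 0 _ ?_ ?_ ?_).seq ((Does.peek
    (Does.push _ _ _)).seq ((runs_clear .Y _).does.seq (runs_clear .N _).does))))).of_eq ?_
  · simp [hP]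
  · simp [hN]
  · simp [hY]
  · have e : (unary (0 + (es.countP (0 < ·) - es.countP (· = 0))) : List Sym).head?.isSome =
        majority es 0 := by
      simp only [majority, Nat.le_zero, List.head?_replicate]
      split_ifs with h
      · simp; omega
      · simp; omega
    simp only [update_self, e]
    clear e
    funext k
    cases k <;> simp [hW, hP, hN, hY]

/-- Writes the least number that is not exceeded by more than half of the numbers on `F` on `X`. -/
def medianProg : Prog :=
  roundProg ;; .each .Q Sym.toBit (fun _ => .push .X .mark ;; roundProg) ;;
    (.pop .Q fun _ => .skip) ;; clear .F

theorem majority_sub (es : List ℕ) (r : ℕ) : majority (es.map (· - r)) 0 = majority es r := by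
  simp [majority, List.countP_map, Function.comp_def]
  have : (fun e => decide (e - r = 0)) = fun e => decide (e ≤ r) := by
    funext e
    simp only [decide_eq_decide]
    omega
  rw [this]

theorem exists_not_majority (es : List ℕ) : ∃ r, majority es r = false := by
  refine ⟨es.sum, ?_⟩
  have : es.countP (es.sum < ·) = 0 := by
    rw [List.countP_eq_zero]
    intro e he
    have := List.single_le_sum (fun _ _ => Nat.zero_le _) e he
    simpa using this
  simp [majority, this]

/-- The least number that is not exceeded by more than half of the numbers. -/
def median (es : List ℕ) : ℕ := Nat.find (exists_not_majority es)

theorem does_median_loop (es : List ℕ) (d r : ℕ) (hd : r + d = median es) (S : Store)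
    (hF : S .F = blocks ((es.map (· - r)).map (· - 1)))
    (hQ : S .Q = [.bit (majority es r)]) (hX : S .X = unary r) (hW : S .W = [])
    (hP : S .P = []) (hN : S .N = []) (hY : S .Y = []) :
    ∃ F, Does (.each .Q Sym.toBit (fun _ => .push .X .mark ;; roundProg)) S
      (update (update (update S .Q [.bit false]) .X (unary (median es))) .F F) := by
  induction d generalizing r S with
  | zero =>
    have h1 : majority es r = false := by
      have := Nat.find_spec (exists_not_majority es)
      rwa [show Nat.find (exists_not_majority es) = r from hd.symm] at this
    refine ⟨S .F, (Does.each_stop (by simp [hQ, h1, Sym.toBit])).of_eq ?_⟩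
    have h2 : r = median es := by simpa using hd
    rw [← h2, ← h1, ← hQ, ← hX]
    simp
  | succ d ih =>
    have h1 : majority es r = true := by
      have := Nat.find_min (exists_not_majority es) (m := r) (by
        change r < median es
        omega)
      simpa using this
    have e : (es.map (· - r)).map (· - 1) = es.map (· - (r + 1)) := by
      simp [Function.comp_def, Nat.sub_sub]
    rw [e] at hF
    have h2 := does_roundProg (es.map (· - (r + 1)))
      (update (update S .Q []) .X (unary (r + 1))) (by simp [hF]) (by simp [hW])
      (by simp [hP]) (by simp [hN]) (by simp [hY])
    rw [majority_sub] at h2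
    obtain ⟨F, h3⟩ := ih (r + 1) (by omega) (update (update (update (update S .Q [])
      .X (unary (r + 1))) .F (blocks ((es.map (· - (r + 1))).map (· - 1))))
      .Q (.bit (majority es (r + 1)) :: (update (update S .Q []) .X (unary (r + 1))) .Q))
      (by simp) (by simp) (by simp) (by simp [hW]) (by simp [hP]) (by simp [hN]) (by simp [hY])
    refine ⟨F, (Does.each_step hQ h1 (Does.push_seq ?_) h3).of_eq ?_⟩
    · convert h2 using 1
      funext k
      cases k <;> simp [hX, unary_succ]
    · clear ih h2 h3
      funext k
      cases k <;> simp

theorem does_medianProg (es : List ℕ) (I D T : List Sym) :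
    Does medianProg (idle [] (blocks es) I D T)
      (update (idle [] [] I D T) .X (unary (median es))) := by
  have h1 := does_roundProg es (idle [] (blocks es) I D T) rfl rfl rfl rfl rfl
  obtain ⟨F, h2⟩ := does_median_loop es (median es) 0 (by simp) (update (update
    (idle [] (blocks es) I D T) .F (blocks (es.map (· - 1))))
    .Q (.bit (majority es 0) :: idle [] (blocks es) I D T .Q)) (by simp) (by simp [idle])
    (by simp [idle]) (by simp [idle]) (by simp [idle]) (by simp [idle]) (by simp [idle])
  refine (h1.seq (h2.seq ((Does.pop_some (s := .bit false) (l := []) (by simp) Does.skip).seq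
    (runs_clear .F _).does))).of_eq ?_
  funext k
  cases k <;> simp [idle]

/-- Writes the number on `X` in binary on `D`. -/
def binProg : Prog :=
  .each .X (fun _ => true) fun s => .push .X s ;; halve true ;; .pop .Z fun o =>
    .push .D (.bit o.isSome)

theorem does_binProg (c : ℕ) (S : Store) (hX : S .X = unary c) (hY : S .Y = []) (hZ : S .Z = []) :
    ∃ l : List Bool, ofBits l = c ∧ Does binProg S
      (update (update S .X []) .D ((l.map .bit).reverse ++ S .D)) := by
  induction c using Nat.strong_induction_on generalizing S with
  | _ c ih =>
    rcases Nat.eq_zero_or_pos c with rfl | hc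
    · refine ⟨[], rfl, (Does.each_stop (by simp [hX])).of_eq ?_⟩
      funext k
      cases k <;> simp_all
    · obtain ⟨c', hc'⟩ := Nat.exists_eq_succ_of_ne_zero hc.ne'
      obtain ⟨l, hl, h⟩ := ih (c / 2) (by omega) (update (update S .X (unary (c / 2)))
        .D (.bit (c % 2 == 1) :: S .D)) (by simp) (by simp [hY]) (by simp [hZ])
      refine ⟨(c % 2 == 1) :: l, ?_, (Does.each_peek (s := .mark) (l := unary c')
        (by rw [hX, hc', unary_succ]) rfl ((runs_halve true c S hX hY).does.seq
        (S'' := update (update S .X (unary (c / 2))) .D (.bit (c % 2 == 1) :: S .D)) ?_)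
        h).of_eq ?_⟩
      · simp only [ofBits, List.map_cons, Nat.ofDigits_cons] at hl ⊢
        rw [hl]
        rcases Nat.mod_two_eq_zero_or_one c with h0 | h0 <;> rw [h0] <;> simp <;> omega
      · rcases Nat.mod_two_eq_zero_or_one c with h0 | h0
        · refine (Does.pop_none (by simp [h0, hZ]) (Does.push _ _ _)).of_eq ?_
          funext k
          cases k <;> simp [h0]
        · refine (Does.pop_some (s := .mark) (l := []) (by simp [h0, hZ])
            (Does.push _ _ _)).of_eq ?_
          funext k
          cases k <;> simp [h0, hZ]
      · clear ih h
        funext k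
        cases k <;> simp

/-- Computes the estimate. -/
def reportProg : Prog :=
  decodeProg ;; .each .I (fun _ => true) (fun s => .push .I s ;; loadRow ;; estProg) ;;
    medianProg ;; binProg ;; .push .D .sep ;; .push .D (.bit true)

/-- A symbol of the output of `reportProg`. -/
def symOpt : Sym → List (Option Bool)
  | .bit b => [some b]
  | _ => [none]

/-- The Turing machine that computes the estimate. -/
noncomputable def reportMachine : Machine Bool (Option Bool) := machine .base symOpt reportProg

theorem report_outputs (rows : List Row) (h : ∀ row ∈ rows, row.Clean ∧ [] ∉ row.pts) :
    ∃ a : List Bool, ofBits a = median (rows.map Row.est).reverse ∧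
      reportMachine.Outputs (memory rows) (a.map some ++ none :: [true].map some) := by
  have h1 := runs_decodeProg (memText rows) [] [] [] []
  rw [List.append_nil] at h1
  have h2 := does_ests rows h []
  rw [List.append_nil] at h2
  have h3 := does_medianProg (rows.map Row.est).reverse [] [] []
  obtain ⟨l, hl, h4⟩ := does_binProg (median (rows.map Row.est).reverse)
    (update (idle [] [] [] [] []) .X (unary (median (rows.map Row.est).reverse))) (by simp)
    (by simp [idle]) (by simp [idle])
  have h5 : Does reportProg (idle (((memText rows).flatMap enc).map .base).reverse [] [] [] [])
      (update Store.nil .D (.bit true :: .sep :: (l.map Sym.bit).reverse)) := by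
    refine (h1.does.seq (h2.seq (h3.seq (h4.seq (Does.push_seq (Does.push _ _ _)))))).of_eq ?_
    funext k
    cases k <;> simp [idle]
  have e1 : idle (((memText rows).flatMap enc).map .base).reverse [] [] [] [] =
      update Store.nil .A ((memory rows).map .base).reverse := by
    funext k
    cases k <;> simp [idle, memory]
  rw [e1] at h5
  obtain ⟨t, h5⟩ := h5
  have h7 := h5.outputsWithin (g := symOpt)
  refine ⟨l, hl, _, Eq.mp (congrArg (fun y => Machine.OutputsWithin _ _ y _) ?_) h7⟩
  have : ∀ l : List Bool, (l.map Sym.bit).flatMap symOpt = l.map some := by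
    intro l
    induction l with
    | nil => rfl
    | cons b l ih => simp [symOpt, ih]
  simp [symOpt, this]

/-! ### The cells are pairwise independent -/

/-- The random bits of a row. -/
abbrev Seed (n : ℕ) := (Fin n → Bool) × (Fin n → Bool × Bool)

namespace Seed

variable {n : ℕ}

/-- The tape with the given random bits. -/
def tape (ω : Seed n) : Tape := ⟨List.ofFn ω.1, List.ofFn ω.2⟩

theorem valid_tape (ω : Seed n) : ω.tape.Valid n := by simp [tape, Tape.Valid]

/-- The coefficients on the tape, from the oldest cell to the newest one. -/
def cell (ω : Seed n) (p : ℕ) : Bool :=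
  if h : p < n then ω.1 ⟨n - 1 - p, by omega⟩
  else if h' : p - n < n then (ω.2 ⟨p - n, h'⟩).1 else false

/-- The coefficients of the `i`-th equation. -/
def coefs (ω : Seed n) (i : ℕ) : List Bool := List.ofFn fun j : Fin n => ω.cell (i + j + 1)

theorem eqv_tape (ω : Seed n) (i : Fin n) :
    ω.tape.eqv i = (ω.2 i).2 :: ω.coefs i := by
  have hi : (i : ℕ) < ω.tape.eqs.length := by
    rw [ω.valid_tape.length_eqs]; omega
  have he : ω.tape.eqs[(i : ℕ)] = .con (ω.2 i).1 (ω.2 i).2 := by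
    simp [Tape.eqs, tape]
  rw [Tape.eqv, ω.valid_tape.1]
  have hl := Tape.left_succ (tp := ω.tape) i hi
  rw [he] at hl
  unfold equation
  have hh : (ω.tape.left (i + 1)).head? = some (.con (ω.2 i).1 (ω.2 i).2) := by rw [hl]; rfl
  rw [hh]
  have hb : (some (Sym.con (ω.2 i).1 (ω.2 i).2) != some Sym.fls) = true := rfl
  simp only [Option.getD_some, Sym.const, List.cons.injEq, true_and, hb, Bool.true_and]
  have hlen := ω.valid_tape.length_left (i + 1)
  apply List.ext_getElem
  · simp [coefs, hlen]
  · intro j h1 h2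
    have hj : j < n := by simpa [coefs] using h2
    simp only [List.getElem_reverse, List.getElem_map, List.getElem_take, List.length_map,
      List.length_take, coefs, List.getElem_ofFn]
    have e1 : min n (ω.tape.left (i + 1)).length - 1 - j = n - 1 - j := by omega
    simp only [e1]
    simp only [Tape.left, tape, Tape.eqs]
    rw [List.getElem_append]
    simp only [List.length_reverse, List.length_take, List.length_append, List.length_map,
      List.length_ofFn, List.length_singleton]
    have e2 : min ((i : ℕ) + 1) (n + 1) = i + 1 := by omega
    split_ifs with hq
    · simp only [e2] at hq
      simp only [List.getElem_reverse, List.getElem_take, List.length_take, List.length_append,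
        List.length_map, List.length_ofFn, List.length_singleton, e2]
      rw [List.getElem_append_left (by simp; omega)]
      simp only [List.getElem_map, List.getElem_ofFn, Sym.coef]
      rw [cell, dif_neg (by omega), dif_pos (by omega)]
      exact congrArg (fun k => (ω.2 k).1) (Fin.ext (by simp only; omega))
    · simp only [e2] at hq
      simp only [List.getElem_map, List.getElem_ofFn, Sym.coef, e2]
      rw [cell, dif_pos (by omega)]
      exact congrArg ω.1 (Fin.ext (by simp only; omega))

/-- The sum of two seeds over `𝔽₂`. -/
def add (ω δ : Seed n) : Seed n :=
  (fun i => xor (ω.1 i) (δ.1 i), fun i => (xor (ω.2 i).1 (δ.2 i).1, xor (ω.2 i).2 (δ.2 i).2))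

theorem add_add (ω δ : Seed n) : (ω.add δ).add δ = ω := by
  simp [add]

theorem cell_add (ω δ : Seed n) (p : ℕ) : (ω.add δ).cell p = xor (ω.cell p) (δ.cell p) := by
  simp only [cell, add]
  split_ifs <;> rfl

theorem coefs_add (ω δ : Seed n) (i : ℕ) : (ω.add δ).coefs i = vx (ω.coefs i) (δ.coefs i) := by
  apply List.ext_getElem
  · simp [coefs, vx]
  · intro j h1 h2
    simp [coefs, vx, cell_add]

theorem _root_.DNFStream.ip_comm (u v : List Bool) : ip u v = ip v u := by
  rw [ip, ip, List.zipWith_comm_of_comm]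
  exact fun a b => Bool.and_comm a b

/-- The equations depend linearly on the seed. -/
theorem ip_eqv_add (ω δ : Seed n) (i : Fin n) (v : List Bool) :
    ip ((ω.add δ).tape.eqv i) v = xor (ip (ω.tape.eqv i) v) (ip (δ.tape.eqv i) v) := by
  rw [eqv_tape, eqv_tape, eqv_tape, coefs_add, ip_comm, ip_comm _ v, ip_comm _ v, ← ip_vx]
  · rfl
  · simp [coefs]

theorem ip_cons (a b : Bool) (u v : List Bool) : ip (a :: u) (b :: v) = xor (a && b) (ip u v) := rfl

/-- A seed that changes only the constant term of one equation. -/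
theorem exists_const (m : Fin n) : ∃ δ : Seed n, ∀ (i : Fin n) (b : Bool) (x : List Bool),
    ip (δ.tape.eqv i) (b :: x) = (decide (i = m) && b) := by
  refine ⟨(fun _ => false, fun i => (false, decide (i = m))), fun i b x => ?_⟩
  rw [eqv_tape]
  have : coefs ((fun _ => false, fun i => (false, decide (i = m))) : Seed n) i =
      List.replicate n false := by
    rw [List.eq_replicate_iff]
    refine ⟨by simp [coefs], fun b hb => ?_⟩
    obtain ⟨j, rfl⟩ := (List.mem_ofFn' _ _).1 hb
    simp only [cell]
    split_ifs <;> rfl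
  rw [this, ip_cons, ip_zeros, Bool.xor_false]

theorem ip_single (z : List Bool) (k : ℕ) (hk : k < z.length) (u : List Bool)
    (hu : ∀ j (h : j < u.length), u[j] = decide (j = k)) (hl : u.length = z.length) :
    ip u z = z[k] := by
  induction z generalizing u k with
  | nil => simp at hk
  | cons b z ih =>
    rcases u with _ | ⟨a, u⟩
    · simp at hl
    · have ha := hu 0 (by simp)
      rw [List.getElem_cons_zero] at ha
      have hu' : ∀ j (h : j < u.length), u[j] = decide (j + 1 = k) := fun j h => by
        have := hu (j + 1) (by simpa using h)
        simpa using this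
      rw [ip_cons, ha]
      rcases k with _ | k
      · have : u = List.replicate u.length false := by
          apply List.ext_getElem
          · simp
          · intro j h1 h2
            rw [hu' j h1]
            simp
        rw [this, ip_zeros]
        simp
      · rw [ih k (by simpa using hk) u (fun j h => by simpa using hu' j h) (by simpa using hl)]
        simp

theorem ip_none (z : List Bool) (u : List Bool)
    (hu : ∀ j (h : j < u.length) (h' : j < z.length), u[j] = true → z[j] = false) :
    ip u z = false := by
  induction z generalizing u with
  | nil => cases u <;> rfl
  | cons b z ih =>
    rcases u with _ | ⟨a, u⟩
    · rfl
    · have h0 : a = true → b = false := hu 0 (by simp) (by simp)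
      rw [ip_cons, ih u fun j h h' e => by
        have := hu (j + 1) (by simpa using h) (by simpa using h')
        simpa using this (by simpa using e)]
      cases a <;> simp_all

/-- A nonzero vector has a last nonzero coordinate. -/
theorem exists_last (z : List Bool) (hz : true ∈ z) :
    ∃ k, ∃ hk : k < z.length, z[k] = true ∧ ∀ j (h : j < z.length), k < j → z[j] = false := by
  induction z using List.reverseRecOn with
  | nil => simp at hz
  | append_singleton z b ih =>
    rcases b with _ | _
    · obtain ⟨k, hk, h1, h2⟩ := ih (by simpa using hz)
      refine ⟨k, by simp; omega, by rw [List.getElem_append_left hk]; exact h1, fun j h hkj => ?_⟩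
      rw [List.getElem_append]
      split_ifs with hj
      · exact h2 j hj hkj
      · simp
    · refine ⟨z.length, by simp, by simp, fun j h hkj => ?_⟩
      simp at h
      omega

/-- A seed that changes the value of the `m`-th equation at the direction `z`, but neither the
values of the previous equations there nor the values of any equation at the point `x`: a cell of
the tape is flipped that the `m`-th equation pairs with the last nonzero coordinate of `z`, and so
the previous equations pair it with zeros; the constant terms are adjusted to `x`. -/
theorem exists_direction (m : Fin n) (x z : List Bool) (hz : z.length = n) (hz1 : true ∈ z) :
    ∃ δ : Seed n, (∀ i : Fin n, ip (δ.tape.eqv i) (true :: x) = false) ∧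
      ip (δ.tape.eqv m) (false :: z) = true ∧
      ∀ i : Fin n, i < m → ip (δ.tape.eqv i) (false :: z) = false := by
  obtain ⟨k, hk, h1, h2⟩ := exists_last z hz1
  obtain ⟨α, hα⟩ : ∃ α : Seed n, ∀ p, p < 2 * n → α.cell p = decide (p = m + k + 1) := by
    refine ⟨(fun i => decide (n - 1 - (i : ℕ) = m + k + 1), fun i =>
      (decide (n + (i : ℕ) = m + k + 1), false)), fun p hp => ?_⟩
    simp only [cell]
    split_ifs with h3 h4
    · congr 2; omega
    · congr 2; omega
    · omega
  have hcong : ∀ (c : Fin n → Bool) (i : ℕ), coefs ((α.1, fun i => ((α.2 i).1, c i)) : Seed n) i =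
      α.coefs i := fun c i => rfl
  refine ⟨(α.1, fun i => ((α.2 i).1, ip (α.coefs i) x)), fun i => ?_, ?_, fun i hi => ?_⟩
  · rw [eqv_tape, hcong, ip_cons]
    simp
  · rw [eqv_tape, hcong, ip_cons, Bool.and_false, Bool.false_xor,
      ip_single z k hk _ (fun j h => ?_) (by simp [coefs, hz]), h1]
    have hj : j < n := by simpa [coefs] using h
    simp only [coefs, List.getElem_ofFn]
    rw [hα _ (by omega), decide_eq_decide]
    omega
  · rw [eqv_tape, hcong, ip_cons, Bool.and_false, Bool.false_xor]
    refine ip_none z _ fun j h h' e => ?_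
    have hj : j < n := by simpa [coefs] using h
    simp only [coefs, List.getElem_ofFn] at e
    rw [hα _ (by omega), decide_eq_true_eq] at e
    exact h2 j h' (by have : (i : ℕ) < m := hi; omega)

open Finset in
/-- If a shift of the seed preserves `P` and changes `Q`, then `Q` holds with conditional
probability one half given `P`. -/
theorem card_half (δ : Seed n) (P Q : Seed n → Bool) (hP : ∀ ω : Seed n, P (ω.add δ) = P ω)
    (hQ : ∀ ω : Seed n, Q (ω.add δ) = !Q ω) :
    2 * #{ω | P ω = true ∧ Q ω = false} = #{ω | P ω = true} := by
  have h1 : #{ω | P ω = true ∧ Q ω = false} = #{ω | P ω = true ∧ Q ω = true} := by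
    refine card_bij' (fun ω _ => ω.add δ) (fun ω _ => ω.add δ) ?_ ?_ ?_ ?_
    · intro ω h
      simp only [mem_filter, mem_univ, true_and] at h ⊢
      rw [hP, hQ, h.1, h.2]
      exact ⟨rfl, rfl⟩
    · intro ω h
      simp only [mem_filter, mem_univ, true_and] at h ⊢
      rw [hP, hQ, h.1, h.2]
      exact ⟨rfl, rfl⟩
    · intro ω _; exact add_add ω δ
    · intro ω _; exact add_add ω δ
  have h2 := card_filter_add_card_filter_not (s := univ.filter fun ω : Seed n => P ω = true)
    (fun ω => Q ω = false)
  rw [filter_filter, filter_filter] at h2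
  simp only [Bool.not_eq_false] at h2
  omega

open Finset in
/-- A point lies in the cell of level `m` with probability `2⁻ᵐ`. -/
theorem card_inCell (x : List Bool) (m : ℕ) (hm : m ≤ n) :
    2 ^ m * #{ω : Seed n | ω.tape.inCell m (true :: x) = true} = Fintype.card (Seed n) := by
  induction m with
  | zero => simp [Tape.inCell]
  | succ m ih =>
    obtain ⟨δ, hδ⟩ := exists_const (⟨m, hm⟩ : Fin n)
    have hadd : ∀ ω : Seed n, ∀ i, i < n → ip ((ω.add δ).tape.eqv i) (true :: x) =
        xor (ip (ω.tape.eqv i) (true :: x)) (decide (i = m)) := by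
      intro ω i hi
      rw [ip_eqv_add ω δ ⟨i, hi⟩, hδ]
      simp
    have h := card_half δ (fun ω => ω.tape.inCell m (true :: x))
      (fun ω => ip (ω.tape.eqv m) (true :: x)) (fun ω => ?_) (fun ω => ?_)
    · rw [← ih (by omega), ← h, pow_succ]
      simp only [Tape.inCell_succ, Bool.and_eq_true, Bool.not_eq_true']
      ring
    · rw [Bool.eq_iff_iff]
      simp only [Tape.inCell, List.all_eq_true, List.mem_range]
      refine forall₂_congr fun i hi => ?_
      rw [hadd ω i (by omega)]
      simp [hi.ne]
    · rw [hadd ω m (by omega)]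
      simp

open Finset in
/-- Two different points both lie in the cell of level `m` with probability `4⁻ᵐ`. -/
theorem card_inCell₂ {x y : List Bool} (hx : x.length = n) (hy : y.length = n) (hxy : x ≠ y)
    (m : ℕ) (hm : m ≤ n) :
    4 ^ m * #{ω : Seed n | ω.tape.inCell m (true :: x) = true ∧
      ω.tape.inCell m (true :: y) = true} = Fintype.card (Seed n) := by
  have hz : (vx x y).length = n := length_vx hx hy
  have hz1 : true ∈ vx x y := by
    by_contra hcon
    refine hxy (List.ext_getElem (hx.trans hy.symm) fun j h1 h2 => ?_)
    have : (vx x y)[j]'(by rw [hz, ← hx]; exact h1) ≠ true := fun h => hcon (by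
      rw [← h]; exact List.getElem_mem _)
    simp only [vx, List.getElem_zipWith] at this
    simpa using this
  have hxz : vx (true :: x) (true :: y) = false :: vx x y := rfl
  have hipz : ∀ N, ip N (true :: y) = xor (ip N (true :: x)) (ip N (false :: vx x y)) := by
    intro N
    rw [← hxz, ip_vx N (by simp [hx, hy]), ← Bool.xor_assoc, Bool.xor_self, Bool.false_xor]
  induction m with
  | zero => simp [Tape.inCell]
  | succ m ih =>
    obtain ⟨δ, hδ⟩ := exists_const (⟨m, hm⟩ : Fin n)
    obtain ⟨η, h1, h2, h3⟩ := exists_direction (⟨m, hm⟩ : Fin n) x (vx x y) hz hz1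
    -- both equations at `x` and at `x + y` are shifted in the expected way
    have haddx : ∀ ω : Seed n, ∀ i, i < n → ip ((ω.add δ).tape.eqv i) (true :: x) =
        xor (ip (ω.tape.eqv i) (true :: x)) (decide (i = m)) := by
      intro ω i hi
      rw [ip_eqv_add ω δ ⟨i, hi⟩, hδ]
      simp
    have haddz : ∀ ω : Seed n, ∀ i, i < n → ip ((ω.add δ).tape.eqv i) (false :: vx x y) =
        ip (ω.tape.eqv i) (false :: vx x y) := by
      intro ω i hi
      rw [ip_eqv_add ω δ ⟨i, hi⟩, hδ]
      simp
    have haddx' : ∀ ω : Seed n, ∀ i, i < n → ip ((ω.add η).tape.eqv i) (true :: x) =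
        ip (ω.tape.eqv i) (true :: x) := by
      intro ω i hi
      rw [ip_eqv_add ω η ⟨i, hi⟩, h1 ⟨i, hi⟩]
      simp
    have haddz' : ∀ ω : Seed n, ∀ i, i < m → ip ((ω.add η).tape.eqv i) (false :: vx x y) =
        ip (ω.tape.eqv i) (false :: vx x y) := by
      intro ω i hi
      rw [ip_eqv_add ω η ⟨i, by omega⟩, h3 ⟨i, by omega⟩ hi]
      simp
    have hcx : ∀ ω : Seed n, (ω.add δ).tape.inCell m (true :: x) = ω.tape.inCell m (true :: x) := by
      intro ω
      rw [Bool.eq_iff_iff]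
      simp only [Tape.inCell, List.all_eq_true, List.mem_range]
      refine forall₂_congr fun i hi => ?_
      rw [haddx ω i (by omega)]
      simp [hi.ne]
    have hcy : ∀ ω : Seed n, (ω.add δ).tape.inCell m (true :: y) = ω.tape.inCell m (true :: y) := by
      intro ω
      rw [Bool.eq_iff_iff]
      simp only [Tape.inCell, List.all_eq_true, List.mem_range]
      refine forall₂_congr fun i hi => ?_
      rw [hipz, hipz, haddx ω i (by omega), haddz ω i (by omega)]
      simp [hi.ne]
    have hcx' : ∀ ω : Seed n, (ω.add η).tape.inCell m (true :: x) =
        ω.tape.inCell m (true :: x) := by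
      intro ω
      rw [Bool.eq_iff_iff]
      simp only [Tape.inCell, List.all_eq_true, List.mem_range]
      refine forall₂_congr fun i hi => ?_
      rw [haddx' ω i (by omega)]
    have hcy' : ∀ ω : Seed n, (ω.add η).tape.inCell m (true :: y) =
        ω.tape.inCell m (true :: y) := by
      intro ω
      rw [Bool.eq_iff_iff]
      simp only [Tape.inCell, List.all_eq_true, List.mem_range]
      refine forall₂_congr fun i hi => ?_
      rw [hipz, hipz, haddx' ω i (by omega), haddz' ω i hi]
    -- `η` halves the seeds by the value of the next equation at `x + y`, then `δ` by that at `x`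
    have e1 := card_half η (fun ω => ω.tape.inCell m (true :: x) && ω.tape.inCell m (true :: y))
      (fun ω => ip (ω.tape.eqv m) (false :: vx x y)) (fun ω => by simp only [hcx', hcy'])
      (fun ω => by
        rw [ip_eqv_add ω η ⟨m, hm⟩, h2]
        simp)
    have e2 := card_half δ (fun ω => (ω.tape.inCell m (true :: x) && ω.tape.inCell m (true :: y))
      && !ip (ω.tape.eqv m) (false :: vx x y))
      (fun ω => ip (ω.tape.eqv m) (true :: x))
      (fun ω => by simp only [hcx, hcy, haddz ω m (by omega)])
      (fun ω => by simp only [haddx ω m (by omega)]; simp)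
    have e3 : ∀ ω : Seed n, (ω.tape.inCell (m + 1) (true :: x) = true ∧
        ω.tape.inCell (m + 1) (true :: y) = true) ↔
        (((ω.tape.inCell m (true :: x) && ω.tape.inCell m (true :: y))
          && !ip (ω.tape.eqv m) (false :: vx x y)) = true ∧
          ip (ω.tape.eqv m) (true :: x) = false) := by
      intro ω
      rw [Tape.inCell_succ, Tape.inCell_succ, hipz]
      cases ω.tape.inCell m (true :: x) <;> cases ω.tape.inCell m (true :: y) <;>
        cases ip (ω.tape.eqv m) (true :: x) <;> cases ip (ω.tape.eqv m) (false :: vx x y) <;> simp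
    simp only [e3]
    simp only [Bool.and_eq_true, Bool.not_eq_true'] at e1 e2 ⊢
    rw [← ih (by omega), ← e1, ← e2, pow_succ]
    ring

end Seed

/-! ### The estimate of a row -/

section Moments

open Finset

variable {n : ℕ} {A : List (List Bool)}

/-- The number of points of `A` in the cell of level `m`. -/
def cellCount (A : List (List Bool)) (m : ℕ) (ω : Seed n) : ℕ :=
  (A.filter (ω.tape.inCell m)).length

theorem cellCount_eq (hA : A.Nodup) (m : ℕ) (ω : Seed n) :
    (cellCount A m ω : ℚ) = ∑ v ∈ A.toFinset, if ω.tape.inCell m v = true then 1 else 0 := by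
  rw [Finset.sum_boole, cellCount, ← List.toFinset_filter,
    List.toFinset_card_of_nodup (hA.filter _)]

theorem IsPoints.exists_eq (hA : IsPoints n A) {v : List Bool} (hv : v ∈ A.toFinset) :
    ∃ x : List Bool, v = true :: x ∧ x.length = n := by
  obtain ⟨h1, h2⟩ := hA.2 v (List.mem_toFinset.1 hv)
  rcases v with _ | ⟨b, x⟩
  · simp at h2
  · obtain rfl : b = true := by simpa using h2
    exact ⟨x, rfl, by simpa using h1⟩

/-- The expected number of points in a cell. -/
theorem sum_cellCount (hA : IsPoints n A) (m : ℕ) (hm : m ≤ n) :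
    2 ^ m * ∑ ω : Seed n, (cellCount A m ω : ℚ) = A.length * Fintype.card (Seed n) := by
  simp only [cellCount_eq hA.1]
  rw [Finset.sum_comm, Finset.mul_sum, ← List.toFinset_card_of_nodup hA.1, ← nsmul_eq_mul,
    ← Finset.sum_const]
  refine Finset.sum_congr rfl fun v hv => ?_
  obtain ⟨x, rfl, -⟩ := hA.exists_eq hv
  rw [Finset.sum_boole, ← Seed.card_inCell x m hm]
  push_cast
  rfl

/-- The second moment of the number of points in a cell, by pairwise independence. -/
theorem sum_cellCount_sq (hA : IsPoints n A) (m : ℕ) (hm : m ≤ n) :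
    4 ^ m * ∑ ω : Seed n, (cellCount A m ω : ℚ) ^ 2 =
      A.length * (2 ^ m + (A.length - 1)) * Fintype.card (Seed n) := by
  have key : ∀ v ∈ A.toFinset, ∀ w ∈ A.toFinset,
      4 ^ m * (∑ ω : Seed n, ((if ω.tape.inCell m v = true then 1 else 0) *
        (if ω.tape.inCell m w = true then 1 else 0) : ℚ)) =
      (if v = w then 2 ^ m - 1 else 0) * Fintype.card (Seed n) + Fintype.card (Seed n) := by
    intro v hv w hw
    obtain ⟨x, rfl, hx⟩ := hA.exists_eq hv
    obtain ⟨y, rfl, hy⟩ := hA.exists_eq hw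
    have e : ∀ ω : Seed n, ((if ω.tape.inCell m (true :: x) = true then 1 else 0) *
        (if ω.tape.inCell m (true :: y) = true then 1 else 0) : ℚ) =
        if ω.tape.inCell m (true :: x) = true ∧ ω.tape.inCell m (true :: y) = true then 1
          else 0 := by
      intro ω
      split_ifs <;> simp_all
    simp only [e]
    rw [Finset.sum_boole]
    by_cases hxy : x = y
    · subst hxy
      simp only [and_self, if_true]
      rw [← Seed.card_inCell x m hm, show (4 : ℚ) = 2 * 2 by norm_num, mul_pow]
      push_cast
      ring
    · rw [if_neg (by simpa using hxy), ← Seed.card_inCell₂ hx hy hxy m hm]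
      push_cast
      ring
  have e1 : ∀ ω : Seed n, (cellCount A m ω : ℚ) ^ 2 = ∑ v ∈ A.toFinset, ∑ w ∈ A.toFinset,
      ((if ω.tape.inCell m v = true then 1 else 0) *
        (if ω.tape.inCell m w = true then 1 else 0) : ℚ) := by
    intro ω
    rw [cellCount_eq hA.1, sq, Finset.sum_mul_sum]
  simp only [e1]
  rw [Finset.sum_comm, Finset.mul_sum]
  have e2 : ∀ v ∈ A.toFinset, (4 : ℚ) ^ m * ∑ ω : Seed n, ∑ w ∈ A.toFinset,
      ((if ω.tape.inCell m v = true then 1 else 0) *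
        (if ω.tape.inCell m w = true then 1 else 0) : ℚ) =
      (2 ^ m - 1) * Fintype.card (Seed n) + A.length * Fintype.card (Seed n) := by
    intro v hv
    rw [Finset.sum_comm, Finset.mul_sum, Finset.sum_congr rfl (key v hv), Finset.sum_add_distrib,
      ← Finset.sum_mul, Finset.sum_ite_eq, if_pos hv, Finset.sum_const, nsmul_eq_mul,
      List.toFinset_card_of_nodup hA.1]
  rw [Finset.sum_congr rfl e2, Finset.sum_const, nsmul_eq_mul, List.toFinset_card_of_nodup hA.1]
  ring

theorem variance_cellCount (hA : IsPoints n A) (m : ℕ) (hm : m ≤ n) :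
    ∑ ω : Seed n, (2 ^ m * (cellCount A m ω : ℚ) - A.length) ^ 2 ≤
      (A.length : ℚ) * 2 ^ m * (Fintype.card (Seed n) : ℚ) := by
  have h1 := sum_cellCount hA m hm
  have h2 := sum_cellCount_sq hA m hm
  have e : ∀ ω : Seed n, (2 ^ m * (cellCount A m ω : ℚ) - A.length) ^ 2 =
      4 ^ m * (cellCount A m ω : ℚ) ^ 2 - 2 * A.length * (2 ^ m * (cellCount A m ω : ℚ)) +
        (A.length : ℚ) ^ 2 := by
    intro ω
    rw [show (4 : ℚ) ^ m = 2 ^ m * 2 ^ m by rw [← mul_pow]; norm_num]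
    ring
  simp only [e]
  rw [Finset.sum_add_distrib, Finset.sum_sub_distrib, ← Finset.mul_sum, ← Finset.mul_sum,
    ← Finset.mul_sum, h1, h2, Finset.sum_const, nsmul_eq_mul, Finset.card_univ]
  have : (0 : ℚ) ≤ A.length * Fintype.card (Seed n) := by positivity
  nlinarith

theorem chebyshev_cellCount (hA : IsPoints n A) (m : ℕ) (hm : m ≤ n) (a : ℚ) (ha : 0 ≤ a) :
    (#{ω : Seed n | a < |2 ^ m * (cellCount A m ω : ℚ) - A.length|} : ℚ) * a ^ 2 ≤
      A.length * 2 ^ m * Fintype.card (Seed n) := by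
  refine le_trans ?_ (variance_cellCount hA m hm)
  rw [← nsmul_eq_mul]
  refine le_trans (Finset.card_nsmul_le_sum _
    (fun ω : Seed n => (2 ^ m * (cellCount A m ω : ℚ) - A.length) ^ 2) _ fun ω hω => ?_)
    (Finset.sum_le_sum_of_subset_of_nonneg (Finset.filter_subset _ _) fun ω _ _ => sq_nonneg _)
  rw [Finset.mem_filter] at hω
  rw [← sq_abs (2 ^ m * (cellCount A m ω : ℚ) - A.length)]
  exact pow_le_pow_left₀ ha hω.2.le 2

end Moments

theorem satTerm_replicate (k : ℕ) (v : List Bool) :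
    satTerm (List.replicate k (false, false)) v = true := by
  induction k generalizing v with
  | zero => rfl
  | succ k ih =>
    cases v with
    | nil => rfl
    | cons b v => simp [List.replicate_succ, satTerm, ih]

/-- The empty term is satisfied by all assignments. -/
theorem IsPoints.length_le {n : ℕ} {A : List (List Bool)} (hA : IsPoints n A) :
    A.length ≤ 2 ^ n := by
  set ts : List (Bool × Bool) := List.replicate n (false, false) with hts
  have hl : ts.length = n := by simp [hts]
  have h1 : A ⊆ space (termSpace ts) := by
    intro v hv
    obtain ⟨x, rfl, hx⟩ := hA.exists_eq (List.mem_toFinset.2 hv)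
    rw [mem_space_termSpace, hl]
    exact ⟨hx, satTerm_replicate n x⟩
  refine ((hA.1.subperm h1).length_le).trans ?_
  rw [space, ← (solsFrom_perm _ _).length_eq, length_solsFrom]
  obtain ⟨-, -, h3⟩ := isSpace_termSpace ts
  have h2 : (termSpace ts).1.length ≤ n := by
    simpa [termSpace, hl] using length_termGens_le ts
  calc _ ≤ 2 ^ n * 1 := Nat.mul_le_mul (Nat.pow_le_pow_right (by norm_num) h2) h3
    _ = 2 ^ n := by simp

theorem Row.Inv.est_eq {n : ℕ} {ω : Seed n} {K : ℕ} {A : List (List Bool)} {row : Row}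
    (h : row.Inv ω.tape K A) : ∃ j, row.est = 2 ^ j * cellCount A j ω ∧ cellCount A j ω ≤ K ∧
      ∀ i < j, K < cellCount A i ω := by
  obtain ⟨j, hj, hl, hr, hK, hp, hmin⟩ := h
  have h1 : row.left.countP Sym.isEq = j := by
    rw [hl, Tape.left, List.countP_append, List.countP_reverse, List.countP_eq_length.2,
      List.countP_eq_zero.2]
    · rw [ω.valid_tape.1] at hj
      simp [ω.valid_tape.length_eqs, hj]
    · intro s hs
      obtain ⟨b, -, rfl⟩ := List.mem_map.1 hs
      simp [Sym.isEq]
    · exact fun s hs => Tape.isEq_of_mem_eqs (List.mem_of_mem_take hs)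
  refine ⟨j, ?_, ?_, hmin⟩
  · rw [Row.est, h1, hp.length_eq]
    rfl
  · rw [cellCount, ← hp.length_eq]
    omega

open Finset in
/-- The estimate of a row is rarely bad. If there are more than `K` points, let `M` be the last
level whose cell has at least `K / 4` points on average. With high probability, the cells of all
levels up to `M` have roughly the size that is expected; then the level of the row is at most `M`,
and its estimate is good whatever it is. -/
theorem exists_bad_seeds {n : ℕ} {A : List (List Bool)} (hA : IsPoints n A) {K : ℕ} {η : ℚ}
    (hη : 0 < η) (hη1 : η ≤ 1 / 2) (hK : 128 ≤ K * η ^ 2) :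
    ∃ bad : Finset (Seed n), 16 * #bad ≤ Fintype.card (Seed n) ∧
      ∀ ω ∉ bad, ∀ row : Row, row.Inv ω.tape K A →
        |(row.est : ℚ) - A.length| ≤ η * A.length := by
  rcases Nat.lt_or_ge K A.length with hF | hF
  swap
  · -- all points fit into the bucket at level `0`, and the estimate is exact
    refine ⟨∅, by simp, fun ω _ row h => ?_⟩
    obtain ⟨j, h1, -, h3⟩ := h.est_eq
    have h0 : cellCount A 0 ω = A.length := by
      rw [cellCount, List.filter_eq_self.2]
      simp [Tape.inCell]
    rcases Nat.eq_zero_or_pos j with rfl | hj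
    · rw [h1, h0]
      simp
      positivity
    · have := h3 0 hj
      omega
  have hK0 : 0 < K := by
    rcases Nat.eq_zero_or_pos K with rfl | h
    · norm_num at hK
    · exact h
  have hF0 : (0 : ℚ) < A.length := by
    have : 0 < A.length := by omega
    exact_mod_cast this
  -- the last level with an average of at least `K / 4` points
  have hex : ∃ M, 4 * A.length < K * 2 ^ (M + 1) := by
    refine ⟨4 * A.length, (Nat.lt_two_pow_self).trans_le ?_⟩
    rw [pow_succ]
    nlinarith [Nat.two_pow_pos (4 * A.length)]
  obtain ⟨M, hM, hM'⟩ : ∃ M, 4 * A.length < K * 2 ^ (M + 1) ∧ K * 2 ^ M ≤ 4 * A.length := by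
    refine ⟨Nat.find hex, Nat.find_spec hex, ?_⟩
    rcases hm : Nat.find hex with _ | m
    · simp only [pow_zero, mul_one]; omega
    · exact not_lt.1 (Nat.find_min hex (m := m) (by omega))
  have hMn : M ≤ n := by
    have h1 := hA.length_le
    have h2 : 4 * 2 ^ M ≤ K * 2 ^ M := by
      refine Nat.mul_le_mul_right _ ?_
      have h4 : (4 : ℚ) ≤ K := by nlinarith [(by positivity : (0 : ℚ) ≤ K)]
      exact_mod_cast h4
    have h3 : 2 ^ M ≤ 2 ^ n := by omega
    exact (Nat.pow_le_pow_iff_right (by norm_num)).1 h3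
  have hMq : (K : ℚ) * 2 ^ M ≤ 4 * A.length := by exact_mod_cast hM'
  have hMq' : 4 * (A.length : ℚ) < K * 2 ^ (M + 1) := by exact_mod_cast hM
  refine ⟨(range (M + 1)).biUnion fun m =>
    {ω : Seed n | η * A.length < |2 ^ m * (cellCount A m ω : ℚ) - A.length|}, ?_, ?_⟩
  · -- the bounds from Chebyshev's inequality form a geometric series
    have h1 : ∀ m ∈ range (M + 1),
        (#{ω : Seed n | η * A.length < |2 ^ m * (cellCount A m ω : ℚ) - A.length|} : ℚ) ≤
        2 ^ m * (Fintype.card (Seed n) / (η ^ 2 * A.length)) := by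
      intro m hm
      rw [mem_range] at hm
      have := chebyshev_cellCount hA m (by omega) (η * A.length) (by positivity)
      rw [← mul_div_assoc, le_div_iff₀ (by positivity)]
      refine le_of_mul_le_mul_right ?_ hF0
      linarith
    have h2 : (#((range (M + 1)).biUnion fun m =>
        {ω : Seed n | η * A.length < |2 ^ m * (cellCount A m ω : ℚ) - A.length|}) : ℚ) ≤
        ∑ m ∈ range (M + 1), 2 ^ m * (Fintype.card (Seed n) / (η ^ 2 * A.length)) := by
      refine le_trans ?_ (sum_le_sum h1)
      exact_mod_cast card_biUnion_le
    rw [← sum_mul, geom_sum_eq (by norm_num)] at h2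
    have h3 : 16 * ((2 ^ (M + 1) - 1) / (2 - 1) * (Fintype.card (Seed n) / (η ^ 2 * A.length)))
        ≤ (Fintype.card (Seed n) : ℚ) := by
      have hN : (0 : ℚ) ≤ Fintype.card (Seed n) := by positivity
      have h4 : 16 * (2 ^ (M + 1) - 1) ≤ η ^ 2 * (A.length : ℚ) := by
        have : 128 * (2 : ℚ) ^ M ≤ K * η ^ 2 * 2 ^ M :=
          mul_le_mul_of_nonneg_right hK (by positivity)
        have h5 : η ^ 2 * (K * 2 ^ M) ≤ η ^ 2 * (4 * A.length) :=
          mul_le_mul_of_nonneg_left hMq (by positivity)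
        rw [pow_succ]
        linarith
      rw [show (2 : ℚ) - 1 = 1 by norm_num, div_one, ← mul_assoc, ← mul_div_assoc,
        div_le_iff₀ (by positivity)]
      nlinarith
    have h6 : (16 * #((range (M + 1)).biUnion fun m =>
        {ω : Seed n | η * A.length < |2 ^ m * (cellCount A m ω : ℚ) - A.length|}) : ℚ) ≤
        Fintype.card (Seed n) := by linarith
    exact_mod_cast h6
  · intro ω hω row h
    have hgood : ∀ m ≤ M, |2 ^ m * (cellCount A m ω : ℚ) - A.length| ≤ η * A.length := by
      intro m hm
      by_contra hcon
      refine hω (mem_biUnion.2 ⟨m, mem_range.2 (by omega), ?_⟩)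
      simpa using hcon
    obtain ⟨j, h1, -, h3⟩ := h.est_eq
    -- the cell of level `M` has at most `(1 + η) |A| / 2 ^ M < (3 / 2) (K / 2) < K` points
    have hj : j ≤ M := by
      by_contra hcon
      have h4 := h3 M (by omega)
      have h5 := (abs_le.1 (hgood M le_rfl)).2
      have h6 : (K : ℚ) < cellCount A M ω := by exact_mod_cast h4
      have h7 : (2 : ℚ) ^ M * K < 2 ^ M * cellCount A M ω :=
        mul_lt_mul_of_pos_left h6 (by positivity)
      rw [pow_succ] at hMq'
      nlinarith
    have := hgood j hj
    rw [h1]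
    push_cast
    exact this

/-! ### The median -/

/-- The median lies in an interval if fewer than half of the numbers lie outside. -/
theorem median_mem (es : List ℕ) (lo hi : ℚ) (hhi : 0 ≤ hi)
    (h : 2 * es.countP (fun e : ℕ => !decide (lo ≤ (e : ℚ) ∧ (e : ℚ) ≤ hi)) < es.length) :
    lo ≤ median es ∧ (median es : ℚ) ≤ hi := by
  have hcount : ∀ r, es.countP (· ≤ r) + es.countP (r < ·) = es.length := by
    intro r
    rw [List.length_eq_countP_add_countP (l := es) (· ≤ r)]
    congr 2
    funext e
    simp
  constructor
  · by_contra hcon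
    have h1 : majority es (median es) = false := Nat.find_spec (exists_not_majority es)
    simp only [majority, decide_eq_false_iff_not, not_lt] at h1
    have h2 : es.countP (· ≤ median es) ≤
        es.countP (fun e : ℕ => !decide (lo ≤ (e : ℚ) ∧ (e : ℚ) ≤ hi)) := by
      refine List.countP_mono_left fun e _ he => ?_
      have he' : (e : ℚ) ≤ median es := by
        have : e ≤ median es := by simpa using he
        exact_mod_cast this
      simp only [Bool.not_eq_true', decide_eq_false_iff_not]
      intro h3
      linarith [h3.1]
    have := hcount (median es)
    omega
  · by_contra hcon
    have h0 : 0 < median es := by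
      by_contra h0
      have : median es = 0 := by omega
      rw [this] at hcon
      exact hcon (by simpa using hhi)
    have h1 : majority es (median es - 1) = true := by
      have := Nat.find_min (exists_not_majority es) (m := median es - 1) (by
        change median es - 1 < median es
        omega)
      simpa using this
    simp only [majority, decide_eq_true_eq] at h1
    have h2 : es.countP (median es - 1 < ·) ≤
        es.countP (fun e : ℕ => !decide (lo ≤ (e : ℚ) ∧ (e : ℚ) ≤ hi)) := by
      refine List.countP_mono_left fun e _ he => ?_
      have he' : (median es : ℚ) ≤ e := by
        have : median es - 1 < e := by simpa using he
        have : median es ≤ e := by omega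
        exact_mod_cast this
      simp only [Bool.not_eq_true', decide_eq_false_iff_not]
      intro h3
      linarith [h3.2]
    have := hcount (median es - 1)
    omega

open Finset in
/-- If each of `t` independent experiments fails with probability at most `1 / 16`, then at least
half of them fail with probability at most `2⁻ᵗ`. -/
theorem card_half_bad {Ω : Type*} [Fintype Ω] [DecidableEq Ω] (bad : Finset Ω)
    (h : 16 * #bad ≤ Fintype.card Ω) (t : ℕ) :
    2 ^ t * #{ω : Fin t → Ω | t ≤ 2 * #{j | ω j ∈ bad}} ≤ Fintype.card Ω ^ t := by
  -- Markov's inequality for `16 ^ f`, where `f` is the number of failures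
  have h1 : ∑ ω : Fin t → Ω, ∏ j, (if ω j ∈ bad then 16 else 1) =
      (∑ ω : Ω, if ω ∈ bad then 16 else 1) ^ t := by
    rw [Finset.sum_pow', Fintype.piFinset_univ]
  have h2 : (∑ ω : Ω, if ω ∈ bad then 16 else 1) ≤ 2 * Fintype.card Ω := by
    have : ∀ ω : Ω, (if ω ∈ bad then 16 else 1) = (if ω ∈ bad then 15 else 0) + 1 := by
      intro ω; split_ifs <;> rfl
    simp only [this]
    rw [sum_add_distrib, ← sum_filter, sum_const, sum_const, card_univ, filter_mem_eq_inter,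
      univ_inter]
    simp only [smul_eq_mul, mul_one]
    omega
  have h3 : 4 ^ t * #{ω : Fin t → Ω | t ≤ 2 * #{j | ω j ∈ bad}} ≤
      ∑ ω : Fin t → Ω, ∏ j, (if ω j ∈ bad then 16 else 1) := by
    refine le_trans ?_ (sum_le_sum_of_subset (filter_subset
      (fun ω : Fin t → Ω => t ≤ 2 * #{j | ω j ∈ bad}) univ))
    rw [mul_comm, ← smul_eq_mul]
    refine card_nsmul_le_sum _ _ _ fun ω hω => ?_
    rw [mem_filter] at hω
    rw [← prod_filter, prod_const, show 16 = 4 ^ 2 by norm_num, ← pow_mul]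
    exact Nat.pow_le_pow_right (by norm_num) hω.2
  rw [h1] at h3
  have h4 := h3.trans (Nat.pow_le_pow_left h2 t)
  rw [mul_pow, show 4 ^ t = 2 ^ t * 2 ^ t by rw [← mul_pow]; norm_num, mul_assoc] at h4
  exact Nat.le_of_mul_le_mul_left h4 (Nat.two_pow_pos t)

/-! ### Counting the random bits -/

/-- A list is determined by the concatenation of the codes of its entries, if these have the same
length. -/
theorem flatMap_injOn {α β : Type*} {f : α → List β} {m : ℕ} {P : α → Prop}
    (hm : ∀ a, P a → (f a).length = m) (hf : ∀ a b, P a → P b → f a = f b → a = b)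
    {l l' : List α} (hl : ∀ a ∈ l, P a) (hl' : ∀ a ∈ l', P a) (hlen : l.length = l'.length)
    (h : l.flatMap f = l'.flatMap f) : l = l' := by
  induction l generalizing l' with
  | nil => exact (List.length_eq_zero_iff.1 hlen.symm).symm
  | cons a l ih =>
    rcases l' with _ | ⟨b, l'⟩
    · simp at hlen
    rw [List.flatMap_cons, List.flatMap_cons] at h
    obtain ⟨h1, h2⟩ := List.append_inj h (by rw [hm a (hl a (by simp)), hm b (hl' b (by simp))])
    rw [hf a b (hl a (by simp)) (hl' b (by simp)) h1, ih (fun a h => hl a (by simp [h]))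
      (fun a h => hl' a (by simp [h])) (by simpa using hlen) h2]

theorem Tape.Valid.length_bits {n : ℕ} {tp : Tape} (h : tp.Valid n) : tp.bits.length = 3 * n := by
  obtain ⟨h1, h2⟩ := h
  simp [Tape.bits, h1, h2, List.length_flatMap]
  omega

theorem Tape.Valid.bits_inj {n : ℕ} {tp tp' : Tape} (h : tp.Valid n) (h' : tp'.Valid n)
    (e : tp.bits = tp'.bits) : tp = tp' := by
  obtain ⟨h1, h2⟩ := List.append_inj e (by rw [h.1, h'.1])
  have h3 := flatMap_injOn (P := fun _ => True) (m := 2) (fun _ _ => rfl)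
    (fun a b _ _ hab => by
      simp only [List.cons.injEq, and_true] at hab
      exact Prod.ext hab.1 hab.2) (by simp) (by simp) (by rw [h.2, h'.2]) h2
  cases tp
  cases tp'
  simp_all

/-- The tapes of the rows with the given seeds. -/
def seedTapes {n t : ℕ} (ω : Fin t → Seed n) : List Tape := List.ofFn fun j => (ω j).tape

theorem valid_seedTapes {n t : ℕ} (ω : Fin t → Seed n) : ∀ tp ∈ seedTapes ω, tp.Valid n := by
  intro tp h
  obtain ⟨j, rfl⟩ := List.mem_ofFn.1 h
  exact (ω j).valid_tape

theorem length_seedTapes {n t : ℕ} (ω : Fin t → Seed n) : (seedTapes ω).length = t := by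
  simp [seedTapes]

/-- Uniformly distributed random bits amount to independent uniformly distributed seeds of the
rows. -/
theorem exists_bijective_bits (n t : ℕ) :
    ∃ f : (Fin t → Seed n) → (Fin (t * (3 * n)) → Bool), Bijective f ∧
      ∀ ω, List.ofFn (f ω) = (seedTapes ω).flatMap Tape.bits := by
  have hlen : ∀ ω : Fin t → Seed n,
      ((seedTapes ω).flatMap Tape.bits).length = t * (3 * n) := by
    intro ω
    rw [List.length_flatMap, List.map_eq_map_iff.2 fun tp h =>
      (valid_seedTapes ω tp h).length_bits (n := n)]
    simp [length_seedTapes]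
  have hof : ∀ ω : Fin t → Seed n, List.ofFn (fun i : Fin (t * (3 * n)) =>
      ((seedTapes ω).flatMap Tape.bits)[i]'(by rw [hlen]; exact i.2)) =
      (seedTapes ω).flatMap Tape.bits := by
    intro ω
    refine List.ext_getElem (by rw [List.length_ofFn, hlen]) fun i _ _ => ?_
    simp
  refine ⟨fun ω i => ((seedTapes ω).flatMap Tape.bits)[i]'(by rw [hlen]; exact i.2), ?_, hof⟩
  rw [Fintype.bijective_iff_injective_and_card]
  refine ⟨fun ω ω' h => ?_, ?_⟩
  · have h1 : (seedTapes ω).flatMap Tape.bits = (seedTapes ω').flatMap Tape.bits := by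
      rw [← hof ω, ← hof ω']
      exact congrArg List.ofFn h
    have h2 := flatMap_injOn (P := (Tape.Valid · n)) (fun tp h => h.length_bits)
      (fun _ _ h h' => h.bits_inj h')
      (valid_seedTapes ω) (valid_seedTapes ω') (by simp [length_seedTapes]) h1
    have h3 := List.ofFn_injective h2
    funext j
    have h4 := congrFun h3 j
    simp only [Seed.tape, Tape.mk.injEq] at h4
    exact Prod.ext (List.ofFn_injective h4.1) (List.ofFn_injective h4.2)
  · simp only [Fintype.card_fun, Fintype.card_prod, Fintype.card_bool, Fintype.card_fin]
    rw [← mul_pow, ← pow_mul, show 2 * (2 * 2) = 2 ^ 3 by norm_num, ← pow_mul]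
    congr 1
    ring

/-! ### The points of a stream -/

theorem satTerm_termPairs {n : ℕ} (T : Term n) (x : Fin n → Bool) :
    satTerm (termPairs T) (List.ofFn x) = true ↔ ∀ l ∈ T, x l.1 = l.2 := by
  have key : ∀ L : List (Fin n), satTerm (L.map fun i => (decide ((i, true) ∈ T),
      decide ((i, false) ∈ T))) (L.map x) = true ↔ ∀ i ∈ L, ∀ b, (i, b) ∈ T → x i = b := by
    intro L
    induction L with
    | nil => simp [satTerm]
    | cons i L ih =>
      rw [List.map_cons, List.map_cons, satTerm, Bool.and_eq_true, ih]
      simp only [List.mem_cons, forall_eq_or_imp, Bool.forall_bool]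
      cases x i <;> simp
  rw [List.ofFn_eq_map, termPairs, key]
  exact ⟨fun h l hl => h l.1 (List.mem_finRange _) l.2 hl, fun h i _ b hb => h (i, b) hb⟩

/-- The list of the elements of the union of the DNF sets of a stream, each as the vector of its
coordinates with a leading one. -/
def streamPoints {n : ℕ} (stream : List (DNF n)) : List (List Bool) :=
  stream.foldl (fun A φ => addTerms (φ.map termPairs) A) []

theorem mem_addTerms {n : ℕ} (φ : DNF n) (A : List (List Bool)) (x : Fin n → Bool) :
    true :: List.ofFn x ∈ addTerms (φ.map termPairs) A ↔ true :: List.ofFn x ∈ A ∨ Sat φ x := by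
  induction φ generalizing A with
  | nil => simp [addTerms, Sat]
  | cons T φ ih =>
    have := ih (addTerm (termPairs T) A)
    rw [addTerms] at this
    rw [addTerms, List.map_cons, List.foldl_cons, this, mem_addTerm (by simp), satTerm_termPairs]
    simp [Sat, or_assoc]

theorem mem_streamPoints {n : ℕ} (stream : List (DNF n)) (x : Fin n → Bool) :
    true :: List.ofFn x ∈ streamPoints stream ↔ ∃ φ ∈ stream, Sat φ x := by
  induction stream using List.reverseRecOn with
  | nil => simp [streamPoints]
  | append_singleton stream φ ih =>
    rw [streamPoints, List.foldl_append, List.foldl_cons, List.foldl_nil, mem_addTerms]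
    rw [streamPoints] at ih
    rw [ih]
    simp [or_and_right, exists_or]

/-- The points of a stream are listed without repetition. -/
theorem length_eq_F0 {n : ℕ} {stream : List (DNF n)} (h : IsPoints n (streamPoints stream)) :
    (streamPoints stream).length = F0 stream := by
  classical
  have e : ((streamPoints stream).toFinset : Set (List Bool)) =
      (fun x : Fin n → Bool => true :: List.ofFn x) '' (⋃ φ ∈ stream, dnfSet φ) := by
    ext v
    simp only [List.coe_toFinset, Set.mem_ofPred_eq, Set.mem_image, Set.mem_iUnion]
    constructor
    · intro hv
      obtain ⟨x, rfl, hx⟩ := h.exists_eq (List.mem_toFinset.2 hv)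
      obtain ⟨y, rfl⟩ : ∃ y : Fin n → Bool, x = List.ofFn y := by
        subst hx
        exact ⟨x.get, (List.ofFn_get x).symm⟩
      rw [mem_streamPoints] at hv
      exact ⟨y, by simpa [dnfSet] using hv, rfl⟩
    · rintro ⟨x, hx, rfl⟩
      rw [mem_streamPoints]
      simpa [dnfSet] using hx
  rw [F0, ← Set.ncard_image_of_injective (f := fun x : Fin n → Bool => true :: List.ofFn x) _
    (fun x y hxy => List.ofFn_injective (List.cons.inj hxy).2), ← e, Set.ncard_coe_finset,
    List.toFinset_card_of_nodup h.1]

/-! ### The algorithm -/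

/-- The streaming algorithm for DNF sets. -/
noncomputable def algorithm : StreamingAlgorithm :=
  ⟨coinsMachine, initMachine, updateMachine, reportMachine⟩

/-- The memory after a stream consists of rows for the points of the stream. -/
theorem exists_memoryAfter {n : ℕ} {ε δ : ℚ} (hε : 0 < ε) (hδ : 0 < δ)
    {r : Fin (numRows δ * (3 * n)) → Bool} {ω : Fin (numRows δ) → Seed n}
    (hr : List.ofFn r = (seedTapes ω).flatMap Tape.bits) (stream : List (DNF n)) :
    ∃ rows, algorithm.MemoryAfter ε δ r stream (memory rows) ∧
      MemInv n (thresh ε) (seedTapes ω) (streamPoints stream) rows ∧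
      IsPoints n (streamPoints stream) := by
  induction stream using List.reverseRecOn with
  | nil =>
    refine ⟨_, .start ?_, .start _ _ (valid_seedTapes ω), by simp [IsPoints, streamPoints]⟩
    rw [StreamingAlgorithm.Starts, hr]
    exact init_outputs hε hδ _ (valid_seedTapes ω) (length_seedTapes ω)
  | append_singleton stream φ ih =>
    obtain ⟨rows, h1, h2, h3⟩ := ih
    have h4 := h2.procTerms h3 (φ.map termPairs) (by simp)
    refine ⟨_, .item h1 (update_outputsWithin h2 h3 φ), ?_⟩
    simpa [streamPoints] using h4

theorem StreamingAlgorithm.MemoryAfter.unique {A : StreamingAlgorithm} {n : ℕ} {ε δ : ℚ} {R : ℕ}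
    {r : Fin R → Bool} {stream : List (DNF n)} {s s' : List Bool}
    (h : A.MemoryAfter ε δ r stream s) (h' : A.MemoryAfter ε δ r stream s') : s = s' := by
  induction h generalizing s' with
  | start h =>
    generalize hst : ([] : List (DNF n)) = st at h'
    cases h' with
    | start h' => exact h.choose_spec.unique h'.choose_spec
    | item => simp at hst
  | @item stream s₁ s₂ φ t h hu ih =>
    generalize hst : stream ++ [φ] = st at h'
    cases h' with
    | start h' => simp at hst
    | item h' hu' =>
      obtain ⟨rfl, e⟩ := List.append_inj' hst rfl
      obtain rfl : φ = _ := by simpa using e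
      obtain rfl := ih h'
      exact hu.unique hu'

/-- Whatever the random bits, the memory after a stream consists of rows for its points. -/
theorem exists_rows {n : ℕ} {ε δ : ℚ} (hε : 0 < ε) (hδ : 0 < δ)
    {r : Fin (numRows δ * (3 * n)) → Bool} {stream : List (DNF n)} {s : List Bool}
    (h : algorithm.MemoryAfter ε δ r stream s) :
    ∃ (tps : List Tape) (rows : List Row), tps.length = numRows δ ∧ s = memory rows ∧
      MemInv n (thresh ε) tps (streamPoints stream) rows ∧ IsPoints n (streamPoints stream) := by
  obtain ⟨f, hf, hbits⟩ := exists_bijective_bits n (numRows δ)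
  obtain ⟨ω, rfl⟩ := hf.2 r
  obtain ⟨rows, h1, h2, h3⟩ := exists_memoryAfter hε hδ (hbits ω) stream
  exact ⟨_, rows, length_seedTapes ω, h.unique h1, h2, h3⟩

theorem MemInv.exists_inv {n K : ℕ} {tps : List Tape} {A : List (List Bool)} {rows : List Row}
    (h : MemInv n K tps A rows) {row : Row} (hrow : row ∈ rows) : ∃ tp, row.Inv tp K A := by
  induction h with
  | nil => simp at hrow
  | cons h _ ih =>
    rcases List.mem_cons.1 hrow with rfl | h'
    · exact ⟨_, h.2⟩
    · exact ih h'

theorem exists_reports {n K : ℕ} {tps : List Tape} {A : List (List Bool)} {rows : List Row}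
    (h : MemInv n K tps A rows) (hA : IsPoints n A) :
    algorithm.Reports (memory rows) (median (rows.map Row.est).reverse) := by
  obtain ⟨a, h1, h2⟩ := report_outputs rows fun row hrow => by
    obtain ⟨tp, hinv⟩ := h.exists_inv hrow
    refine ⟨hinv.clean, fun hnil => ?_⟩
    obtain ⟨j, -, -, -, -, hp, -⟩ := hinv
    have := (hA.2 [] (List.mem_of_mem_filter (hp.mem_iff.1 hnil))).1
    simp at this
  exact ⟨a, [true], h2, by rw [h1]; simp [ofBits]⟩

/-! ### Bounds for space and time -/

theorem den_div_num {x : ℚ} (hx : 0 < x) : x.den / x.num.natAbs = ⌊1 / x⌋₊ := by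
  rw [← Nat.floor_div_eq_div (K := ℚ)]
  congr 1
  rw [Nat.cast_natAbs, abs_of_pos (Rat.num_pos.2 hx)]
  conv_rhs => rw [← Rat.num_div_den x]
  rw [one_div_div]

theorem thresh_pos (ε : ℚ) : 0 < thresh ε := by
  unfold thresh
  positivity

theorem numRows_pos {δ : ℚ} (hδ : 0 < δ) (hδ1 : δ ≤ 1) : 0 < numRows δ := by
  rw [numRows, Nat.size_pos, den_div_num hδ, Nat.floor_pos]
  exact (one_le_div hδ).2 hδ1

theorem thresh_le {ε : ℚ} (hε : 0 < ε) : (thresh ε : ℝ) ≤ 2 ^ 12 * max 1 (1 / (ε : ℝ) ^ 2) := by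
  have hε' : (0 : ℝ) < ε := by exact_mod_cast hε
  have h1 : ((⌊1 / ε⌋₊ : ℕ) : ℝ) ≤ 1 / (ε : ℝ) := by
    have := Nat.floor_le (by positivity : 0 ≤ 1 / ε)
    exact_mod_cast this
  have h0 : (0 : ℝ) ≤ (⌊1 / ε⌋₊ : ℕ) := by positivity
  set q : ℝ := ((⌊1 / ε⌋₊ : ℕ) : ℝ)
  have h2 : q * q ≤ 1 / (ε : ℝ) ^ 2 := by
    rw [show 1 / (ε : ℝ) ^ 2 = 1 / ε * (1 / ε) by field_simp]
    exact mul_le_mul h1 h1 h0 (h0.trans h1)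
  have h3 := le_max_left 1 (1 / (ε : ℝ) ^ 2)
  have h4 := h2.trans (le_max_right 1 (1 / (ε : ℝ) ^ 2))
  rw [thresh, den_div_num hε]
  push_cast
  nlinarith [sq_nonneg (q - 1)]

theorem numRows_le {δ : ℚ} (hδ : 0 < δ) (hδ1 : δ ≤ 1) :
    (numRows δ : ℝ) ≤ 3 * max 1 (Real.log (1 / (δ : ℝ))) := by
  have hδ' : (0 : ℝ) < δ := by exact_mod_cast hδ
  have h0 := numRows_pos hδ hδ1
  have h1 : 2 ^ (numRows δ - 1) ≤ ⌊1 / δ⌋₊ := by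
    rw [← den_div_num hδ, ← Nat.lt_size]
    exact Nat.sub_lt h0 one_pos
  have h2 : (2 : ℝ) ^ (numRows δ - 1) ≤ 1 / (δ : ℝ) := by
    have := (Nat.cast_le (α := ℚ).2 h1).trans (Nat.floor_le (by positivity : 0 ≤ 1 / δ))
    exact_mod_cast this
  have h3 := Real.log_le_log (by positivity) h2
  rw [Real.log_pow, Nat.cast_sub h0] at h3
  have h4 := le_max_left 1 (Real.log (1 / (δ : ℝ)))
  have h5 := h3.trans (le_max_right 1 (Real.log (1 / (δ : ℝ))))
  have h6 : (0 : ℝ) ≤ (numRows δ : ℝ) - (1 : ℕ) := by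
    have : (1 : ℝ) ≤ numRows δ := by exact_mod_cast h0
    simpa using this
  have h7 := Real.log_two_gt_d9
  push_cast at *
  nlinarith

theorem thresh_mul_numRows_le {ε δ : ℚ} (hε : 0 < ε) (hδ : 0 < δ) (hδ1 : δ ≤ 1) :
    (thresh ε : ℝ) * numRows δ ≤
      12288 * (max 1 (1 / (ε : ℝ) ^ 2) * max 1 (Real.log (1 / (δ : ℝ)))) :=
  (mul_le_mul (thresh_le hε) (numRows_le hδ hδ1) (by positivity) (by positivity)).trans_eq (by ring)

theorem rowSize_le {n K : ℕ} (hn : 0 < n) (hK : 0 < K) : rowSize n K ≤ 9 * (n * K) := by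
  have h1 : n ≤ n * K := Nat.le_mul_of_pos_right _ hK
  have h2 : K ≤ n * K := Nat.le_mul_of_pos_left _ hn
  rw [rowSize, show (n + 1) * K = n * K + K by ring]
  omega

theorem updateTime_le {n K t : ℕ} (hn : 0 < n) (hK : 0 < K) (ht : 0 < t) (k : ℕ) :
    itemTime n K t k + 6 * (t * rowSize n K) + (2 * n + 1) * k + 2 ≤
      10 ^ 4 * (n ^ 4 * max 1 k * (K * t)) := by
  have e1 : rowTime n K ≤ 8000 * (n ^ 3 * K) := by
    refine (rowTime_le n K).trans ?_
    have h1 : (n + 1) ^ 3 ≤ (2 * n) ^ 3 := Nat.pow_le_pow_left (by omega) 3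
    calc 500 * (n + 1) ^ 3 * (K + 1) ≤ 500 * (2 * n) ^ 3 * (2 * K) :=
          Nat.mul_le_mul (Nat.mul_le_mul_left _ h1) (by omega)
      _ = 8000 * (n ^ 3 * K) := by ring
  have e2 := rowSize_le hn hK
  have e3 : n * K ≤ n ^ 3 * K := Nat.mul_le_mul_right _ (Nat.le_self_pow (by norm_num) n)
  have e4 : n ≤ n * K := Nat.le_mul_of_pos_right _ hK
  have e5 : termTime n K t ≤ 8109 * (n ^ 3 * K * t) := by
    have h1 : n ^ 3 * K ≤ n ^ 3 * K * t := Nat.le_mul_of_pos_right _ ht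
    have h2 : rowTime n K + 8 * rowSize n K + 22 ≤ 8094 * (n ^ 3 * K) := by omega
    have h3 := Nat.mul_le_mul_right t h2
    rw [mul_assoc] at h3
    rw [termTime]
    omega
  have e6 : t * rowSize n K ≤ 9 * (n ^ 3 * K * t) := by
    rw [mul_comm]
    calc _ ≤ 9 * (n ^ 3 * K) * t := Nat.mul_le_mul_right _ (by omega)
      _ = _ := by ring
  have e7 : n ≤ n ^ 3 * K * t := e4.trans (e3.trans (Nat.le_mul_of_pos_right _ ht))
  have e8 : n ^ 3 * K * t * max 1 k ≤ n ^ 4 * max 1 k * (K * t) := by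
    calc _ = n ^ 3 * (max 1 k * (K * t)) := by ring
      _ ≤ n ^ 4 * (max 1 k * (K * t)) :=
        Nat.mul_le_mul_right _ (Nat.pow_le_pow_right hn (by norm_num))
      _ = _ := by ring
  have e9 : n ^ 3 * K * t ≤ n ^ 3 * K * t * max 1 k := Nat.le_mul_of_pos_right _ (by simp)
  have e10 : termTime n K t * k ≤ 8109 * (n ^ 3 * K * t * max 1 k) :=
    (Nat.mul_le_mul e5 (le_max_right 1 k)).trans_eq (by ring)
  have e11 : n * k ≤ n ^ 3 * K * t * max 1 k := Nat.mul_le_mul e7 (le_max_right 1 k)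
  have e12 : k ≤ n * k := Nat.le_mul_of_pos_left _ hn
  rw [itemTime, show (3 * n + 2) * k = 3 * (n * k) + 2 * k by ring,
    show (2 * n + 1) * k = 2 * (n * k) + k by ring]
  omega

/-! ### The success probability -/

theorem countP_le_of_forall₂ {α β : Type*} {R : α → β → Prop} {p : α → Bool} {q : β → Bool}
    (h : ∀ a b, R a b → q b = true → p a = true) {l : List α} {l' : List β}
    (hl : List.Forall₂ R l l') : l'.countP q ≤ l.countP p := by
  induction hl with
  | nil => simp
  | @cons a b l l' hab _ ih =>
    have := h a b hab
    rw [List.countP_cons, List.countP_cons]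
    split_ifs <;> simp_all
    omega

open Finset in
theorem countP_ofFn {α : Type*} {t : ℕ} (ω : Fin t → α) (p : α → Prop) [DecidablePred p] :
    (List.ofFn ω).countP (fun a => decide (p a)) = #{j | p (ω j)} := by
  rw [List.ofFn_eq_map, List.countP_map,
    show ((fun a => decide (p a)) ∘ ω) = fun j => decide (p (ω j)) from rfl, ← Multiset.coe_countP,
      Multiset.countP_eq_card_filter]
  simp [Finset.card, Finset.filter, Finset.univ, Fintype.elems]

open Finset in
/-- The median of the estimates is good if fewer than half of the seeds are bad. -/
theorem median_est_mem {n K t : ℕ} {ω : Fin t → Seed n} {A : List (List Bool)} {rows : List Row}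
    (h : MemInv n K (seedTapes ω) A rows) {η : ℚ} (hη : 0 < η) {bad : Finset (Seed n)}
    (hbad : ∀ ω ∉ bad, ∀ row : Row, row.Inv ω.tape K A →
      |(row.est : ℚ) - A.length| ≤ η * A.length) (hω : 2 * #{j | ω j ∈ bad} < t) :
    (1 - η) * A.length ≤ median (rows.map Row.est).reverse ∧
      (median (rows.map Row.est).reverse : ℚ) ≤ (1 + η) * A.length := by
  have h1 : rows.length = t := by rw [← h.length_eq, length_seedTapes]
  rw [show seedTapes ω = (List.ofFn ω).map Seed.tape by rw [List.map_ofFn]; rfl, MemInv,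
    List.forall₂_map_left_iff] at h
  refine median_mem _ _ _ (by positivity) ?_
  rw [List.countP_reverse, List.countP_map, List.length_reverse, List.length_map, h1]
  refine lt_of_le_of_lt (Nat.mul_le_mul_left 2 ?_) hω
  rw [← countP_ofFn ω (· ∈ bad)]
  refine countP_le_of_forall₂ (fun σ row hrow hq => ?_) h
  by_contra hσ
  have := abs_le.1 (hbad σ (by simpa using hσ) row hrow.2)
  have h2 : (1 - η) * (A.length : ℚ) ≤ row.est := by linarith
  have h3 : (row.est : ℚ) ≤ (1 + η) * A.length := by linarith
  simp [h2, h3] at hq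

/-- The buckets are large enough for the relative error `min 1 ε / 2` of a row. -/
theorem thresh_sq {ε : ℚ} (hε : 0 < ε) : 128 ≤ (thresh ε : ℚ) * (min 1 ε / 2) ^ 2 := by
  rw [thresh, den_div_num hε]
  set w : ℚ := ((⌊1 / ε⌋₊ + 1 : ℕ) : ℚ) with hw
  have h1 : 1 ≤ w * ε := by
    have := (Nat.lt_floor_add_one (1 / ε)).le
    rw [div_le_iff₀ hε] at this
    simpa [hw] using this
  have h2 : 1 ≤ w := by
    rw [hw]
    exact_mod_cast Nat.le_add_left 1 _
  have h3 : 1 ≤ w * min 1 ε := by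
    rcases min_choice 1 ε with h | h <;> rw [h]
    · simpa using h2
    · exact h1
  have h4 : 1 ≤ (w * min 1 ε) ^ 2 := one_le_pow₀ h3
  push_cast at hw ⊢
  rw [← hw]
  linarith [show 2 ^ 10 * (w * w) * (min 1 ε / 2) ^ 2 = 256 * (w * min 1 ε) ^ 2 by ring]

open Finset in
/-- The estimate is good with probability at least `1 - δ`. -/
theorem le_coinProb_succeeds {n : ℕ} {ε δ : ℚ} (hε : 0 < ε) (hδ : 0 < δ) (stream : List (DNF n)) :
    1 - (δ : ℝ) ≤ coinProb fun r : Fin (numRows δ * (3 * n)) → Bool =>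
      algorithm.Succeeds ε δ r stream := by
  obtain ⟨f, hf, hbits⟩ := exists_bijective_bits n (numRows δ)
  -- any seeds show that the points of the stream are listed without repetition
  obtain ⟨-, -, -, hA⟩ := exists_memoryAfter hε hδ (hbits fun _ => ⟨fun _ => true, fun _ => (true,
    true)⟩)
    stream
  have hη : 0 < min 1 ε / 2 := by positivity
  have hη1 : min 1 ε / 2 ≤ 1 / 2 := by linarith [min_le_left 1 ε]
  have hηε : min 1 ε / 2 ≤ ε / 2 := by linarith [min_le_right 1 ε]
  obtain ⟨bad, hcard, hbad⟩ := exists_bad_seeds hA hη hη1 (thresh_sq hε)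
  have hF := length_eq_F0 hA
  -- all seeds but few lead to success
  have hsucc : ∀ ω : Fin (numRows δ) → Seed n, ¬ numRows δ ≤ 2 * #{j | ω j ∈ bad} →
      algorithm.Succeeds ε δ (f ω) stream := by
    intro ω hω
    obtain ⟨rows, h1, h2, h3⟩ := exists_memoryAfter hε hδ (hbits ω) stream
    obtain ⟨h4, h5⟩ := median_est_mem h2 hη hbad (not_le.1 hω)
    rw [hF] at h4 h5
    refine ⟨_, _, h1, exists_reports h2 h3, le_trans ?_ h4, h5.trans ?_⟩
    · -- `(1 - η) (1 + ε) ≥ 1` as `η ≤ ε / 2` and `η ≤ 1 / 2`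
      rw [div_le_iff₀ (by linarith), mul_right_comm]
      refine le_mul_of_one_le_left (Nat.cast_nonneg _) ?_
      nlinarith [min_le_left 1 ε, min_le_right 1 ε]
    · refine mul_le_mul_of_nonneg_right ?_ (Nat.cast_nonneg _)
      linarith
  have h1 := card_half_bad bad hcard (numRows δ)
  have h2 : Fintype.card (Seed n) ^ numRows δ = 2 ^ (numRows δ * (3 * n)) := by
    have := Fintype.card_of_bijective hf
    simpa only [Fintype.card_fun, Fintype.card_fin, Fintype.card_bool] using this
  rw [h2] at h1
  have h3 := card_filter_add_card_filter_not (s := (univ : Finset (Fin (numRows δ) → Seed n)))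
    (fun ω => numRows δ ≤ 2 * #{j | ω j ∈ bad})
  rw [card_univ, Fintype.card_fun, Fintype.card_fin, h2] at h3
  have h4 : #{ω : Fin (numRows δ) → Seed n | ¬ numRows δ ≤ 2 * #{j | ω j ∈ bad}} ≤
      ({r | algorithm.Succeeds ε δ r stream} : Set (Fin (numRows δ * (3 * n)) → Bool)).ncard := by
    rw [← card_image_of_injective _ hf.1, ← Set.ncard_coe_finset]
    refine Set.ncard_le_ncard (fun r hr => ?_) (Set.toFinite _)
    simp only [coe_image, coe_filter, mem_univ, true_and] at hr
    obtain ⟨ω, hω, rfl⟩ := hr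
    exact hsucc ω hω
  -- the number of rows is so large that `2 ^ (-t) ≤ δ`
  have h5 : 1 / (δ : ℝ) ≤ 2 ^ numRows δ := by
    have h : ⌊1 / δ⌋₊ < 2 ^ numRows δ := by
      rw [numRows, den_div_num hδ]
      exact Nat.lt_size_self _
    rw [Nat.floor_lt (by positivity)] at h
    exact_mod_cast h.le
  have hδ' : (0 : ℝ) < δ := by exact_mod_cast hδ
  rw [div_le_iff₀ hδ'] at h5
  rw [coinProb, le_div_iff₀ (by positivity)]
  set a := #{ω : Fin (numRows δ) → Seed n | numRows δ ≤ 2 * #{j | ω j ∈ bad}}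
  set b := #{ω : Fin (numRows δ) → Seed n | ¬ numRows δ ≤ 2 * #{j | ω j ∈ bad}}
  have h1' : (2 : ℝ) ^ numRows δ * a ≤ 2 ^ (numRows δ * (3 * n)) := by exact_mod_cast h1
  have h3' : (a : ℝ) + b = 2 ^ (numRows δ * (3 * n)) := by exact_mod_cast h3
  have h6 : (a : ℝ) ≤ δ * 2 ^ (numRows δ * (3 * n)) := by
    calc (a : ℝ) ≤ 2 ^ numRows δ * δ * a := le_mul_of_one_le_left (Nat.cast_nonneg _) h5
      _ = δ * (2 ^ numRows δ * a) := by ring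
      _ ≤ _ := mul_le_mul_of_nonneg_left h1' hδ'.le
  refine le_trans ?_ (Nat.cast_le.2 h4)
  linarith

end DNFStream

theorem mainTheorem1 :
    ∃ (A : DNFStream.StreamingAlgorithm) (C : ℝ),
      ∀ (n : ℕ) (ε δ : ℚ), 1 ≤ n → 0 < ε → 0 < δ → δ ≤ 1 →
        ∃ R : ℕ, A.Draws n ε δ R ∧
          -- the algorithm always halts, on initialisation and when it reports
          (∀ r : Fin R → Bool, ∃ s, A.Starts n ε δ r s) ∧
          (∀ (r : Fin R → Bool) (stream : List (DNFStream.DNF n)) (s : List Bool),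
            A.MemoryAfter ε δ r stream s → ∃ c, A.Reports s c) ∧
          -- space, in bits
          (∀ (r : Fin R → Bool) (stream : List (DNFStream.DNF n)) (s : List Bool),
            A.MemoryAfter ε δ r stream s →
              (s.length : ℝ) ≤
                C * n * max 1 (1 / (ε : ℝ) ^ 2) * max 1 (Real.log (1 / (δ : ℝ)))) ∧
          -- processing time per item
          (∀ (r : Fin R → Bool) (stream : List (DNFStream.DNF n)) (s : List Bool),
            A.MemoryAfter ε δ r stream s →
              ∀ φ : DNFStream.DNF n, ∃ (s' : List Bool) (t : ℕ), A.UpdatesWithin s φ s' t ∧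
                (t : ℝ) ≤
                  C * (n : ℝ) ^ 4 * max 1 (φ.length : ℝ) * max 1 (1 / (ε : ℝ) ^ 2) *
                    max 1 (Real.log (1 / (δ : ℝ)))) ∧
          -- correctness
          (∀ stream : List (DNFStream.DNF n),
            1 - (δ : ℝ) ≤ DNFStream.coinProb fun r : Fin R → Bool => A.Succeeds ε δ r stream) := by
  open DNFStream in
  refine ⟨algorithm, 10 ^ 9, fun n ε δ hn hε hδ hδ1 => ⟨numRows δ * (3 * n),
    coins_outputs n ε δ hε hδ, fun r => ?_, fun r stream s h => ?_, fun r stream s h => ?_,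
    fun r stream s h φ => ?_, le_coinProb_succeeds hε hδ⟩⟩
  · obtain ⟨f, hf, hbits⟩ := exists_bijective_bits n (numRows δ)
    obtain ⟨ω, rfl⟩ := hf.2 r
    refine ⟨memory ((seedTapes ω).map fun tp => tp.row (thresh ε)), ?_⟩
    rw [StreamingAlgorithm.Starts, hbits]
    exact init_outputs hε hδ _ (valid_seedTapes ω) (length_seedTapes ω)
  · obtain ⟨tps, rows, -, rfl, h1, h2⟩ := exists_rows hε hδ h
    exact ⟨_, exists_reports h1 h2⟩
  · obtain ⟨tps, rows, ht, rfl, h1, h2⟩ := exists_rows hε hδ h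
    have h3 : (memory rows).length ≤ 36 * n * (thresh ε * numRows δ) := by
      rw [length_memory]
      calc _ ≤ 4 * (numRows δ * (9 * (n * thresh ε))) := by
            rw [← ht]
            exact Nat.mul_le_mul_left 4 ((h1.length_memText h2).trans
              (Nat.mul_le_mul_left _ (rowSize_le hn (thresh_pos ε))))
        _ = _ := by ring
    have h4 := thresh_mul_numRows_le hε hδ hδ1
    calc ((memory rows).length : ℝ) ≤ 36 * n * (thresh ε * numRows δ) := by exact_mod_cast h3
      _ ≤ 36 * n * _ := mul_le_mul_of_nonneg_left h4 (by positivity)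
      _ = 442368 * (n * max 1 (1 / (ε : ℝ) ^ 2) * max 1 (Real.log (1 / (δ : ℝ)))) := by ring
      _ ≤ 10 ^ 9 * (n * max 1 (1 / (ε : ℝ) ^ 2) * max 1 (Real.log (1 / (δ : ℝ)))) :=
        mul_le_mul_of_nonneg_right (by norm_num) (by positivity)
      _ = _ := by ring
  · obtain ⟨tps, rows, ht, rfl, h1, h2⟩ := exists_rows hε hδ h
    refine ⟨_, _, update_outputsWithin h1 h2 φ, ?_⟩
    have h3 := updateTime_le hn (thresh_pos ε) (numRows_pos hδ hδ1) φ.length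
    have h4 := thresh_mul_numRows_le hε hδ hδ1
    rw [← ht] at h3 h4
    refine (Nat.cast_le.2 h3).trans ?_
    push_cast
    calc _ ≤ 10000 * ((n : ℝ) ^ 4 * max 1 (φ.length : ℝ) * _) :=
          mul_le_mul_of_nonneg_left (mul_le_mul_of_nonneg_left h4 (by positivity)) (by norm_num)
      _ = 122880000 * ((n : ℝ) ^ 4 * max 1 (φ.length : ℝ) * max 1 (1 / (ε : ℝ) ^ 2) *
            max 1 (Real.log (1 / (δ : ℝ)))) := by ring
      _ ≤ 10 ^ 9 * ((n : ℝ) ^ 4 * max 1 (φ.length : ℝ) * max 1 (1 / (ε : ℝ) ^ 2) *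
            max 1 (Real.log (1 / (δ : ℝ)))) :=
        mul_le_mul_of_nonneg_right (by norm_num) (by positivity)
      _ = _ := by ring
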